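/- Let $l\ge 2$, $d_1,\dots,d_{l-1}\ge 0$ be integers, $d_l=0$, let $\alpha_1<\dots<\alpha_l$ and $a$ be real, $q(t)=\sum_{j=1}^{l-1}(2a(t-\alpha_j)+d_j+1)\prod_{k\ne j,\,k<l}(t-\alpha_k)$, and assume $q(\alpha_l)\neq 0$ (automatic if $a\ge 0$). Put $p_c(t)=\prod_{j<l}(t-\alpha_j)^{d_j}$, $P(t)=\prod_{j<l}(t-\alpha_j)^{d_j+1}$, $\Delta_j(\alpha)=\prod_{k\neq j,\,k<l}(\alpha_j-\alpha_k)$, $F_1=\dots=F_{l-1}=P$, $F_l(t)=P(t)-e^{2a(\alpha_l-t)}P(\alpha_l)$, and for $j=1,\dots,l$ $$v_j=(-1)^{l-j}\tfrac{2(d_j+1)}{q(\alpha_j)}\big((-1)^r\alpha_j^{l-r}\big)_{r=1}^l\in\mathbb R^l .$$ Let $\mathring D=(-\infty,\alpha_1)\times(\alpha_1,\alpha_2)\times\dots\times(\alpha_{l-2},\alpha_{l-1})\times(\alpha_l,\infty)$, with coordinates $\xi_1,\dots,\xi_l$, and $p_{nc}(t)=\prod_{j\le l}(t-\xi_j)$,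 $\Delta(\xi_j)=\prod_{i\ne j}(\xi_j-\xi_i)$; $\sigma_r$ denotes elementary symmetric polynomials (of the $\xi_i$ unless other variables are given; $\hat{\ }$ means that a variable is omitted). Let $M^0=\mathring D\times\prod_{j=1}^{l}S^{2d_j+1}$, where the second factor is the product of the Hopf bundles $S^{2d_j+1}\to\mathbb{CP}^{d_j}$ of $\mathcal O(-1)$ (unit spheres; a circle for $j=l$), a principal bundle of the torus $\mathbb R^l/2\pi\Gamma_v$, $\Gamma_v=\bigoplus_j\mathbb Zv_j$, with connection form $\theta=(\theta_1,\dots,\theta_l)=\sum_j\eta_j\otimes v_j$, where $\eta_j$ is the standard connection form of the $j$-th Hopf bundle, equal to $1$ on the generator of $z\mapsto e^{it}z$. Let $\check g^0_j$ be the Fubini–Study metric on $\mathbb{CP}^{d_j}$ of scalar curvature $2d_j(d_j+1)$ (twice the quotient metric of the unit sphere) and $g_j=\frac{2(d_j+1)}{(-1)^{l-1-j}q(\alpha_j)}\check g^0_j$. On $M^0$ consider $$g=\sum_{j<l}(-1)^{l-j}p_{nc}(\alpha_j)g_j+\sum_{j\le l}\frac{p_c(\xi_j)\Delta(\xi_j)}{F_j(\xi_j)}d\xi_j^2+\sum_{j\le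 l}\frac{F_j(\xi_j)}{p_c(\xi_j)\Delta(\xi_j)}\Big(\sum_{r=1}^l\sigma_{r-1}(\hat\xi_j)\theta_r\Big)^2,$$ and let $g'$ be obtained from $g$ by replacing $F_l$ with $P$. Put $r_j=2\sqrt{-p_{nc}(\alpha_j)/\Delta_j(\alpha)}$ for $j<l$, $\beta_0=\sum_{r=1}^l\sigma_{r-1}(\alpha_1,\dots,\alpha_{l-1})\theta_r$ and $\beta_i=\sum_{r=2}^l\sigma_{r-2}(\alpha_1,\dots,\hat\alpha_i,\dots,\alpha_{l-1})\theta_r$ for $i<l$. Put $\tau_j=(-1)^{l-j}\prod_{k\neq j,\,k<l}(\alpha_l-\alpha_k)/q(\alpha_l)$ and let $\tau\in\mathbb T^{l-1}=\mathbb R^{l-1}/\mathbb Z^{l-1}$ be the class of $(\tau_j)_{j<l}$, where the class of $t\in\mathbb R^{l-1}$ acts on $\prod_{j<l}\mathbb C^{d_j+1}$ by $e^{2\pi i t_j}$ on the $j$-th factor. Let $\Lambda$ be the closure of the subgroup generated by $\tau$. 1. $g'$ is a Riemannian metric on $M^0$, and $$g'=(d\sigma_1)^2+\beta_0^2+\sum_{j<l}g_{\mathbb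 R^{2d_j+2}},\qquad g_{\mathbb R^{2d_j+2}}:=dr_j^2+r_j^2\cdot\tfrac14(2\check g_j^0+\beta_j^2).$$ Locally on $M^0$, $\beta_0$ is the differential of a smooth function, and $g_{\mathbb R^{2d_j+2}}$ is the pull-back of the Euclidean metric by a smooth map to $\mathbb C^{d_j+1}$ of norm $r_j$. In particular $g'$ is locally flat. 2. Let $\mathbb Z$ act on $\prod_{j<l}\mathbb C^{d_j+1}\times\mathbb R$, its generator acting by $\tau$ on the first factor and by the translation by $-2\pi\cdot\frac{2}{q(\alpha_l)}\prod_{k<l}(\alpha_l-\alpha_k)$ on the second. This action is free and properly discontinuous, and $E=\big((\prod_{j<l}\mathbb C^{d_j+1}\times\mathbb R)/\mathbb Z\big)\times\mathbb R$ with the quotient of the Euclidean metric is complete, geodesic and locally isometric to Euclidean space. There is a smooth isometric embedding of $(M^0,g')$ onto the open subset of $E$ given by $r_j>0$ for $j<l$ and $$\frac14\sum_{j<l}\frac{1}{\alpha_l-\alpha_j}r_j^2>-\sigma,$$ where $r_j$ is the radius in $\mathbb C^{d_j+1}$ and $\sigma$ is the coordinate of the last factor $\mathbb R$. Under the embedding,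 these $r_j$ correspond to the functions $r_j$ on $M^0$, and $\sigma$ to $\sigma_1-\sum_{k\le l}\alpha_k$. 3. $E$ has a unique asymptotic cone, the proper metric space $C=\big(\prod_{j<l}\mathbb C^{d_j+1}/\Lambda\big)\times\mathbb R$ with the quotient metric and vertex $0$: for every base point $p\in E$ and every sequence $\lambda_i>0$ with $\lambda_i\to0$, the pointed spaces $(E,\lambda_i d_E,p)$ converge to $(C,0)$ in the pointed Gromov–Hausdorff sense, and every proper pointed metric space that is the pointed Gromov–Hausdorff limit of $(E,\lambda_id_E,p)$ for some such $p$ and $\lambda_i$ is isometric to $C$ by an isometry that preserves the base points. -/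

import Mathlib

noncomputable section

namespace TaubNUT

/-! ### Quotients of metric spaces by groups of isometries -/

section Orbit

variable {X : Type*} [PseudoMetricSpace X]

/-- Two points are equivalent if an element of the group `G` of isometries maps one to the other. -/
def orbitSetoid (G : Subgroup (X ≃ᵢ X)) : Setoid X where
  r x y := ∃ g ∈ G, g x = y
  iseqv :=
    { refl := fun x => ⟨1, G.one_mem, rfl⟩
      symm := by
        rintro x y ⟨g, hg, rfl⟩
        exact ⟨g⁻¹, G.inv_mem hg, g.symm_apply_apply x⟩
      trans := by
        rintro x y z ⟨g, hg, rfl⟩ ⟨h, hh, rfl⟩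
        exact ⟨h * g, G.mul_mem hh hg, rfl⟩ }

/-- The orbit space `X / G`. -/
def OrbitSpace (G : Subgroup (X ≃ᵢ X)) : Type _ := Quotient (orbitSetoid G)

/-- The projection `X → X / G`. -/
def OrbitSpace.mk (G : Subgroup (X ≃ᵢ X)) (x : X) : OrbitSpace G :=
  Quotient.mk (orbitSetoid G) x

/-- The distance of `x` to the orbit of `y`. -/
def orbitDist (G : Subgroup (X ≃ᵢ X)) (x y : X) : ℝ := ⨅ g : G, dist x (g.1 y)

theorem orbitDist_bddBelow (G : Subgroup (X ≃ᵢ X)) (x y : X) :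
    BddBelow (Set.range fun g : G => dist x (g.1 y)) :=
  ⟨0, by rintro _ ⟨g, rfl⟩; exact dist_nonneg⟩

theorem orbitDist_comm (G : Subgroup (X ≃ᵢ X)) (x y : X) : orbitDist G x y = orbitDist G y x := by
  have key : ∀ x y : X, orbitDist G x y ≤ orbitDist G y x := by
    intro x y
    refine le_ciInf fun g => ?_
    refine (ciInf_le (orbitDist_bddBelow G x y) g⁻¹).trans (le_of_eq ?_)
    have h : (g⁻¹ : G).1 y = g.1.symm y := rfl
    rw [h, ← g.1.isometry.dist_eq, g.1.apply_symm_apply, dist_comm]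
  exact le_antisymm (key x y) (key y x)

theorem orbitDist_apply (G : Subgroup (X ≃ᵢ X)) (x y : X) (h : G) :
    orbitDist G x (h.1 y) = orbitDist G x y := by
  refine le_antisymm (le_ciInf fun g => ?_) (le_ciInf fun g => ?_)
  · refine (ciInf_le (orbitDist_bddBelow G x (h.1 y)) (g * h⁻¹)).trans (le_of_eq ?_)
    have e : (g * h⁻¹ : G).1 (h.1 y) = g.1 (h.1.symm (h.1 y)) := rfl
    rw [e, h.1.symm_apply_apply]
  · exact ciInf_le (orbitDist_bddBelow G x y) (g * h)

/-- The quotient distance on `X / G`: the distance between the orbits. -/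
instance (G : Subgroup (X ≃ᵢ X)) : Dist (OrbitSpace G) where
  dist := Quotient.lift₂ (orbitDist G) (by
    rintro x y _ _ ⟨g, hg, rfl⟩ ⟨h, hh, rfl⟩
    exact ((orbitDist_apply G (g x) y ⟨h, hh⟩).trans ((orbitDist_comm G (g x) y).trans
      ((orbitDist_apply G y x ⟨g, hg⟩).trans (orbitDist_comm G y x)))).symm)

theorem dist_mk (G : Subgroup (X ≃ᵢ X)) (x y : X) :
    dist (OrbitSpace.mk G x) (OrbitSpace.mk G y) = ⨅ g : G, dist x (g.1 y) := rfl

instance (G : Subgroup (X ≃ᵢ X)) : PseudoMetricSpace (OrbitSpace G) where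
  dist_self := by
    rintro ⟨x⟩
    refine le_antisymm ?_ (Real.iInf_nonneg fun _ => dist_nonneg)
    exact (ciInf_le (orbitDist_bddBelow G x x) 1).trans (le_of_eq (dist_self x))
  dist_comm := by
    rintro ⟨x⟩ ⟨y⟩
    exact orbitDist_comm G x y
  dist_triangle := by
    rintro ⟨x⟩ ⟨y⟩ ⟨z⟩
    refine le_ciInf_add_ciInf fun g h => ?_
    refine (ciInf_le (orbitDist_bddBelow G x z) (g * h)).trans ?_
    have e : (g * h : G).1 z = g.1 (h.1 z) := rfl
    rw [e, ← g.1.isometry.dist_eq y (h.1 z)]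
    exact dist_triangle _ _ _

end Orbit

/-! ### Pointed Gromov-Hausdorff limits of rescalings and asymptotic cones -/

section Cone

open Filter Topology

/-- The rescaled pointed spaces `(X, c i • dist, p)` converge to `(Y, y)` in the pointed
Gromov-Hausdorff sense: for all `R, ε > 0` and all large `i` there is a map from the ball of
radius `R` about `p` to `Y` that sends `p` to `y`, has distortion less than `ε`, and whose image
has an `ε`-neighbourhood that contains the ball of radius `R - ε` about `y`. -/
def RescalingsConverge (X : Type*) [PseudoMetricSpace X] (p : X) (c : ℕ → ℝ)
    (Y : Type*) [PseudoMetricSpace Y] (y : Y) : Prop :=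
  ∀ R : ℝ, 0 < R → ∀ ε : ℝ, 0 < ε → ∀ᶠ i in atTop, ∃ f : X → Y, f p = y ∧
    (∀ a b : X, c i * dist p a < R → c i * dist p b < R →
      |dist (f a) (f b) - c i * dist a b| < ε) ∧
    ∀ z : Y, dist y z < R - ε → ∃ a : X, c i * dist p a < R ∧ dist (f a) z < ε

/-- `(Y, y)` is an asymptotic cone of `X`: a pointed Gromov-Hausdorff limit of `X` rescaled by
factors that tend to `0`, about some base point. -/
def IsAsymptoticCone (X : Type*) [PseudoMetricSpace X]
    (Y : Type*) [PseudoMetricSpace Y] (y : Y) : Prop :=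
  ∃ (p : X) (c : ℕ → ℝ), (∀ i, 0 < c i) ∧ Tendsto c atTop (𝓝 0) ∧ RescalingsConverge X p c Y y

end Cone

/-! ### The parameters and the polynomials -/

/-- `q(t) = ∑ⱼ (2a(t - αⱼ) + (dⱼ + 1)) ∏_{k ≠ j} (t - αₖ)`, with `j`, `k` from `1` to `l - 1 = m`. -/
def qPoly {m : ℕ} (d : Fin m → ℕ) (α : Fin (m + 1) → ℝ) (a t : ℝ) : ℝ :=
  ∑ j : Fin m, (2 * a * (t - α j.castSucc) + (d j + 1)) *
    ∏ k ∈ Finset.univ.erase j, (t - α k.castSucc)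

/-- The parameters, with `l = m + 1 ≥ 2`. The index `j ∈ {1, …, l}` is `j - 1 : Fin (m + 1)` in the
code, and the last index `l` is `Fin.last m`. The condition `q(α_l) ≠ 0`, which the definition of
`v_l` needs, holds automatically for `a ≥ 0`. -/
structure Data where
  m : ℕ
  one_le_m : 1 ≤ m
  d : Fin m → ℕ
  α : Fin (m + 1) → ℝ
  strictMono_α : StrictMono α
  a : ℝ
  q_ne_zero : qPoly d α a (α (Fin.last m)) ≠ 0

variable (D : Data)

/-- `d_1, …, d_{l-1}` extended by `d_l = 0`. -/
def Data.dExt : Fin (D.m + 1) → ℕ := Fin.lastCases 0 D.d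

/-- `α_l`. -/
def Data.αl : ℝ := D.α (Fin.last D.m)

/-- The polynomial `q`. -/
def Data.q (t : ℝ) : ℝ := qPoly D.d D.α D.a t

/-- `p_c(t) = ∏_{j<l} (t - αⱼ)^{dⱼ}`. -/
def Data.pc (t : ℝ) : ℝ := ∏ j : Fin D.m, (t - D.α j.castSucc) ^ D.d j

/-- `P(t) = ∏_{j<l} (t - αⱼ)^{dⱼ+1}`. -/
def Data.P (t : ℝ) : ℝ := ∏ j : Fin D.m, (t - D.α j.castSucc) ^ (D.d j + 1)

/-- `F_1 = ⋯ = F_{l-1} = P` and `F_l(t) = P(t) - e^{2a(α_l - t)} P(α_l)`. -/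
def Data.F (j : Fin (D.m + 1)) (t : ℝ) : ℝ :=
  if j = Fin.last D.m then D.P t - Real.exp (2 * D.a * (D.αl - t)) * D.P D.αl else D.P t

/-- `Δⱼ(α_1, …, α_{l-1}) = ∏_{k ≠ j, k < l} (αⱼ - αₖ)`. -/
def Data.Δα (j : Fin D.m) : ℝ :=
  ∏ k ∈ Finset.univ.erase j, (D.α j.castSucc - D.α k.castSucc)

/-- `p_nc(t) = ∏ⱼ (t - ξⱼ)`. -/
def pnc {n : ℕ} (ξ : Fin n → ℝ) (t : ℝ) : ℝ := ∏ j, (t - ξ j)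

/-- `Δ(ξⱼ) = ∏_{i ≠ j} (ξⱼ - ξᵢ)`. -/
def Δξ {n : ℕ} (ξ : Fin n → ℝ) (j : Fin n) : ℝ := ∏ i ∈ Finset.univ.erase j, (ξ j - ξ i)

/-- The `r`-th elementary symmetric polynomial of the `x i`, `i ∈ s`. -/
def sym {ι : Type*} (s : Finset ι) (x : ι → ℝ) (r : ℕ) : ℝ := (s.val.map x).esymm r

/-- The vector `vⱼ = (-1)^{l-j} 2(dⱼ+1)/q(αⱼ) (-αⱼ^{l-1}, …, (-1)^r αⱼ^{l-r}, …, (-1)^l)`. -/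
def Data.v (j : Fin (D.m + 1)) : Fin (D.m + 1) → ℝ := fun r =>
  (-1) ^ (D.m - (j : ℕ)) * (2 * (D.dExt j + 1) / D.q (D.α j)) *
    ((-1) ^ ((r : ℕ) + 1) * D.α j ^ (D.m - (r : ℕ)))

/-- `τⱼ = (-1)^{l-j} ∏_{k ≠ j, k < l} (α_l - αₖ) / q(α_l)`. -/
def Data.τ (j : Fin D.m) : ℝ :=
  (-1) ^ (D.m - (j : ℕ)) * (∏ k ∈ Finset.univ.erase j, (D.αl - D.α k.castSucc)) / D.q D.αl

/-! ### The manifold `M⁰` and the metric `g'`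

`P` is the principal bundle of the torus `ℝ^l / 2πΓ_v` over `∏_{j<l} ℂP^{dⱼ}` that is associated
with `⨁_{j ≤ l} O(-1)` (where `ℂP^{d_l}` is a point), that is, the product of the Hopf bundles
`S^{2dⱼ+1} → ℂP^{dⱼ}`, `j < l`, and of the circle. So `M⁰ = D° × ∏_{j<l} S^{2dⱼ+1} × S¹` is a
submanifold of the vector space `ℝ^l × ∏_{j<l} ℂ^{dⱼ+1} × ℂ`. -/

/-- The vector space `ℝ^l × ∏_{j<l} ℂ^{dⱼ+1} × ℂ`. -/
abbrev Data.W : Type :=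
  (Fin (D.m + 1) → ℝ) × ((j : Fin D.m) → EuclideanSpace ℂ (Fin (D.d j + 1))) × ℂ

/-- `D° = (-∞, α_1) × (α_1, α_2) × ⋯ × (α_{l-2}, α_{l-1}) × (α_l, ∞)`. -/
def Data.domain : Set (Fin (D.m + 1) → ℝ) :=
  {ξ | (∀ j : Fin D.m, ξ j.castSucc < D.α j.castSucc) ∧
    (∀ j k : Fin D.m, (j : ℕ) + 1 = k → D.α j.castSucc < ξ k.castSucc) ∧
    D.αl < ξ (Fin.last D.m)}

/-- The manifold `M⁰`; its points are the triples `(ξ, z, w)`. -/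
def Data.M0 : Set D.W := {x | x.1 ∈ D.domain ∧ (∀ j, ‖x.2.1 j‖ = 1) ∧ ‖x.2.2‖ = 1}

/-- The tangent space of `M⁰` at `x`. -/
def Data.tangent (x : D.W) : Set D.W :=
  {u | (∀ j, inner ℝ (x.2.1 j) (u.2.1 j) = 0) ∧ inner ℝ x.2.2 u.2.2 = 0}

/-- The connection form of the Hopf bundle `S^{2dⱼ+1} → ℂP^{dⱼ}` (for `j < l`), respectively the
angular form of the circle (for `j = l`): it is `1` on the generator of `z ↦ e^{it} z`. -/
def Data.η (x u : D.W) : Fin (D.m + 1) → ℝ :=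
  Fin.lastCases (inner ℂ x.2.2 u.2.2).im (fun j => (inner ℂ (x.2.1 j) (u.2.1 j)).im)

/-- The connection form `θ = ∑ⱼ ηⱼ ⊗ vⱼ` on `P`; `dθ = ∑ⱼ ω̌ⱼ⁰ ⊗ vⱼ`. -/
def Data.θ (x u : D.W) (r : Fin (D.m + 1)) : ℝ := ∑ j, D.η x u j * D.v j r

/-- (The pull-back of) the Fubini-Study metric `ǧⱼ⁰` on `ℂP^{dⱼ}` of scalar curvature `2dⱼ(dⱼ+1)`:
twice the horizontal part of the round metric of the unit sphere. -/
def Data.gFS (j : Fin D.m) (x u u' : D.W) : ℝ :=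
  2 * (inner ℝ (u.2.1 j) (u'.2.1 j) - D.η x u j.castSucc * D.η x u' j.castSucc)

/-- The multiple `2(dⱼ+1) / ((-1)^{l-1-j} q(αⱼ)) ǧⱼ⁰` of the Fubini-Study metric. -/
def Data.gKE (j : Fin D.m) (x u u' : D.W) : ℝ :=
  2 * (D.d j + 1) / ((-1) ^ (D.m - 1 - (j : ℕ)) * D.q (D.α j.castSucc)) * D.gFS j x u u'

/-- The metric on `M⁰` given by the functions `F_1, …, F_l`,
`∑_{j<l} (-1)^{l-j} p_nc(αⱼ) gⱼ + ∑ⱼ p_c(ξⱼ)Δ(ξⱼ)/Fⱼ(ξⱼ) dξⱼ²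
  + ∑ⱼ Fⱼ(ξⱼ)/(p_c(ξⱼ)Δ(ξⱼ)) (∑ᵣ σ_{r-1}(ξ̂ⱼ) θᵣ)²`. -/
def Data.metric (F : Fin (D.m + 1) → ℝ → ℝ) (x u u' : D.W) : ℝ :=
  (∑ j : Fin D.m, (-1) ^ (D.m - (j : ℕ)) * pnc x.1 (D.α j.castSucc) * D.gKE j x u u') +
  (∑ j, D.pc (x.1 j) * Δξ x.1 j / F j (x.1 j) * (u.1 j * u'.1 j)) +
  ∑ j, F j (x.1 j) / (D.pc (x.1 j) * Δξ x.1 j) *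
    ((∑ r : Fin (D.m + 1), sym (Finset.univ.erase j) x.1 r * D.θ x u r) *
     (∑ r : Fin (D.m + 1), sym (Finset.univ.erase j) x.1 r * D.θ x u' r))

/-- The metric `g` of the Kähler-Ricci soliton. -/
def Data.gSoliton : D.W → D.W → D.W → ℝ := D.metric D.F

/-- The metric `g'`: `F_l` is replaced with `P`. -/
def Data.gPrime : D.W → D.W → D.W → ℝ :=
  D.metric (Function.update D.F (Fin.last D.m) D.P)

/-- The function `σ_1 = ξ_1 + ⋯ + ξ_l`. -/
def Data.σ₁ (x : D.W) : ℝ := sym Finset.univ x.1 1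

/-- The function `rⱼ = 2 √(-p_nc(αⱼ) / Δⱼ(α_1, …, α_{l-1}))`. -/
def Data.r (j : Fin D.m) (x : D.W) : ℝ := 2 * √(-pnc x.1 (D.α j.castSucc) / D.Δα j)

/-- The form `β_0 = ∑ᵣ σ_{r-1}(α_1, …, α_{l-1}) θᵣ`. -/
def Data.β₀ (x u : D.W) : ℝ :=
  ∑ r : Fin (D.m + 1),
    sym (Finset.univ : Finset (Fin D.m)) (fun k => D.α k.castSucc) r * D.θ x u r

/-- The form `βᵢ = ∑_{r ≥ 2} σ_{r-2}(α_1, …, α̂ᵢ, …, α_{l-1}) θᵣ`, for `i < l`. -/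
def Data.β (i : Fin D.m) (x u : D.W) : ℝ :=
  ∑ r : Fin D.m, sym (Finset.univ.erase i) (fun k => D.α k.castSucc) r * D.θ x u r.succ

/-- The tensor `drⱼ² + rⱼ² · ¼ (2 ǧⱼ⁰ + βⱼ²)`, the metric of the cone over the unit sphere
`S^{2dⱼ+1}` with its metric `¼ (2 ǧⱼ⁰ + βⱼ²)`. -/
def Data.gCone (j : Fin D.m) (x u u' : D.W) : ℝ :=
  fderiv ℝ (D.r j) x u * fderiv ℝ (D.r j) x u' +
    D.r j x ^ 2 * (1 / 4 * (2 * D.gFS j x u u' + D.β j x u * D.β j x u'))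

/-! ### The flat manifold `E = ((∏ ℂ^{dⱼ+1} × ℝ) / ℤ) × ℝ` and its asymptotic cone -/

/-- The Euclidean space `∏_{j<l} ℂ^{dⱼ+1}`. -/
abbrev Data.V : Type := PiLp 2 fun j : Fin D.m => EuclideanSpace ℂ (Fin (D.d j + 1))

/-- The action of the torus on `∏_{j<l} ℂ^{dⱼ+1}`, by rotation of each factor. Here the torus
`ℝ^{l-1} / ℤ^{l-1}` is written as `(S¹)^{l-1}`, the class of `t` being `(e^{2πi tⱼ})ⱼ`. -/
def Data.rotation : (Fin D.m → Circle) →* (D.V ≃ᵢ D.V) where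
  toFun t :=
    { toFun := fun x => WithLp.toLp 2 fun j => t j • x j
      invFun := fun x => WithLp.toLp 2 fun j => (t j)⁻¹ • x j
      left_inv := fun x => by ext j k; simp
      right_inv := fun x => by ext j k; simp
      isometry_toFun := Isometry.of_dist_eq fun x y => by
        rw [PiLp.dist_eq_of_L2, PiLp.dist_eq_of_L2]
        refine congrArg Real.sqrt (Finset.sum_congr rfl fun j _ => ?_)
        change dist (t j • x j) (t j • y j) ^ 2 = _
        rw [dist_eq_norm, dist_eq_norm, ← smul_sub, Circle.smul_def, norm_smul, Circle.norm_coe,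
          one_mul] }
  map_one' := by ext x j k; simp
  map_mul' s t := by ext x j k; simp [mul_smul]

/-- `τ` as an element of the torus. -/
def Data.τTorus : Fin D.m → Circle := fun j => Circle.exp (2 * Real.pi * D.τ j)

/-- `Λ`, the closure of the subgroup of the torus generated by `τ`. -/
def Data.Λ : Subgroup (Fin D.m → Circle) := (Subgroup.zpowers D.τTorus).topologicalClosure

/-- The translation length `-2π · 2 ∏_{k<l} (α_l - αₖ) / q(α_l)`. -/
def Data.shift : ℝ :=
  -(2 * Real.pi) * (2 / D.q D.αl * ∏ k : Fin D.m, (D.αl - D.α k.castSucc))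

/-- The generator of the `ℤ`-action on `∏ ℂ^{dⱼ+1} × ℝ`: `τ` on the first factor and a translation
on the second one. -/
def Data.gen : WithLp 2 (D.V × ℝ) ≃ᵢ WithLp 2 (D.V × ℝ) where
  toFun y := WithLp.toLp 2 (D.rotation D.τTorus y.fst, y.snd + D.shift)
  invFun y := WithLp.toLp 2 ((D.rotation D.τTorus).symm y.fst, y.snd - D.shift)
  left_inv y := by simp; rfl
  right_inv y := by simp; rfl
  isometry_toFun := Isometry.of_dist_eq fun x y => by
    simp [WithLp.prod_dist_eq_of_L2, (D.rotation D.τTorus).isometry.dist_eq]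

/-- The Euclidean space `∏ ℂ^{dⱼ+1} × ℝ × ℝ`. -/
abbrev Data.Euc : Type := WithLp 2 (WithLp 2 (D.V × ℝ) × ℝ)

/-- The flat manifold `E = ((∏ ℂ^{dⱼ+1} × ℝ) / ℤ) × ℝ`. -/
abbrev Data.E : Type := WithLp 2 (OrbitSpace (Subgroup.zpowers D.gen) × ℝ)

/-- The covering map from the Euclidean space to `E`. -/
def Data.proj (y : D.Euc) : D.E := WithLp.toLp 2 (OrbitSpace.mk _ y.fst, y.snd)

/-- The radius of the `j`-th component in `ℂ^{dⱼ+1}`. -/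
def Data.radius (j : Fin D.m) (y : D.Euc) : ℝ := ‖y.fst.fst j‖

/-- The space `(∏ ℂ^{dⱼ+1} / Λ) × ℝ`. -/
abbrev Data.Cone : Type := WithLp 2 (OrbitSpace (D.Λ.map D.rotation) × ℝ)

/-- The vertex of `(∏ ℂ^{dⱼ+1} / Λ) × ℝ`. -/
def Data.apex : D.Cone := WithLp.toLp 2 (OrbitSpace.mk _ 0, 0)

/-- `Φ : M⁰ → E` is a smooth isometric immersion of `(M⁰, g')`: locally `Φ` lifts to a smooth map
into the Euclidean space that pulls the Euclidean metric back to `g'`. -/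
def Data.IsIsometricImmersion (Φ : D.M0 → D.E) : Prop :=
  ∀ x₀ ∈ D.M0, ∃ (N : Set D.W) (φ : D.W → D.Euc), IsOpen N ∧ x₀ ∈ N ∧
    ContDiffOn ℝ (⊤ : ℕ∞) φ N ∧ ∀ (x : D.W) (hx : x ∈ D.M0), x ∈ N →
      D.proj (φ x) = Φ ⟨x, hx⟩ ∧ ∀ u ∈ D.tangent x, ∀ u' ∈ D.tangent x,
        inner ℝ (fderiv ℝ φ x u) (fderiv ℝ φ x u') = D.gPrime x u u'

end TaubNUT

end

/-!
In the coordinates `ξ`, the polynomial `p_nc(t) = ∏ⱼ (t - ξⱼ)` is monic of degree `l`, and it is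
determined by `σ₁` and by its values at `α_1, …, α_{l-1}`, that is, by `σ₁` and the radii `rⱼ`.
Lagrange interpolation at the `αⱼ` turns the metric `g'` into a diagonal form in two steps. The part
in the directions of the `ξⱼ` becomes `dσ₁² + ∑ drⱼ²` (`sum_Δξ_div_A_mul`), and dually the part in
the directions of the torus becomes `β₀² + ∑ rⱼ² βⱼ² / 4` (`sum_A_div_Δξ_mul_sub`). Vieta's formula
gives `β₀ = κ η_l` and `βⱼ = ± 2 (ηⱼ + τⱼ η_l)` for the Hopf connection forms `ηⱼ`. Hence, if `t` is
a local choice of the angle of the last circle, then `s = κ t` is a primitive of `β₀`, and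
`ζⱼ = rⱼ e^{i τⱼ t} zⱼ` pulls the Euclidean metric of `ℂ^{dⱼ+1}` back to the `j`-th cone metric
(`inner_fderiv_ζ`). This shows that `g'` is flat.

When the angle `t` grows by `2π`, the flat coordinates change by the generator of the `ℤ`-action.
So `(ζ, s, σ₁ - ∑ αₖ)` is a well-defined map from `M⁰` to `E`. Its inverse is explicit: the `ξⱼ` are
the roots of the polynomial with prescribed `σ₁` and `rⱼ`. Between two neighbours among the `αₖ` the
quotient `p_nc / A`, where `A(t) = ∏_{k<l} (t - αₖ)`, runs from `-∞` to `∞`, which yields a root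
there, and on `(α_l, ∞)` the root exists if the quotient is negative at `α_l`, which is the
inequality that describes the image (`exists_pnc_eq_poly`). The sign of the quotient shows that the
roots depend continuously on the parameters (`continuousOn_roots`), and so the map is an open
embedding.

The distance of `E` differs from the one of `(∏ ℂ^{dⱼ+1} / Λ) × ℝ` only by bounded terms and by the
error made when elements of `Λ` are approximated by powers `τⁿ`. As `Λ` is compact, boundedly many
powers suffice for a given precision, so the difference vanishes under rescaling
(`mul_dist_proj_le`, `rescalingsConverge`). Uniqueness of the cone is the uniqueness of pointed
Gromov-Hausdorff limits among proper spaces, for which limits along an ultrafilter are taken of the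
almost isometries between two limit spaces (`RescalingsConverge.exists_isometryEquiv`).
-/

noncomputable section

namespace TaubNUT

/-! ### Orbit spaces -/

section OrbitLemmas

open Filter Topology

variable {X : Type*} [PseudoMetricSpace X] (G : Subgroup (X ≃ᵢ X))

theorem OrbitSpace.mk_surjective : Function.Surjective (OrbitSpace.mk G) := Quotient.mk_surjective

variable {G} in
theorem OrbitSpace.mk_eq_mk {x y : X} : OrbitSpace.mk G x = OrbitSpace.mk G y ↔ ∃ g ∈ G, g x = y :=
  Quotient.eq (r := orbitSetoid G)

variable {G} in
theorem dist_mk_le {g : X ≃ᵢ X} (hg : g ∈ G) (x y : X) :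
    dist (OrbitSpace.mk G x) (OrbitSpace.mk G y) ≤ dist x (g y) :=
  ciInf_le (orbitDist_bddBelow G x y) ⟨g, hg⟩

theorem dist_mk_le_dist (x y : X) : dist (OrbitSpace.mk G x) (OrbitSpace.mk G y) ≤ dist x y :=
  dist_mk_le G.one_mem x y

theorem OrbitSpace.continuous_mk : Continuous (OrbitSpace.mk G) :=
  (LipschitzWith.of_dist_le_mul (K := 1) fun x y => by simpa using dist_mk_le_dist G x y).continuous

variable {G} in
theorem exists_dist_lt_of_dist_mk_lt {x y : X} {r : ℝ}
    (h : dist (OrbitSpace.mk G x) (OrbitSpace.mk G y) < r) : ∃ g ∈ G, dist x (g y) < r := by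
  obtain ⟨g, hg⟩ := exists_lt_of_ciInf_lt h
  exact ⟨g.1, g.2, hg⟩

/-- A closed ball of the quotient is a closed subset of the image of a larger closed ball. -/
instance [ProperSpace X] : ProperSpace (OrbitSpace G) where
  isCompact_closedBall := by
    intro z r
    obtain ⟨x, rfl⟩ := OrbitSpace.mk_surjective G z
    refine ((isCompact_closedBall x (r + 1)).image (OrbitSpace.continuous_mk G)).of_isClosed_subset
      Metric.isClosed_closedBall fun w hw => ?_
    obtain ⟨y, rfl⟩ := OrbitSpace.mk_surjective G w
    rw [Metric.mem_closedBall, dist_comm] at hw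
    obtain ⟨g, hg, h⟩ := exists_dist_lt_of_dist_mk_lt (lt_of_le_of_lt hw (lt_add_one r))
    exact ⟨g y, by rw [Metric.mem_closedBall, dist_comm]; exact h.le,
      OrbitSpace.mk_eq_mk.2 ⟨g⁻¹, G.inv_mem hg, g.symm_apply_apply y⟩⟩

end OrbitLemmas

theorem dist_withLp {α β : Type*} [PseudoMetricSpace α] [PseudoMetricSpace β]
    (x y : WithLp 2 (α × β)) : dist x y = √(dist x.fst y.fst ^ 2 + dist x.snd y.snd ^ 2) := by
  rw [WithLp.prod_dist_eq_add (by norm_num), Real.sqrt_eq_rpow]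
  norm_num

instance {α β : Type*} [PseudoMetricSpace α] [PseudoMetricSpace β] [ProperSpace α]
    [ProperSpace β] : ProperSpace (WithLp 2 (α × β)) where
  isCompact_closedBall := by
    intro x r
    have hK := ((isCompact_closedBall x.fst r).prod (isCompact_closedBall x.snd r)).image
      (WithLp.prod_continuous_toLp 2 α β)
    refine hK.of_isClosed_subset Metric.isClosed_closedBall fun y hy => ⟨y.ofLp, ?_, rfl⟩
    have h := hy.out
    rw [dist_withLp] at h
    refine ⟨le_trans (Real.le_sqrt_of_sq_le ?_) h, le_trans (Real.le_sqrt_of_sq_le ?_) h⟩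
    · exact le_add_of_nonneg_right (sq_nonneg (dist y.snd x.snd))
    · exact le_add_of_nonneg_left (sq_nonneg (dist y.fst x.fst))

/-! ### Uniqueness of pointed Gromov-Hausdorff limits -/

section Limits

open Filter Topology

/-- Maps between proper spaces that are almost isometric and almost inverse to each other yield an
isometry, as their limits along an ultrafilter. -/
theorem exists_isometryEquiv_of_approx {Y Z : Type*} [MetricSpace Y] [ProperSpace Y]
    [PseudoMetricSpace Z] [ProperSpace Z] (hZ : ∀ a b : Z, dist a b = 0 → a = b) (y : Y) (z : Z)
    (h : ℕ → Y → Z) (k : ℕ → Z → Y)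
    (hh : ∀ a b, Tendsto (fun n => dist (h n a) (h n b)) atTop (𝓝 (dist a b)))
    (hy : Tendsto (fun n => dist (h n y) z) atTop (𝓝 0))
    (hk : ∀ a : Z, ∃ r, ∀ᶠ n in atTop, dist (k n a) y ≤ r)
    (hhk : ∀ a, Tendsto (fun n => dist (h n (k n a)) a) atTop (𝓝 0))
    (hd : ∀ r δ, 0 < δ → ∀ᶠ n in atTop, ∀ a b, dist a y ≤ r → dist b y ≤ r →
      dist (h n a) (h n b) ≤ dist a b + δ) :
    ∃ e : Y ≃ᵢ Z, e y = z := by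
  let U : Ultrafilter ℕ := hyperfilter ℕ
  have hU : (U : Filter ℕ) ≤ atTop := Nat.hyperfilter_le_atTop
  -- limits along the ultrafilter of sequences that stay in a ball
  have lim {W : Type _} [PseudoMetricSpace W] [ProperSpace W] (w : ℕ → W) (c : W) (r : ℝ)
      (hw : ∀ᶠ n in atTop, dist (w n) c ≤ r) : ∃ v, Tendsto w U (𝓝 v) := by
    obtain ⟨v, -, hv⟩ := (isCompact_closedBall c r).ultrafilter_le_nhds (U.map w)
      (le_principal_iff.2 (hU hw))
    exact ⟨v, hv⟩
  have hbdd : ∀ a, ∀ᶠ n in atTop, dist (h n a) z ≤ dist a y + 1 := fun a => by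
    have ht := (hh a y).add hy
    filter_upwards [ht.eventually_lt_const (u := dist a y + 1) (by linarith)] with n hn
    exact (dist_triangle _ (h n y) _).trans hn.le
  choose H hH using fun a => lim (fun n => h n a) z (dist a y + 1) (hbdd a)
  have hKex : ∀ a : Z, ∃ b, Tendsto (fun n => k n a) U (𝓝 b) := fun a => by
    obtain ⟨r, hr⟩ := hk a
    obtain ⟨v, -, hv⟩ := (isCompact_closedBall y r).ultrafilter_le_nhds (U.map fun n => k n a)
      (le_principal_iff.2 (hU hr))
    exact ⟨v, hv⟩
  choose K hK using hKex
  have hiso : Isometry H := Isometry.of_dist_eq fun a b =>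
    tendsto_nhds_unique ((hH a).dist (hH b)) ((hh a b).mono_left hU)
  have hHK : ∀ a, H (K a) = a := fun a => by
    refine hZ _ _ ?_
    obtain ⟨r, hr⟩ := hk a
    refine le_antisymm (le_of_forall_pos_le_add fun δ hδ => ?_) dist_nonneg
    -- `dist (h n (K a)) a ≤ (dist (K a) (k n a) + δ) + dist (h n (k n a)) a`
    have t1 : Tendsto (fun n => dist (h n (K a)) a) U (𝓝 (dist (H (K a)) a)) :=
      (hH (K a)).dist tendsto_const_nhds
    have t2 : Tendsto (fun n => dist (K a) (k n a) + δ + dist (h n (k n a)) a) U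
        (𝓝 (dist (K a) (K a) + δ + 0)) :=
      ((tendsto_const_nhds.dist (hK a)).add_const δ).add ((hhk a).mono_left hU)
    rw [dist_self, zero_add, add_zero] at t2
    rw [zero_add]
    refine le_of_tendsto_of_tendsto t1 t2 ?_
    filter_upwards [hU hr, hU (hd (max r (dist (K a) y)) δ hδ)] with n h1 h2
    exact (dist_triangle _ (h n (k n a)) _).trans
      (add_le_add_left (h2 _ _ (le_max_right _ _) (h1.trans (le_max_left _ _))) _)
  refine ⟨IsometryEquiv.mk' H K hHK hiso, hZ _ _ ?_⟩
  exact tendsto_nhds_unique ((hH y).dist tendsto_const_nhds) (hy.mono_left hU)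

/-- Pointed Gromov-Hausdorff limits are unique among proper spaces. -/
theorem RescalingsConverge.exists_isometryEquiv {X Y Z : Type*} [PseudoMetricSpace X]
    [MetricSpace Y] [ProperSpace Y] [PseudoMetricSpace Z] [ProperSpace Z]
    (hZ : ∀ a b : Z, dist a b = 0 → a = b) {p : X} {c : ℕ → ℝ} {y : Y} {z : Z}
    (hXY : RescalingsConverge X p c Y y) (hXZ : RescalingsConverge X p c Z z)  :
    ∃ e : Y ≃ᵢ Z, e y = z := by
  have hε : ∀ n : ℕ, (0 : ℝ) < 1 / (n + 1) := fun n => Nat.one_div_pos_of_nat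
  have hex : ∀ n : ℕ, ∃ (i : ℕ) (f : X → Y) (g : X → Z), (f p = y ∧
      (∀ a b : X, c i * dist p a < (n + 1 : ℝ) → c i * dist p b < (n + 1 : ℝ) →
        |dist (f a) (f b) - c i * dist a b| < 1 / (n + 1 : ℝ)) ∧
      ∀ w : Y, dist y w < (n + 1 : ℝ) - 1 / (n + 1 : ℝ) →
        ∃ a : X, c i * dist p a < (n + 1 : ℝ) ∧ dist (f a) w < 1 / (n + 1 : ℝ)) ∧
      (g p = z ∧
      (∀ a b : X, c i * dist p a < (n + 1 : ℝ) → c i * dist p b < (n + 1 : ℝ) →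
        |dist (g a) (g b) - c i * dist a b| < 1 / (n + 1 : ℝ)) ∧
      ∀ w : Z, dist z w < (n + 1 : ℝ) - 1 / (n + 1 : ℝ) →
        ∃ a : X, c i * dist p a < (n + 1 : ℝ) ∧ dist (g a) w < 1 / (n + 1 : ℝ)) := fun n => by
    obtain ⟨i, ⟨f, hf⟩, g, hg⟩ :=
      ((hXY (n + 1) (by positivity) _ (hε n)).and (hXZ (n + 1) (by positivity) _ (hε n))).exists
    exact ⟨i, f, g, hf, hg⟩
  choose i f g hfg using hex
  have hf0 := fun n => (hfg n).1.1
  have hf := fun n => (hfg n).1.2.1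
  have hfs := fun n => (hfg n).1.2.2
  have hg0 := fun n => (hfg n).2.1
  have hg := fun n => (hfg n).2.2.1
  have hgs := fun n => (hfg n).2.2.2
  -- near-preimages under `f n` and `g n`
  have hA : ∀ (n : ℕ) (w : Y), ∃ a : X, dist y w < (n + 1 : ℝ) - 1 / (n + 1 : ℝ) →
      c (i n) * dist p a < (n + 1 : ℝ) ∧ dist (f n a) w < 1 / (n + 1 : ℝ) := fun n w => by
    by_cases h : dist y w < (n + 1 : ℝ) - 1 / (n + 1 : ℝ)
    · obtain ⟨a, ha⟩ := hfs n w h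
      exact ⟨a, fun _ => ha⟩
    · exact ⟨p, fun h' => absurd h' h⟩
  have hB : ∀ (n : ℕ) (w : Z), ∃ a : X, dist z w < (n + 1 : ℝ) - 1 / (n + 1 : ℝ) →
      c (i n) * dist p a < (n + 1 : ℝ) ∧ dist (g n a) w < 1 / (n + 1 : ℝ) := fun n w => by
    by_cases h : dist z w < (n + 1 : ℝ) - 1 / (n + 1 : ℝ)
    · obtain ⟨a, ha⟩ := hgs n w h
      exact ⟨a, fun _ => ha⟩
    · exact ⟨p, fun h' => absurd h' h⟩
  choose A hA using hA
  choose B hB using hB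
  have hε0 : Tendsto (fun n : ℕ => 1 / ((n : ℝ) + 1)) atTop (𝓝 0) :=
    tendsto_one_div_add_atTop_nhds_zero_nat
  have hε1 : ∀ n : ℕ, 1 / ((n : ℝ) + 1) ≤ 1 := fun n => by
    rw [div_le_one (by positivity)]
    have : (0 : ℝ) ≤ n := n.cast_nonneg
    linarith
  have hlarge : ∀ r : ℝ, ∀ᶠ n : ℕ in atTop, r + 1 < n := fun r =>
    tendsto_natCast_atTop_atTop.eventually_gt_atTop (r + 1)
  have key : ∀ n : ℕ, ∀ r : ℝ, r + 1 < n → ∀ a b : Y, dist a y ≤ r → dist b y ≤ r →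
      |dist (g n (A n a)) (g n (A n b)) - dist a b| ≤ 4 * (1 / ((n : ℝ) + 1)) := by
    intro n r hr a b ha hb
    have h1 := hε1 n
    obtain ⟨a1, a2⟩ := hA n a (by rw [dist_comm]; linarith)
    obtain ⟨b1, b2⟩ := hA n b (by rw [dist_comm]; linarith)
    have hF := abs_lt.1 (hf n _ _ a1 b1)
    have hG := abs_lt.1 (hg n _ _ a1 b1)
    have t1 := dist_triangle4 a (f n (A n a)) (f n (A n b)) b
    have t2 := dist_triangle4 (f n (A n a)) a b (f n (A n b))
    rw [dist_comm a (f n (A n a))] at t1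
    rw [dist_comm b (f n (A n b))] at t2
    rw [abs_le]
    constructor <;> linarith [hF.1, hF.2, hG.1, hG.2]
  have hp : ∀ n : ℕ, c (i n) * dist p p < (n + 1 : ℝ) := fun n => by
    rw [dist_self, mul_zero]; positivity
  have h4 : Tendsto (fun n : ℕ => 4 * (1 / ((n : ℝ) + 1))) atTop (𝓝 0) := by
    simpa using hε0.const_mul 4
  have hkb : ∀ (a : Z) (n : ℕ), dist z a + 1 + 2 < n →
      dist (f n (B n a)) y ≤ dist z a + 3 ∧ dist (g n (A n (f n (B n a)))) a ≤
        4 * (1 / ((n : ℝ) + 1)) := by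
    intro a n hn
    have h1 := hε1 n
    obtain ⟨b1, b2⟩ := hB n a (by linarith)
    have e1 := abs_lt.1 (hf n _ _ b1 (hp n))
    have e2 := abs_lt.1 (hg n _ _ b1 (hp n))
    rw [hf0] at e1
    rw [hg0] at e2
    have t1 := dist_triangle (g n (B n a)) a z
    rw [dist_comm a z] at t1
    have hb : dist (f n (B n a)) y ≤ dist z a + 3 := by linarith [e1.2, e2.1]
    obtain ⟨a1, a2⟩ := hA n (f n (B n a)) (by rw [dist_comm]; linarith [e1.2, e2.1])
    have e3 := abs_lt.1 (hf n _ _ a1 b1)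
    have e4 := abs_lt.1 (hg n _ _ a1 b1)
    have t2 := dist_triangle (g n (A n (f n (B n a)))) (g n (B n a)) a
    exact ⟨hb, by linarith [e3.1, e4.2]⟩
  refine exists_isometryEquiv_of_approx hZ y z (fun n a => g n (A n a)) (fun n a => f n (B n a))
    ?_ ?_ ?_ ?_ ?_
  · intro a b
    rw [tendsto_iff_dist_tendsto_zero]
    refine squeeze_zero' (Eventually.of_forall fun _ => dist_nonneg) ?_ h4
    filter_upwards [hlarge (max (dist a y) (dist b y))] with n hn
    rw [Real.dist_eq]
    exact key n _ hn a b (le_max_left _ _) (le_max_right _ _)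
  · refine squeeze_zero' (Eventually.of_forall fun _ => dist_nonneg) ?_ h4
    filter_upwards [hlarge 0] with n hn
    obtain ⟨a1, a2⟩ := hA n y (by rw [dist_self]; linarith [hε1 n])
    have e1 := abs_lt.1 (hf n _ _ a1 (hp n))
    have e2 := abs_lt.1 (hg n _ _ a1 (hp n))
    rw [hf0] at e1
    rw [hg0] at e2
    linarith [e1.1, e2.2, hε n]
  · intro a
    refine ⟨dist z a + 3, ?_⟩
    filter_upwards [hlarge (dist z a + 2)] with n hn
    exact (hkb a n (by linarith)).1
  · intro a
    refine squeeze_zero' (Eventually.of_forall fun _ => dist_nonneg) ?_ h4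
    filter_upwards [hlarge (dist z a + 2)] with n hn
    exact (hkb a n (by linarith)).2
  · intro r δ hδ
    filter_upwards [hlarge r, h4.eventually_lt_const hδ] with n hn hn' a b ha hb
    linarith [(abs_le.1 (key n r hn a b ha hb)).2]

end Limits

/-! ### Lagrange interpolation and Vieta's formula -/

section Interpolation

open Polynomial Finset

variable {ι κ : Type*}

/-- Vieta's formula, with the indices in `Fin (n + 1)`. -/
theorem sum_sym_mul_pow (s : Finset ι) (x : ι → ℝ) {n : ℕ} (hn : #s = n) (t : ℝ) :
    ∑ r : Fin (n + 1), sym s x r * ((-1) ^ (r : ℕ) * t ^ (n - (r : ℕ))) = ∏ i ∈ s, (t - x i) := by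
  have h := congrArg (Polynomial.eval t) (Multiset.prod_X_sub_X_eq_sum_esymm (s.val.map x))
  rw [Multiset.map_map, Multiset.card_map, Finset.card_val, hn] at h
  have e : (Multiset.map ((fun t => X - C t) ∘ x) s.val).prod = ∏ i ∈ s, (X - C (x i)) := rfl
  rw [e, eval_prod, eval_finsetSum] at h
  simp only [eval_sub, eval_X, eval_C, eval_mul, eval_pow, eval_neg, eval_one] at h
  rw [h, Finset.sum_range]
  refine Finset.sum_congr rfl fun r _ => ?_
  unfold sym
  ring

theorem sum_sym_succ_mul_pow (s : Finset ι) (x : ι → ℝ) {n : ℕ} (hn : #s + 1 = n) (t : ℝ) :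
    ∑ r : Fin n, sym s x r * ((-1) ^ (r : ℕ) * t ^ (n - 1 - (r : ℕ))) = ∏ i ∈ s, (t - x i) := by
  subst hn
  exact sum_sym_mul_pow s x rfl t

theorem degree_nodal_sub_nodal_lt (s : Finset ι) (u : Finset κ) (x : ι → ℝ) (y : κ → ℝ)
    (h : #s = #u) : (Lagrange.nodal s x - Lagrange.nodal u y).degree < #u := by
  have := degree_sub_lt_left (p := Lagrange.nodal s x) (q := Lagrange.nodal u y)
    (by rw [Lagrange.degree_nodal, Lagrange.degree_nodal, h]) Lagrange.nodal_ne_zero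
    (by rw [Lagrange.nodal_monic.leadingCoeff, Lagrange.nodal_monic.leadingCoeff])
  rwa [Lagrange.degree_nodal, h] at this

/-- Interpolation of a monic polynomial of degree `#u` at the nodes `y`. -/
theorem prod_eq_add_sum_of_card_eq [DecidableEq κ] (s : Finset ι) (u : Finset κ) (x : ι → ℝ)
    (y : κ → ℝ) (hy : Set.InjOn y u) (h : #s = #u) (t : ℝ) :
    ∏ i ∈ s, (t - x i) = ∏ k ∈ u, (t - y k) + ∑ k ∈ u, (∏ i ∈ s, (y k - x i)) /
      (∏ n ∈ u.erase k, (y k - y n)) * ∏ n ∈ u.erase k, (t - y n) := by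
  have e := Lagrange.eq_interpolate hy (degree_nodal_sub_nodal_lt s u x y h)
  rw [Lagrange.interpolate_eq_sum] at e
  have e' := congrArg (Polynomial.eval t) e
  rw [eval_sub, Lagrange.eval_nodal, Lagrange.eval_nodal, eval_finsetSum, sub_eq_iff_eq_add'] at e'
  rw [e']
  congr 1
  refine Finset.sum_congr rfl fun k hk => ?_
  rw [eval_mul, eval_C, eval_prod, eval_sub, Lagrange.eval_nodal, Lagrange.eval_nodal_at_node hk,
    sub_zero]
  simp

/-- Interpolation of a monic polynomial of degree less than `#u` at the nodes `y`. -/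
theorem prod_eq_sum_of_card_lt [DecidableEq κ] (s : Finset ι) (u : Finset κ) (x : ι → ℝ) (y : κ → ℝ)
    (hy : Set.InjOn y u) (h : #s < #u) (t : ℝ) :
    ∏ i ∈ s, (t - x i) = ∑ k ∈ u, (∏ i ∈ s, (y k - x i)) /
      (∏ n ∈ u.erase k, (y k - y n)) * ∏ n ∈ u.erase k, (t - y n) := by
  have e := Lagrange.eq_interpolate (f := Lagrange.nodal s x) hy
    (by rw [Lagrange.degree_nodal]; exact_mod_cast h)
  rw [Lagrange.interpolate_eq_sum] at e
  have e' := congrArg (Polynomial.eval t) e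
  rw [Lagrange.eval_nodal, eval_finsetSum] at e'
  rw [e']
  refine Finset.sum_congr rfl fun k hk => ?_
  rw [eval_mul, eval_C, eval_prod, Lagrange.eval_nodal]
  simp

/-- The leading coefficient of a monic polynomial, by interpolation. -/
theorem sum_prod_div_eq_one [DecidableEq κ] (s : Finset ι) (u : Finset κ) (x : ι → ℝ) (y : κ → ℝ)
    (hy : Set.InjOn y u) (h : #u = #s + 1) :
    ∑ k ∈ u, (∏ i ∈ s, (y k - x i)) / ∏ n ∈ u.erase k, (y k - y n) = 1 := by
  have e := Lagrange.leadingCoeff_eq_sum (P := Lagrange.nodal s x) hy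
    (by rw [Lagrange.degree_nodal, h]; rfl)
  rw [Lagrange.nodal_monic.leadingCoeff] at e
  rw [e]
  simp only [Lagrange.eval_nodal]

end Interpolation

/-- The polynomial `∏_{k<l} (t - αₖ)`. -/
def Data.A (D : Data) (t : ℝ) : ℝ := ∏ k : Fin D.m, (t - D.α k.castSucc)

section Identities

variable (D : Data)

theorem Data.α_injective : Function.Injective fun k : Fin D.m => D.α k.castSucc :=
  D.strictMono_α.injective.comp (Fin.castSucc_injective _)

theorem Data.Δα_ne_zero (k : Fin D.m) : D.Δα k ≠ 0 :=
  Finset.prod_ne_zero_iff.2 fun _ hn =>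
    sub_ne_zero.2 fun h => (Finset.ne_of_mem_erase hn) (D.α_injective h).symm

theorem Data.A_eq_mul (k : Fin D.m) (t : ℝ) :
    D.A t = (t - D.α k.castSucc) * ∏ n ∈ Finset.univ.erase k, (t - D.α n.castSucc) :=
  (Finset.mul_prod_erase _ _ (Finset.mem_univ k)).symm

theorem pnc_eq_mul {n : ℕ} (ξ : Fin n → ℝ) (j : Fin n) (t : ℝ) :
    pnc ξ t = (t - ξ j) * ∏ i ∈ Finset.univ.erase j, (t - ξ i) :=
  (Finset.mul_prod_erase _ _ (Finset.mem_univ j)).symm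

variable {D}

/-- The diagonalization of `dσ₁² + ∑ₖ drₖ²` in the coordinates `ξ`, off the diagonal. -/
theorem sum_pnc_div_of_ne {ξ : Fin (D.m + 1) → ℝ} {i j : Fin (D.m + 1)} (hij : i ≠ j)
    (hξ : ∀ j (k : Fin D.m), ξ j ≠ D.α k.castSucc) :
    1 + ∑ k : Fin D.m, -pnc ξ (D.α k.castSucc) / D.Δα k *
      (1 / ((ξ i - D.α k.castSucc) * (ξ j - D.α k.castSucc))) = 0 := by
  have h := sum_prod_div_eq_one ((Finset.univ.erase i).erase j) Finset.univ ξ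
    (fun k : Fin D.m => D.α k.castSucc) D.α_injective.injOn (by
      rw [Finset.card_erase_of_mem (by simp [hij.symm]), Finset.card_erase_of_mem (by simp)]
      simp only [Finset.card_univ, Fintype.card_fin]
      have := D.one_le_m
      omega)
  rw [add_comm, ← eq_neg_iff_add_eq_zero]
  refine Eq.trans ?_ (congrArg Neg.neg h)
  rw [← Finset.sum_neg_distrib]
  refine Finset.sum_congr rfl fun k _ => ?_
  have e : pnc ξ (D.α k.castSucc) = (D.α k.castSucc - ξ i) * ((D.α k.castSucc - ξ j) *
      ∏ n ∈ (Finset.univ.erase i).erase j, (D.α k.castSucc - ξ n)) := by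
    rw [pnc_eq_mul ξ i, Finset.mul_prod_erase _ (fun n => D.α k.castSucc - ξ n)
      (Finset.mem_erase.2 ⟨hij.symm, Finset.mem_univ j⟩)]
  rw [e]
  have h1 := sub_ne_zero.2 (hξ i k)
  have h2 := sub_ne_zero.2 (hξ j k)
  have h3 := D.Δα_ne_zero k
  change _ = -(_ / D.Δα k)
  field_simp
  ring

/-- The diagonalization of `dσ₁² + ∑ₖ drₖ²` in the coordinates `ξ`, on the diagonal. -/
theorem sum_pnc_div_self {ξ : Fin (D.m + 1) → ℝ} (j : Fin (D.m + 1))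
    (hξ : ∀ j (k : Fin D.m), ξ j ≠ D.α k.castSucc) :
    1 + ∑ k : Fin D.m, -pnc ξ (D.α k.castSucc) / D.Δα k *
      (1 / ((ξ j - D.α k.castSucc) * (ξ j - D.α k.castSucc))) = Δξ ξ j / D.A (ξ j) := by
  have h := prod_eq_add_sum_of_card_eq (Finset.univ.erase j) Finset.univ ξ
    (fun k : Fin D.m => D.α k.castSucc) D.α_injective.injOn (by simp) (ξ j)
  change Δξ ξ j = D.A (ξ j) + _ at h
  have hA : D.A (ξ j) ≠ 0 := Finset.prod_ne_zero_iff.2 fun k _ => sub_ne_zero.2 (hξ j k)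
  rw [eq_div_iff hA, h, add_mul, one_mul, Finset.sum_mul]
  congr 1
  refine Finset.sum_congr rfl fun k _ => ?_
  rw [pnc_eq_mul ξ j, D.A_eq_mul k]
  change _ = _ / D.Δα k * _
  have h2 := sub_ne_zero.2 (hξ j k)
  have h3 := D.Δα_ne_zero k
  field_simp
  ring

theorem sum_A_div_Δξ {ξ : Fin (D.m + 1) → ℝ} (hinj : Function.Injective ξ) :
    ∑ j, D.A (ξ j) / Δξ ξ j = 1 :=
  sum_prod_div_eq_one Finset.univ Finset.univ (fun k : Fin D.m => D.α k.castSucc) ξ hinj.injOn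
    (by simp)

theorem sum_A_div_Δξ_mul {ξ : Fin (D.m + 1) → ℝ} (hinj : Function.Injective ξ) (t : ℝ) :
    ∑ j, D.A (ξ j) / Δξ ξ j * ∏ i ∈ Finset.univ.erase j, (t - ξ i) = D.A t :=
  (prod_eq_sum_of_card_lt Finset.univ Finset.univ (fun k : Fin D.m => D.α k.castSucc) ξ hinj.injOn
    (by simp) t).symm

theorem sum_A_div_Δξ_mul_mul {ξ : Fin (D.m + 1) → ℝ} (hinj : Function.Injective ξ)
    (k n : Fin D.m) :
    ∑ j, D.A (ξ j) / Δξ ξ j * ((∏ i ∈ Finset.univ.erase j, (D.α k.castSucc - ξ i)) *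
      ∏ i ∈ Finset.univ.erase j, (D.α n.castSucc - ξ i)) =
      if k = n then -pnc ξ (D.α k.castSucc) * D.Δα k else 0 := by
  have h := prod_eq_sum_of_card_lt (Finset.univ.erase k) Finset.univ
    (fun k : Fin D.m => D.α k.castSucc) ξ hinj.injOn
      (by rw [Finset.card_erase_of_mem (Finset.mem_univ _)]
          simp only [Finset.card_univ, Fintype.card_fin]
          omega)
      (D.α n.castSucc)
  have e : ∑ j, D.A (ξ j) / Δξ ξ j * ((∏ i ∈ Finset.univ.erase j, (D.α k.castSucc - ξ i)) *
      ∏ i ∈ Finset.univ.erase j, (D.α n.castSucc - ξ i)) =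
      -pnc ξ (D.α k.castSucc) * ∏ i ∈ Finset.univ.erase k, (D.α n.castSucc - D.α i.castSucc) := by
    rw [h, Finset.mul_sum]
    refine Finset.sum_congr rfl fun j _ => ?_
    rw [D.A_eq_mul k, pnc_eq_mul ξ j]
    change _ = _ * (_ / Δξ ξ j * _)
    ring
  rw [e]
  split_ifs with hkn
  · subst hkn; rfl
  · rw [Finset.prod_eq_zero (i := n) (by simp [Ne.symm hkn]) (sub_self _), mul_zero]

/-- `∏_{i≠j} (t - ξᵢ)` in terms of its values at the `αₖ`. -/
theorem prod_erase_eq_A_add {ξ : Fin (D.m + 1) → ℝ} (j : Fin (D.m + 1)) (t : ℝ) :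
    ∏ i ∈ Finset.univ.erase j, (t - ξ i) = D.A t + ∑ k : Fin D.m,
      (∏ i ∈ Finset.univ.erase j, (D.α k.castSucc - ξ i)) / D.Δα k *
        ∏ n ∈ Finset.univ.erase k, (t - D.α n.castSucc) :=
  prod_eq_add_sum_of_card_eq (Finset.univ.erase j) Finset.univ ξ
    (fun k : Fin D.m => D.α k.castSucc) D.α_injective.injOn (by simp) t

end Identities

namespace Data

variable {D : Data}

/-! ### Interlacing of the coordinates with the parameters -/

theorem α_le {j k : Fin D.m} (h : j ≤ k) : D.α j.castSucc ≤ D.α k.castSucc :=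
  D.strictMono_α.monotone (Fin.castSucc_le_castSucc_iff.2 h)

theorem α_lt_αl (k : Fin D.m) : D.α k.castSucc < D.αl := D.strictMono_α (Fin.castSucc_lt_last k)

theorem lt_α_of_le {ξ : Fin (D.m + 1) → ℝ} (hξ : ξ ∈ D.domain) {j : Fin (D.m + 1)} {k : Fin D.m}
    (h : j ≤ k.castSucc) : ξ j < D.α k.castSucc := by
  obtain ⟨j, rfl⟩ : ∃ i : Fin D.m, i.castSucc = j :=
    ⟨j.castPred (ne_of_lt (lt_of_le_of_lt h (Fin.castSucc_lt_last k))), Fin.castSucc_castPred _ _⟩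
  exact (hξ.1 j).trans_le (α_le (Fin.castSucc_le_castSucc_iff.1 h))

theorem α_lt_of_lt {ξ : Fin (D.m + 1) → ℝ} (hξ : ξ ∈ D.domain) {j : Fin (D.m + 1)} {k : Fin D.m}
    (h : k.castSucc < j) : D.α k.castSucc < ξ j := by
  induction j using Fin.lastCases with
  | last => exact (α_lt_αl k).trans hξ.2.2
  | cast j =>
    have hkj : (k : ℕ) < j := h
    let n : Fin D.m := ⟨j - 1, by omega⟩
    have hn : (n : ℕ) + 1 = j := by simp only [n]; omega
    exact (α_le (show k ≤ n from Fin.le_def.2 (by omega))).trans_lt (hξ.2.1 n j hn)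

theorem ξ_ne_α {ξ : Fin (D.m + 1) → ℝ} (hξ : ξ ∈ D.domain) (j : Fin (D.m + 1)) (k : Fin D.m) :
    ξ j ≠ D.α k.castSucc := by
  rcases le_or_gt j k.castSucc with h | h
  · exact (lt_α_of_le hξ h).ne
  · exact (α_lt_of_lt hξ h).ne'

theorem strictMono_of_mem {ξ : Fin (D.m + 1) → ℝ} (hξ : ξ ∈ D.domain) : StrictMono ξ := by
  intro i j hij
  induction i using Fin.lastCases with
  | last => exact absurd hij (not_lt.2 (Fin.le_last j))
  | cast i => exact (lt_α_of_le hξ le_rfl).trans (α_lt_of_lt hξ hij)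

theorem prod_erase_eq_prod_succAbove {n : ℕ} (j : Fin (n + 1)) (f : Fin (n + 1) → ℝ) :
    ∏ i ∈ Finset.univ.erase j, f i = ∏ k : Fin n, f (j.succAbove k) := by
  rw [← Finset.compl_singleton, ← Fin.image_succAbove_univ,
    Finset.prod_image Fin.succAbove_right_injective.injOn]

/-- The factors of `Δ(ξⱼ)` and of `A(ξⱼ)` have pairwise the same signs. -/
theorem Δξ_div_A_pos {ξ : Fin (D.m + 1) → ℝ} (hξ : ξ ∈ D.domain) (j : Fin (D.m + 1)) :
    0 < Δξ ξ j / D.A (ξ j) := by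
  unfold Δξ A
  rw [prod_erase_eq_prod_succAbove, ← Finset.prod_div_distrib]
  refine Finset.prod_pos fun k _ => ?_
  rcases lt_or_ge k.castSucc j with h | h
  · rw [Fin.succAbove_of_castSucc_lt _ _ h]
    exact div_pos (sub_pos.2 (strictMono_of_mem hξ h)) (sub_pos.2 (α_lt_of_lt hξ h))
  · rw [Fin.succAbove_of_le_castSucc _ _ h]
    exact div_pos_of_neg_of_neg
      (sub_neg.2 (strictMono_of_mem hξ (h.trans_lt (Fin.castSucc_lt_succ))))
      (sub_neg.2 (lt_α_of_le hξ h))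

/-- `rⱼ² / 4`, as a function of the coordinates `ξ`. -/
def ρ (D : Data) (k : Fin D.m) (ξ : Fin (D.m + 1) → ℝ) : ℝ :=
  -pnc ξ (D.α k.castSucc) / D.Δα k

theorem ρ_pos {ξ : Fin (D.m + 1) → ℝ} (hξ : ξ ∈ D.domain) (k : Fin D.m) : 0 < D.ρ k ξ := by
  have e : D.ρ k ξ = (D.α k.castSucc - ξ k.castSucc) * ((ξ k.succ - D.α k.castSucc) *
      ∏ n ∈ Finset.univ.erase k, (D.α k.castSucc - ξ (k.castSucc.succAbove n)) /
        (D.α k.castSucc - D.α n.castSucc)) := by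
    unfold ρ Δα
    rw [pnc_eq_mul ξ k.castSucc, prod_erase_eq_prod_succAbove,
      ← Finset.mul_prod_erase _ _ (Finset.mem_univ k), Fin.succAbove_castSucc_self,
      Finset.prod_div_distrib]
    ring
  rw [e]
  refine mul_pos (sub_pos.2 (lt_α_of_le hξ le_rfl)) (mul_pos
    (sub_pos.2 (α_lt_of_lt hξ Fin.castSucc_lt_succ)) (Finset.prod_pos fun n hn => ?_))
  rcases lt_or_gt_of_ne (Finset.ne_of_mem_erase hn) with h | h
  · have h' : n.castSucc < k.castSucc := h
    rw [Fin.succAbove_of_castSucc_lt _ _ h']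
    exact div_pos (sub_pos.2 (lt_α_of_le hξ h'.le)) (sub_pos.2 (D.strictMono_α h'))
  · have h' : k.castSucc < n.castSucc := h
    rw [Fin.succAbove_of_le_castSucc _ _ h'.le]
    exact div_pos_of_neg_of_neg (sub_neg.2 (α_lt_of_lt hξ (h'.trans Fin.castSucc_lt_succ)))
      (sub_neg.2 (D.strictMono_α h'))

theorem r_eq (k : Fin D.m) (x : D.W) : D.r k x = 2 * √(D.ρ k x.1) := rfl

theorem r_pos {x : D.W} (hx : x.1 ∈ D.domain) (k : Fin D.m) : 0 < D.r k x :=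
  mul_pos two_pos (Real.sqrt_pos.2 (ρ_pos hx k))

theorem r_sq {x : D.W} (hx : x.1 ∈ D.domain) (k : Fin D.m) : D.r k x ^ 2 = 4 * D.ρ k x.1 := by
  rw [r_eq, mul_pow, Real.sq_sqrt (ρ_pos hx k).le]
  norm_num

/-! ### The forms `βⱼ` in terms of the Hopf connection forms -/

theorem q_α (k : Fin D.m) : D.q (D.α k.castSucc) = (D.d k + 1) * D.Δα k := by
  unfold q qPoly
  rw [Finset.sum_eq_single k]
  · rw [sub_self, mul_zero, zero_add]; rfl
  · intro j _ hj
    rw [Finset.prod_eq_zero (Finset.mem_erase.2 ⟨hj.symm, Finset.mem_univ k⟩) (sub_self _),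
      mul_zero]
  · exact fun h => absurd (Finset.mem_univ k) h

/-- The scalar factor of `vⱼ`. -/
def vCoeff (D : Data) (j : Fin (D.m + 1)) : ℝ :=
  (-1) ^ (D.m - (j : ℕ)) * (2 * (D.dExt j + 1) / D.q (D.α j))

theorem vCoeff_last : D.vCoeff (Fin.last D.m) = 2 / D.q D.αl := by
  simp [vCoeff, dExt, αl]

theorem vCoeff_castSucc (k : Fin D.m) :
    D.vCoeff k.castSucc = (-1) ^ (D.m - (k : ℕ)) * (2 / D.Δα k) := by
  have h1 : (D.d k + 1 : ℝ) ≠ 0 := by positivity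
  have h2 := D.Δα_ne_zero k
  simp only [vCoeff, dExt, Fin.lastCases_castSucc, q_α, Fin.val_castSucc]
  field_simp

theorem sum_sym_mul_θ {ι : Type*} (s : Finset ι) (y : ι → ℝ) (hs : s.card = D.m) (x u : D.W) :
    ∑ r : Fin (D.m + 1), sym s y r * D.θ x u r =
      -∑ k, D.η x u k * D.vCoeff k * ∏ i ∈ s, (D.α k - y i) := by
  simp only [θ, Finset.mul_sum]
  rw [Finset.sum_comm, ← Finset.sum_neg_distrib]
  refine Finset.sum_congr rfl fun k _ => ?_
  rw [← sum_sym_mul_pow s y hs, Finset.mul_sum, ← Finset.sum_neg_distrib]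
  refine Finset.sum_congr rfl fun r _ => ?_
  rw [v, ← vCoeff, pow_succ]
  ring

theorem β₀_eq_sum (x u : D.W) : D.β₀ x u = -∑ k, D.η x u k * D.vCoeff k * D.A (D.α k) :=
  sum_sym_mul_θ Finset.univ _ (by simp) x u

theorem β_eq_sum (i : Fin D.m) (x u : D.W) : D.β i x u = ∑ k, D.η x u k * D.vCoeff k *
    ∏ n ∈ Finset.univ.erase i, (D.α k - D.α n.castSucc) := by
  simp only [β, θ, Finset.mul_sum]
  rw [Finset.sum_comm]
  refine Finset.sum_congr rfl fun k _ => ?_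
  have hc : (Finset.univ.erase i).card + 1 = D.m := by
    rw [Finset.card_erase_of_mem (Finset.mem_univ i), Finset.card_univ, Fintype.card_fin]
    have := D.one_le_m
    omega
  rw [← sum_sym_succ_mul_pow _ _ hc, Finset.mul_sum]
  refine Finset.sum_congr rfl fun r _ => ?_
  rw [v, ← vCoeff, pow_succ, Fin.val_succ, pow_succ, Nat.sub_sub, add_comm 1]
  ring

/-- `∑ᵣ σ_{r-1}(ξ̂ⱼ) θᵣ` in terms of the forms `β₀`, `βᵢ`. -/
theorem sum_sym_erase_mul_θ (ξ : Fin (D.m + 1) → ℝ) (j : Fin (D.m + 1)) (x u : D.W) :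
    ∑ r : Fin (D.m + 1), sym (Finset.univ.erase j) ξ r * D.θ x u r =
      D.β₀ x u - ∑ k : Fin D.m, (∏ i ∈ Finset.univ.erase j, (D.α k.castSucc - ξ i)) / D.Δα k *
        D.β k x u := by
  rw [sum_sym_mul_θ _ _ (by simp), β₀_eq_sum]
  simp only [β_eq_sum, Finset.mul_sum]
  rw [Finset.sum_comm, ← neg_add', ← Finset.sum_add_distrib]
  refine congrArg Neg.neg (Finset.sum_congr rfl fun k _ => ?_)
  rw [prod_erase_eq_A_add, mul_add, Finset.mul_sum]
  congr 1
  exact Finset.sum_congr rfl fun n _ => by ring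

/-- The factor `κ` with `β₀ = κ η_l`; the translation length of the generator of the `ℤ`-action
is `2πκ`. -/
def κ (D : Data) : ℝ := -(2 / D.q D.αl * D.A D.αl)

theorem A_αl_pos : 0 < D.A D.αl := Finset.prod_pos fun k _ => sub_pos.2 (α_lt_αl k)

theorem κ_ne_zero : D.κ ≠ 0 :=
  neg_ne_zero.2 (mul_ne_zero (div_ne_zero two_ne_zero D.q_ne_zero) A_αl_pos.ne')

theorem shift_eq : D.shift = 2 * Real.pi * D.κ := by
  simp only [shift, κ, A]
  ring

theorem β₀_eq (x u : D.W) : D.β₀ x u = D.κ * D.η x u (Fin.last D.m) := by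
  rw [β₀_eq_sum, Fin.sum_univ_castSucc, Finset.sum_eq_zero, zero_add, vCoeff_last, κ, ← αl]
  · ring
  · intro k _
    rw [A_eq_mul _ k, sub_self, zero_mul, mul_zero]

theorem β_eq (i : Fin D.m) (x u : D.W) : D.β i x u =
    2 * (-1) ^ (D.m - (i : ℕ)) * (D.η x u i.castSucc + D.τ i * D.η x u (Fin.last D.m)) := by
  rw [β_eq_sum, Fin.sum_univ_castSucc, Finset.sum_eq_single i]
  · rw [vCoeff_castSucc, vCoeff_last, τ, ← αl]
    change _ * D.Δα i + _ = _
    have h := D.Δα_ne_zero i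
    have hs : ((-1 : ℝ) ^ (D.m - (i : ℕ))) * (-1) ^ (D.m - (i : ℕ)) = 1 := by
      rw [← mul_pow]; norm_num
    field_simp
    linear_combination (-(∏ k ∈ Finset.univ.erase i, (D.αl - D.α k.castSucc)) *
      D.η x u (Fin.last D.m) / D.q D.αl) * hs
  · intro k _ hk
    rw [Finset.prod_eq_zero (Finset.mem_erase.2 ⟨hk, Finset.mem_univ k⟩) (sub_self _), mul_zero]
  · exact fun h => absurd (Finset.mem_univ i) h

/-! ### Diagonalization of the metric -/

theorem P_eq (t : ℝ) : D.P t = D.pc t * D.A t := by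
  simp only [P, pc, A, ← Finset.prod_mul_distrib, pow_succ]

theorem update_F (j : Fin (D.m + 1)) : Function.update D.F (Fin.last D.m) D.P j = D.P := by
  by_cases h : j = Fin.last D.m
  · rw [h, Function.update_self]
  · rw [Function.update_of_ne h]
    funext t
    simp [F, h]

theorem pc_ne_zero {ξ : Fin (D.m + 1) → ℝ} (hξ : ξ ∈ D.domain) (j : Fin (D.m + 1)) :
    D.pc (ξ j) ≠ 0 :=
  Finset.prod_ne_zero_iff.2 fun k _ => pow_ne_zero _ (sub_ne_zero.2 (ξ_ne_α hξ j k))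

/-- The horizontal part of the metric. -/
theorem horizontal_coeff (k : Fin D.m) (x u u' : D.W) :
    (-1) ^ (D.m - (k : ℕ)) * pnc x.1 (D.α k.castSucc) * D.gKE k x u u' =
      2 * D.ρ k x.1 * D.gFS k x u u' := by
  have h1 : (D.d k + 1 : ℝ) ≠ 0 := by positivity
  have h2 := D.Δα_ne_zero k
  have h3 : (-1 : ℝ) ^ (D.m - 1 - (k : ℕ)) ≠ 0 := pow_ne_zero _ (by norm_num)
  have h4 : (-1 : ℝ) ^ (D.m - (k : ℕ)) = (-1) ^ (D.m - 1 - (k : ℕ)) * -1 := by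
    rw [← pow_succ]
    congr 1
    have := k.2
    omega
  rw [gKE, q_α, h4, ρ]
  field_simp

/-- The part of the metric in the directions of the coordinates `ξ`. -/
theorem sum_Δξ_div_A_mul {ξ : Fin (D.m + 1) → ℝ} (hξ : ξ ∈ D.domain) (u u' : Fin (D.m + 1) → ℝ) :
    ∑ j, Δξ ξ j / D.A (ξ j) * (u j * u' j) = (∑ j, u j) * (∑ j, u' j) +
      ∑ k : Fin D.m, D.ρ k ξ * ((∑ j, u j / (ξ j - D.α k.castSucc)) *
        ∑ j, u' j / (ξ j - D.α k.castSucc)) := by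
  have key : ∀ i j, u i * u' j * (1 + ∑ k : Fin D.m, D.ρ k ξ *
      (1 / ((ξ i - D.α k.castSucc) * (ξ j - D.α k.castSucc)))) =
      if i = j then Δξ ξ j / D.A (ξ j) * (u j * u' j) else 0 := by
    intro i j
    split_ifs with h
    · subst h
      rw [mul_comm]
      exact congrArg (· * _) (sum_pnc_div_self i (ξ_ne_α hξ))
    · exact mul_eq_zero_of_right _ (sum_pnc_div_of_ne h (ξ_ne_α hξ))
  have e : ∑ j, Δξ ξ j / D.A (ξ j) * (u j * u' j) = ∑ i, ∑ j, u i * u' j *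
      (1 + ∑ k : Fin D.m, D.ρ k ξ *
      (1 / ((ξ i - D.α k.castSucc) * (ξ j - D.α k.castSucc)))) := by
    refine Finset.sum_congr rfl fun i _ => ?_
    rw [Finset.sum_congr rfl fun j _ => key i j, Finset.sum_ite_eq, if_pos (Finset.mem_univ i)]
  rw [e]
  simp only [Finset.sum_mul_sum]
  simp only [Finset.mul_sum]
  rw [Finset.sum_comm (s := (Finset.univ : Finset (Fin D.m))), ← Finset.sum_add_distrib]
  refine Finset.sum_congr rfl fun i _ => ?_
  rw [Finset.sum_comm (s := (Finset.univ : Finset (Fin D.m))), ← Finset.sum_add_distrib]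
  refine Finset.sum_congr rfl fun j _ => ?_
  rw [mul_add, mul_one, Finset.mul_sum]
  congr 1
  refine Finset.sum_congr rfl fun k _ => ?_
  rw [one_div, mul_inv]
  ring

/-- The part of the metric in the directions of the torus. -/
theorem sum_A_div_Δξ_mul_sub {ξ : Fin (D.m + 1) → ℝ} (hξ : ξ ∈ D.domain) (b b' : ℝ)
    (c c' : Fin D.m → ℝ) :
    ∑ j, D.A (ξ j) / Δξ ξ j *
      ((b - ∑ k : Fin D.m, (∏ i ∈ Finset.univ.erase j, (D.α k.castSucc - ξ i)) / D.Δα k * c k) *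
      (b' - ∑ k : Fin D.m, (∏ i ∈ Finset.univ.erase j, (D.α k.castSucc - ξ i)) / D.Δα k * c' k)) =
    b * b' + ∑ k, D.ρ k ξ * (c k * c' k) := by
  have hinj := (strictMono_of_mem hξ).injective
  set w : Fin (D.m + 1) → ℝ := fun j => D.A (ξ j) / Δξ ξ j
  set H : Fin (D.m + 1) → Fin D.m → ℝ := fun j k => ∏ i ∈ Finset.univ.erase j,
    (D.α k.castSucc - ξ i)
  have h1 : ∑ j, w j = 1 := sum_A_div_Δξ hinj
  have h2 : ∀ k, ∑ j, w j * H j k = 0 := fun k => by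
    rw [show ∑ j, w j * H j k = D.A (D.α k.castSucc) from sum_A_div_Δξ_mul hinj _, A_eq_mul _ k,
      sub_self, zero_mul]
  have h3 : ∀ k n, ∑ j, w j * (H j k * H j n) =
      if k = n then -pnc ξ (D.α k.castSucc) * D.Δα k else 0 := fun k n =>
    sum_A_div_Δξ_mul_mul hinj k n
  have h4 : ∀ a : Fin D.m → ℝ, ∑ j, w j * ∑ k, H j k / D.Δα k * a k = 0 := fun a => by
    simp only [Finset.mul_sum]
    rw [Finset.sum_comm]
    refine Finset.sum_eq_zero fun k _ => ?_
    have := congrArg (· * (a k / D.Δα k)) (h2 k)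
    simp only [Finset.sum_mul, zero_mul] at this
    rw [← this]
    exact Finset.sum_congr rfl fun j _ => by ring
  have h5 : ∑ j, w j * ((∑ k, H j k / D.Δα k * c k) * ∑ k, H j k / D.Δα k * c' k) =
      ∑ k, D.ρ k ξ * (c k * c' k) := by
    simp only [Finset.sum_mul_sum]
    simp only [Finset.mul_sum]
    rw [Finset.sum_comm]
    refine Finset.sum_congr rfl fun k _ => ?_
    rw [Finset.sum_comm]
    have e : ∀ n, ∑ j, w j * (H j k / D.Δα k * c k * (H j n / D.Δα n * c' n)) =
        if k = n then D.ρ n ξ * (c n * c' n) else 0 := fun n => by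
      have := congrArg (· * (c k * c' n / (D.Δα k * D.Δα n))) (h3 k n)
      simp only [Finset.sum_mul] at this
      refine Eq.trans (Finset.sum_congr rfl fun j _ => by ring) (this.trans ?_)
      split_ifs with h
      · subst h
        have := D.Δα_ne_zero k
        rw [ρ]
        field_simp
      · rw [zero_mul]
    rw [Finset.sum_congr rfl fun n _ => e n, Finset.sum_ite_eq, if_pos (Finset.mem_univ k)]
  have e : ∀ j, w j * ((b - ∑ k, H j k / D.Δα k * c k) * (b' - ∑ k, H j k / D.Δα k * c' k)) =
      b * b' * w j - b' * (w j * ∑ k, H j k / D.Δα k * c k) -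
        b * (w j * ∑ k, H j k / D.Δα k * c' k) +
        w j * ((∑ k, H j k / D.Δα k * c k) * ∑ k, H j k / D.Δα k * c' k) := fun j => by ring
  change ∑ j, w j * ((b - ∑ k, H j k / D.Δα k * c k) * (b' - ∑ k, H j k / D.Δα k * c' k)) = _
  rw [Finset.sum_congr rfl fun j _ => e j, Finset.sum_add_distrib, Finset.sum_sub_distrib,
    Finset.sum_sub_distrib, ← Finset.mul_sum, ← Finset.mul_sum, ← Finset.mul_sum, h1, h4, h4, h5]
  ring

/-- `g'` in terms of `σ₁`, of the `rₖ² = 4ρₖ` and of the connection forms. -/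
theorem gPrime_eq {x : D.W} (hx : x.1 ∈ D.domain) (u u' : D.W) :
    D.gPrime x u u' = (∑ j, u.1 j) * (∑ j, u'.1 j) + D.β₀ x u * D.β₀ x u' +
      ∑ k, (D.ρ k x.1 * ((∑ j, u.1 j / (x.1 j - D.α k.castSucc)) *
        ∑ j, u'.1 j / (x.1 j - D.α k.castSucc)) +
        4 * D.ρ k x.1 * (1 / 4 * (2 * D.gFS k x u u' + D.β k x u * D.β k x u'))) := by
  have h1 : ∀ j, D.pc (x.1 j) * Δξ x.1 j / D.P (x.1 j) = Δξ x.1 j / D.A (x.1 j) := fun j => by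
    rw [P_eq, mul_div_mul_left _ _ (pc_ne_zero hx j)]
  have h2 : ∀ j, D.P (x.1 j) / (D.pc (x.1 j) * Δξ x.1 j) = D.A (x.1 j) / Δξ x.1 j := fun j => by
    rw [P_eq, mul_div_mul_left _ _ (pc_ne_zero hx j)]
  simp only [gPrime, metric, update_F, h1, h2, horizontal_coeff, sum_sym_erase_mul_θ]
  rw [sum_Δξ_div_A_mul hx, sum_A_div_Δξ_mul_sub hx]
  simp only [Finset.sum_add_distrib, mul_add]
  have e1 : ∑ k, 4 * D.ρ k x.1 * (1 / 4 * (2 * D.gFS k x u u')) =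
      ∑ k, 2 * D.ρ k x.1 * D.gFS k x u u' := Finset.sum_congr rfl fun k _ => by ring
  have e2 : ∑ k, 4 * D.ρ k x.1 * (1 / 4 * (D.β k x u * D.β k x u')) =
      ∑ k, D.ρ k x.1 * (D.β k x u * D.β k x u') := Finset.sum_congr rfl fun k _ => by ring
  rw [e1, e2]
  ring

end Data

/-- The real inner product of `ℂⁿ` is the real part of the complex one. -/
theorem real_inner_eq_re {ι : Type*} [Fintype ι] (z u : EuclideanSpace ℂ ι) :
    inner ℝ z u = (inner ℂ z u).re := by
  simp only [PiLp.inner_apply, Complex.re_sum]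
  exact Finset.sum_congr rfl fun i _ => rfl

/-- A vector orthogonal to `z` in the real sense has a purely imaginary complex product with `z`. -/
theorem inner_eq_im_mul_I {ι : Type*} [Fintype ι] {z u : EuclideanSpace ℂ ι}
    (h : inner ℝ z u = 0) : inner ℂ z u = (inner ℂ z u).im * Complex.I := by
  rw [real_inner_eq_re] at h
  apply Complex.ext <;> simp [h]

/-- The differential of `r e^{iθ} z` is `e^{iθ} ((dr + i r dθ) z + r dz)`. For `z` on the unit
sphere, this is the Euclidean inner product of its values when `(dr, dθ, dz)` is `(a, b, u)` and
`(a', b', u')`. -/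
theorem inner_cone {ι : Type*} [Fintype ι] {z u u' : EuclideanSpace ℂ ι} (hz : ‖z‖ = 1)
    (hu : inner ℝ z u = 0) (hu' : inner ℝ z u' = 0) {c : ℂ} (hc : ‖c‖ = 1) (a a' r b b' : ℝ) :
    inner ℝ (c • ((a + r * b * Complex.I : ℂ) • z + (r : ℂ) • u))
      (c • ((a' + r * b' * Complex.I : ℂ) • z + (r : ℂ) • u')) =
    a * a' + r ^ 2 * (inner ℝ u u' + b * (inner ℂ z u').im + b' * (inner ℂ z u).im + b * b') := by
  have h1 : inner ℂ z z = (1 : ℂ) := by rw [inner_self_eq_norm_sq_to_K, hz]; simp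
  have h2 := inner_eq_im_mul_I hu
  have h3 := inner_eq_im_mul_I hu'
  have h4 : inner ℂ u z = -((inner ℂ z u).im * Complex.I) := by
    rw [← inner_conj_symm, h2]; simp
  have h5 : (starRingEnd ℂ) c * c = 1 := by
    rw [← Complex.normSq_eq_conj_mul_self, Complex.normSq_eq_norm_sq, hc]; simp
  rw [real_inner_eq_re, real_inner_eq_re, inner_smul_left, inner_smul_right, ← mul_assoc, h5,
    one_mul, inner_add_left, inner_add_right, inner_add_right, inner_smul_left, inner_smul_left,
    inner_smul_left, inner_smul_left, inner_smul_right, inner_smul_right, inner_smul_right,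
    inner_smul_right, h1, h3, h4]
  simp
  ring

namespace Data

variable {D : Data}

/-! ### Positivity -/

theorem η_castSucc (x u : D.W) (k : Fin D.m) :
    D.η x u k.castSucc = (inner ℂ (x.2.1 k) (u.2.1 k)).im := by simp [η]

theorem η_last (x u : D.W) : D.η x u (Fin.last D.m) = (inner ℂ x.2.2 u.2.2).im := by simp [η]

theorem abs_η_castSucc_le {x : D.W} (hx : x ∈ D.M0) (u : D.W) (k : Fin D.m) :
    |D.η x u k.castSucc| ≤ ‖u.2.1 k‖ := by
  rw [η_castSucc]
  refine (Complex.abs_im_le_norm _).trans ((norm_inner_le_norm _ _).trans ?_)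
  rw [hx.2.1 k, one_mul]

theorem gFS_self (k : Fin D.m) (x u : D.W) :
    D.gFS k x u u = 2 * (‖u.2.1 k‖ ^ 2 - D.η x u k.castSucc ^ 2) := by
  rw [gFS, real_inner_self_eq_norm_sq, sq (D.η x u _)]

theorem gFS_self_nonneg {x : D.W} (hx : x ∈ D.M0) (u : D.W) (k : Fin D.m) :
    0 ≤ D.gFS k x u u := by
  rw [gFS_self]
  have := sq_le_sq.2 ((abs_η_castSucc_le hx u k).trans (le_abs_self _))
  linarith

theorem gPrime_pos {x : D.W} (hx : x ∈ D.M0) {u : D.W} (hu : u ∈ D.tangent x) (hu0 : u ≠ 0) :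
    0 < D.gPrime x u u := by
  have hA : ∀ j, 0 ≤ Δξ x.1 j / D.A (x.1 j) * (u.1 j * u.1 j) := fun j =>
    mul_nonneg (Δξ_div_A_pos hx.1 j).le (mul_self_nonneg _)
  have hB : ∀ k, 0 ≤ 4 * D.ρ k x.1 *
      (1 / 4 * (2 * D.gFS k x u u + D.β k x u * D.β k x u)) := fun k => by
    have h1 := (ρ_pos hx.1 k).le
    have h2 := gFS_self_nonneg hx u k
    have h3 := mul_self_nonneg (D.β k x u)
    positivity
  have e : D.gPrime x u u = ∑ j, Δξ x.1 j / D.A (x.1 j) * (u.1 j * u.1 j) +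
      (D.β₀ x u * D.β₀ x u + ∑ k, 4 * D.ρ k x.1 *
        (1 / 4 * (2 * D.gFS k x u u + D.β k x u * D.β k x u))) := by
    rw [gPrime_eq hx.1, sum_Δξ_div_A_mul hx.1, Finset.sum_add_distrib]
    ring
  have h1 := Finset.sum_nonneg fun j (_ : j ∈ Finset.univ) => hA j
  have h2 := Finset.sum_nonneg fun k (_ : k ∈ Finset.univ) => hB k
  have h3 := mul_self_nonneg (D.β₀ x u)
  refine lt_of_le_of_ne (by rw [e]; positivity) fun h => hu0 ?_
  rw [e] at h
  obtain ⟨h1z, h23⟩ := (add_eq_zero_iff_of_nonneg h1 (add_nonneg h3 h2)).1 h.symm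
  obtain ⟨h3z, h2z⟩ := (add_eq_zero_iff_of_nonneg h3 h2).1 h23
  have h1' := (Finset.sum_eq_zero_iff_of_nonneg fun j _ => hA j).1 h1z
  have h2' := (Finset.sum_eq_zero_iff_of_nonneg fun k _ => hB k).1 h2z
  have hη : D.η x u (Fin.last D.m) = 0 := by
    have := mul_self_eq_zero.1 h3z
    rw [β₀_eq] at this
    exact (mul_eq_zero.1 this).resolve_left κ_ne_zero
  refine Prod.ext (funext fun j => ?_) (Prod.ext (funext fun k => ?_) ?_)
  · have := h1' j (Finset.mem_univ j)
    exact mul_self_eq_zero.1 ((mul_eq_zero.1 this).resolve_left (Δξ_div_A_pos hx.1 j).ne')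
  · have h4 := (mul_eq_zero.1 (h2' k (Finset.mem_univ k))).resolve_left
      (mul_ne_zero (by norm_num) (ρ_pos hx.1 k).ne')
    have h5 := gFS_self_nonneg hx u k
    have h6 := mul_self_nonneg (D.β k x u)
    have h7 : D.β k x u = 0 := mul_self_eq_zero.1 (by linarith only [h4, h5, h6])
    rw [β_eq, hη, mul_zero, add_zero] at h7
    have h8 : D.η x u k.castSucc = 0 :=
      (mul_eq_zero.1 h7).resolve_left (mul_ne_zero two_ne_zero (pow_ne_zero _ (by norm_num)))
    have h9 : D.gFS k x u u = 0 := by linarith only [h4, h5, h6]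
    rw [gFS_self, h8] at h9
    exact norm_eq_zero.1 (pow_eq_zero_iff two_ne_zero |>.1 (by linarith only [h9]))
  · rw [η_last] at hη
    have h4 : inner ℂ x.2.2 u.2.2 = 0 := Complex.ext hu.2 hη
    have h5 : x.2.2 ≠ 0 := norm_ne_zero_iff.1 (by rw [hx.2.2]; exact one_ne_zero)
    simpa [h5] using h4

/-! ### The differentials of `σ₁` and `rⱼ` -/

theorem σ₁_eq (x : D.W) : D.σ₁ x = ∑ j, x.1 j := by
  rw [σ₁, sym, Multiset.esymm, Multiset.powersetCard_one, Multiset.map_map, Multiset.map_map]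
  exact congrArg Multiset.sum (Multiset.map_congr rfl fun j _ => Multiset.prod_singleton _)

/-- The linear map `u ↦ duⱼ` on the `ξ`-coordinates. -/
def coord (D : Data) (j : Fin (D.m + 1)) : D.W →L[ℝ] ℝ :=
  (ContinuousLinearMap.proj j).comp (ContinuousLinearMap.fst ℝ _ _)

theorem hasFDerivAt_σ₁ (x : D.W) : HasFDerivAt D.σ₁ (∑ j, D.coord j) x := by
  have : D.σ₁ = ⇑(∑ j, D.coord j) := by
    funext x
    rw [σ₁_eq, _root_.sum_apply]
    rfl
  rw [this]
  exact ContinuousLinearMap.hasFDerivAt _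

theorem fderiv_σ₁ (x u : D.W) : fderiv ℝ D.σ₁ x u = ∑ j, u.1 j := by
  rw [(hasFDerivAt_σ₁ x).fderiv, _root_.sum_apply]
  rfl

/-- The differential of `rₖ`. -/
def dr (D : Data) (k : Fin D.m) (x : D.W) : D.W →L[ℝ] ℝ :=
  √(D.ρ k x.1) • ∑ j, (x.1 j - D.α k.castSucc)⁻¹ • D.coord j

theorem dr_apply (k : Fin D.m) (x u : D.W) :
    D.dr k x u = √(D.ρ k x.1) * ∑ j, u.1 j / (x.1 j - D.α k.castSucc) := by
  simp only [dr, _root_.smul_apply, _root_.sum_apply, smul_eq_mul]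
  congr 1
  exact Finset.sum_congr rfl fun j _ => by rw [div_eq_inv_mul]; rfl

theorem hasFDerivAt_r {x : D.W} (hx : x.1 ∈ D.domain) (k : Fin D.m) :
    HasFDerivAt (D.r k) (D.dr k x) x := by
  have h1 : HasFDerivAt (fun y : D.W => pnc y.1 (D.α k.castSucc))
      (∑ j, (∏ i ∈ Finset.univ.erase j, (D.α k.castSucc - x.1 i)) • -D.coord j) x :=
    HasFDerivAt.finsetProd fun j _ => (D.coord j).hasFDerivAt.const_sub _
  have h2 : HasFDerivAt (fun y : D.W => D.ρ k y.1) _ x := (h1.neg.mul_const (D.Δα k)⁻¹)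
  have h3 := (h2.sqrt (ρ_pos hx k).ne').const_mul 2
  refine h3.congr_fderiv ?_
  have hs : √(D.ρ k x.1) ≠ 0 := (Real.sqrt_pos.2 (ρ_pos hx k)).ne'
  have hs2 : √(D.ρ k x.1) * √(D.ρ k x.1) = D.ρ k x.1 := Real.mul_self_sqrt (ρ_pos hx k).le
  refine ContinuousLinearMap.ext fun u => ?_
  rw [dr_apply]
  simp only [_root_.smul_apply, _root_.sum_apply,
    _root_.neg_apply, smul_eq_mul]
  have e : ∑ j, (∏ i ∈ Finset.univ.erase j, (D.α k.castSucc - x.1 i)) * -D.coord j u =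
      pnc x.1 (D.α k.castSucc) * ∑ j, u.1 j / (x.1 j - D.α k.castSucc) := by
    rw [Finset.mul_sum]
    refine Finset.sum_congr rfl fun j _ => ?_
    have := sub_ne_zero.2 (ξ_ne_α hx j k)
    rw [pnc_eq_mul _ j]
    change _ * -u.1 j = _
    field_simp
    ring
  rw [e]
  have e2 : (D.Δα k)⁻¹ * -(pnc x.1 (D.α k.castSucc) *
      ∑ j, u.1 j / (x.1 j - D.α k.castSucc)) =
      √(D.ρ k x.1) * √(D.ρ k x.1) * ∑ j, u.1 j / (x.1 j - D.α k.castSucc) := by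
    rw [hs2, ρ]
    ring
  rw [e2]
  field_simp

theorem gCone_eq {x : D.W} (hx : x.1 ∈ D.domain) (k : Fin D.m) (u u' : D.W) :
    D.gCone k x u u' = D.dr k x u * D.dr k x u' +
      D.r k x ^ 2 * (1 / 4 * (2 * D.gFS k x u u' + D.β k x u * D.β k x u')) := by
  rw [gCone, (hasFDerivAt_r hx k).fderiv]

theorem gPrime_eq_sum_gCone {x : D.W} (hx : x.1 ∈ D.domain) (u u' : D.W) :
    D.gPrime x u u' = fderiv ℝ D.σ₁ x u * fderiv ℝ D.σ₁ x u' + D.β₀ x u * D.β₀ x u' +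
        ∑ j, D.gCone j x u u' := by
  rw [gPrime_eq hx, fderiv_σ₁, fderiv_σ₁]
  congr 1
  refine Finset.sum_congr rfl fun k _ => ?_
  have hs2 : √(D.ρ k x.1) * √(D.ρ k x.1) = D.ρ k x.1 := Real.mul_self_sqrt (ρ_pos hx k).le
  rw [gCone_eq hx, r_sq hx, dr_apply, dr_apply]
  congr 1
  linear_combination (-(∑ j, u.1 j / (x.1 j - D.α k.castSucc)) *
    ∑ j, u'.1 j / (x.1 j - D.α k.castSucc)) * hs2

/-! ### Local flat coordinates -/

/-- The coordinate with values in `ℂ^{dⱼ+1}`, for a choice `t` of the angle of `w`. -/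
def ζ (D : Data) (t : ℂ → ℝ) (j : Fin D.m) (x : D.W) : EuclideanSpace ℂ (Fin (D.d j + 1)) :=
  ((D.r j x : ℂ) * Complex.exp ((D.τ j * t x.2.2 : ℝ) * Complex.I)) • x.2.1 j

/-- The flat coordinates on `M⁰`, for a choice `t` of the angle of `w`. -/
def lift (D : Data) (t : ℂ → ℝ) (x : D.W) : D.Euc :=
  WithLp.toLp 2 (WithLp.toLp 2 (WithLp.toLp 2 fun j => D.ζ t j x, D.κ * t x.2.2),
    D.σ₁ x - ∑ k, D.α k)

theorem norm_ζ {x : D.W} (hx : x ∈ D.M0) (t : ℂ → ℝ) (j : Fin D.m) : ‖D.ζ t j x‖ = D.r j x := by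
  rw [ζ, norm_smul, norm_mul, Complex.norm_exp_ofReal_mul_I, hx.2.1 j, mul_one, mul_one,
    Complex.norm_real, Real.norm_of_nonneg (r_pos hx.1 j).le]

/-- A local choice of the angle, near `w₀`. -/
def angle (w₀ w : ℂ) : ℝ := (Complex.log (w / w₀)).im + w₀.arg

/-- The domain of the flat coordinates for the choice `angle w₀`. -/
def chart (D : Data) (w₀ : ℂ) : Set D.W :=
  {x | (∀ k, 0 < D.ρ k x.1) ∧ x.2.2 / w₀ ∈ Complex.slitPlane}

theorem contDiff_ρ (k : Fin D.m) : ContDiff ℝ (⊤ : ℕ∞) fun x : D.W => D.ρ k x.1 := by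
  refine ContDiff.div_const (ContDiff.neg (contDiff_prod fun j _ => ?_)) _
  exact contDiff_const.sub (D.coord j).contDiff

theorem isOpen_chart (w₀ : ℂ) : IsOpen (D.chart w₀) := by
  refine IsOpen.and ?_ (Complex.isOpen_slitPlane.preimage
    ((continuous_snd.comp continuous_snd).div_const w₀))
  simp only [Set.ofPred_forall]
  exact isOpen_iInter_of_finite fun k =>
    isOpen_lt continuous_const (contDiff_ρ k).continuous

theorem mem_chart {x : D.W} (hx : x ∈ D.M0) : x ∈ D.chart x.2.2 := by
  refine ⟨fun k => ρ_pos hx.1 k, ?_⟩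
  have h : x.2.2 ≠ 0 := norm_ne_zero_iff.1 (by rw [hx.2.2]; exact one_ne_zero)
  change x.2.2 / x.2.2 ∈ _
  rw [div_self h]
  exact Complex.one_mem_slitPlane

theorem contDiffOn_angle (w₀ : ℂ) :
    ContDiffOn ℝ (⊤ : ℕ∞) (angle w₀) {w | w / w₀ ∈ Complex.slitPlane} := by
  intro w hw
  refine ContDiffAt.contDiffWithinAt ?_
  refine ContDiffAt.add ?_ contDiffAt_const
  have h : ContDiffAt ℝ (⊤ : ℕ∞) (fun w => Complex.log (w / w₀)) w :=
    ((Complex.contDiffAt_log hw).restrict_scalars ℝ).comp w (contDiffAt_id.div_const w₀)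
  exact Complex.imCLM.contDiff.contDiffAt.comp w h

theorem contDiffOn_angle_comp (w₀ : ℂ) :
    ContDiffOn ℝ (⊤ : ℕ∞) (fun x : D.W => angle w₀ x.2.2) (D.chart w₀) :=
  (contDiffOn_angle w₀).comp (contDiff_snd.comp contDiff_snd).contDiffOn fun _ hx => hx.2

theorem contDiffOn_r (k : Fin D.m) (w₀ : ℂ) : ContDiffOn ℝ (⊤ : ℕ∞) (D.r k) (D.chart w₀) :=
  contDiffOn_const.mul ((contDiff_ρ k).contDiffOn.sqrt fun _ hx => (hx.1 k).ne')

theorem contDiffOn_ζ (w₀ : ℂ) (j : Fin D.m) :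
    ContDiffOn ℝ (⊤ : ℕ∞) (D.ζ (angle w₀) j) (D.chart w₀) := by
  have h1 : ContDiffOn ℝ (⊤ : ℕ∞) (fun x : D.W => (D.r j x : ℂ)) (D.chart w₀) :=
    Complex.ofRealCLM.contDiff.comp_contDiffOn (contDiffOn_r j w₀)
  have h2 : ContDiffOn ℝ (⊤ : ℕ∞) (fun x : D.W => D.τ j * angle w₀ x.2.2) (D.chart w₀) :=
    contDiffOn_const.mul (contDiffOn_angle_comp w₀)
  have h3 : ContDiffOn ℝ (⊤ : ℕ∞) (fun x : D.W => ((D.τ j * angle w₀ x.2.2 : ℝ) : ℂ))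
      (D.chart w₀) := Complex.ofRealCLM.contDiff.comp_contDiffOn h2
  have h4 : ContDiff ℝ (⊤ : ℕ∞) fun x : D.W => x.2.1 := contDiff_fst.comp contDiff_snd
  exact (h1.mul (h3.mul contDiffOn_const).cexp).smul (contDiff_pi.1 h4 j).contDiffOn

theorem contDiffOn_lift (w₀ : ℂ) :
    ContDiffOn ℝ (⊤ : ℕ∞) (D.lift (angle w₀)) (D.chart w₀) := by
  refine (WithLp.contDiff_toLp).comp_contDiffOn (ContDiffOn.prodMk
    ((WithLp.contDiff_toLp).comp_contDiffOn (ContDiffOn.prodMk ?_ ?_)) ?_)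
  · exact (PiLp.contDiff_toLp).comp_contDiffOn (contDiffOn_pi.2 fun j => contDiffOn_ζ w₀ j)
  · exact contDiffOn_const.mul (contDiffOn_angle_comp w₀)
  · refine ContDiffOn.sub ?_ contDiffOn_const
    have : D.σ₁ = ⇑(∑ j, D.coord j) := by
      funext x
      rw [σ₁_eq, _root_.sum_apply]
      rfl
    rw [this]
    exact (ContinuousLinearMap.contDiff _).contDiffOn

/-- On the unit circle, the differential of the angle is the angular form. -/
theorem hasFDerivAt_angle {w₀ : ℂ} {x : D.W} (hx : x ∈ D.M0) (hw : x ∈ D.chart w₀) :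
    ∃ t' : D.W →L[ℝ] ℝ, HasFDerivAt (fun x : D.W => angle w₀ x.2.2) t' x ∧
      ∀ u, t' u = D.η x u (Fin.last D.m) := by
  have hw0 : w₀ ≠ 0 := fun h => Complex.zero_notMem_slitPlane (by simpa [h] using hw.2)
  have h5 : x.2.2 ≠ 0 := norm_ne_zero_iff.1 (by rw [hx.2.2]; exact one_ne_zero)
  have h1 : HasFDerivAt (fun x : D.W => x.2.2)
      ((ContinuousLinearMap.snd ℝ _ ℂ).comp (ContinuousLinearMap.snd ℝ _ _)) x :=
    (hasFDerivAt_snd (𝕜 := ℝ) (p := x)).snd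
  have h2 := (((hasDerivAt_id x.2.2).div_const w₀).clog hw.2).hasFDerivAt.restrictScalars ℝ
  have h3 : HasFDerivAt (fun x : D.W => Complex.log (x.2.2 / w₀)) _ x :=
    HasFDerivAt.comp (g := fun w => Complex.log (w / w₀)) x h2 h1
  have h4 : HasFDerivAt (fun x : D.W => (Complex.log (x.2.2 / w₀)).im) _ x :=
    Complex.imCLM.hasFDerivAt.comp x h3
  refine ⟨_, h4.add_const w₀.arg, fun u => ?_⟩
  rw [η_last]
  have e : (inner ℂ x.2.2 u.2.2 : ℂ) = u.2.2 * (1 / w₀ / (x.2.2 / w₀)) := by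
    have h6 : (starRingEnd ℂ) x.2.2 * x.2.2 = 1 := by
      rw [← Complex.normSq_eq_conj_mul_self, Complex.normSq_eq_norm_sq, hx.2.2]; simp
    rw [RCLike.inner_apply]
    field_simp
    linear_combination u.2.2 * h6
  rw [e]
  simp

theorem hasFDerivAt_ζ {w₀ : ℂ} {x : D.W} (hx : x ∈ D.M0) (hw : x ∈ D.chart w₀) (j : Fin D.m) :
    ∃ ζ' : D.W →L[ℝ] EuclideanSpace ℂ (Fin (D.d j + 1)), HasFDerivAt (D.ζ (angle w₀) j) ζ' x ∧
      ∀ u, ζ' u = Complex.exp ((D.τ j * angle w₀ x.2.2 : ℝ) * Complex.I) •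
        ((D.dr j x u + D.r j x * (D.τ j * D.η x u (Fin.last D.m) : ℝ) * Complex.I : ℂ) • x.2.1 j +
          (D.r j x : ℂ) • u.2.1 j) := by
  obtain ⟨t', ht, ht'⟩ := hasFDerivAt_angle hx hw
  have h1 : HasFDerivAt (fun x : D.W => x.2.1 j)
      ((ContinuousLinearMap.proj j).comp ((ContinuousLinearMap.fst ℝ _ ℂ).comp
        (ContinuousLinearMap.snd ℝ _ _))) x :=
    hasFDerivAt_pi'.1 (hasFDerivAt_snd (𝕜 := ℝ) (p := x)).fst j
  have h2 := Complex.ofRealCLM.hasFDerivAt.comp x (hasFDerivAt_r hx.1 j)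
  have h3 := (Complex.ofRealCLM.hasFDerivAt.comp x (ht.const_mul (D.τ j))).mul_const Complex.I
  have h4 := ((Complex.hasDerivAt_exp _).hasFDerivAt.restrictScalars ℝ).comp x h3
  refine ⟨_, (h2.mul h4).smul h1, fun u => ?_⟩
  simp [ht', smul_smul, -Complex.coe_smul]
  module

theorem inner_fderiv_ζ {w₀ : ℂ} {x : D.W} (hx : x ∈ D.M0) (hw : x ∈ D.chart w₀) (j : Fin D.m)
    {u u' : D.W} (hu : u ∈ D.tangent x) (hu' : u' ∈ D.tangent x) :
    inner ℝ (fderiv ℝ (D.ζ (angle w₀) j) x u) (fderiv ℝ (D.ζ (angle w₀) j) x u') =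
      D.gCone j x u u' := by
  obtain ⟨ζ', h1, h2⟩ := hasFDerivAt_ζ hx hw j
  rw [h1.fderiv, h2, h2, inner_cone (hx.2.1 j) (hu.1 j) (hu'.1 j)
    (Complex.norm_exp_ofReal_mul_I _), gCone_eq hx.1, β_eq, β_eq, gFS, η_castSucc, η_castSucc]
  have hs : ((-1 : ℝ) ^ (D.m - (j : ℕ))) * (-1) ^ (D.m - (j : ℕ)) = 1 := by
    rw [← mul_pow]; norm_num
  set e : ℝ := (-1) ^ (D.m - (j : ℕ))
  set a := (inner ℂ (x.2.1 j) (u.2.1 j)).im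
  set a' := (inner ℂ (x.2.1 j) (u'.2.1 j)).im
  set b := D.τ j * D.η x u (Fin.last D.m)
  set b' := D.τ j * D.η x u' (Fin.last D.m)
  linear_combination (-(D.r j x ^ 2 * (a + b) * (a' + b'))) * hs

theorem fderiv_κ_mul_angle {w₀ : ℂ} {x : D.W} (hx : x ∈ D.M0) (hw : x ∈ D.chart w₀) (u : D.W) :
    fderiv ℝ (fun x : D.W => D.κ * angle w₀ x.2.2) x u = D.β₀ x u := by
  obtain ⟨t', ht, ht'⟩ := hasFDerivAt_angle hx hw
  rw [(ht.const_mul D.κ).fderiv, β₀_eq, ← ht']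
  rfl

/-- The flat coordinates are isometric. -/
theorem inner_fderiv_lift {w₀ : ℂ} {x : D.W} (hx : x ∈ D.M0) (hw : x ∈ D.chart w₀)
    {u u' : D.W} (hu : u ∈ D.tangent x) (hu' : u' ∈ D.tangent x) :
    inner ℝ (fderiv ℝ (D.lift (angle w₀)) x u) (fderiv ℝ (D.lift (angle w₀)) x u') =
      D.gPrime x u u' := by
  have h := (((contDiffOn_lift w₀).contDiffAt ((isOpen_chart w₀).mem_nhds hw)).differentiableAt
    (by simp)).hasFDerivAt
  have h1 := ((WithLp.prodContinuousLinearEquiv 2 ℝ _ _).toContinuousLinearMap.hasFDerivAt).comp x h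
  have h2 := (ContinuousLinearMap.fst ℝ (WithLp 2 (D.V × ℝ)) ℝ).hasFDerivAt.comp x h1
  have h3 := (ContinuousLinearMap.snd ℝ (WithLp 2 (D.V × ℝ)) ℝ).hasFDerivAt.comp x h1
  have h4 := ((WithLp.prodContinuousLinearEquiv 2 ℝ _ _).toContinuousLinearMap.hasFDerivAt).comp x
    h2
  have h5 := (ContinuousLinearMap.fst ℝ D.V ℝ).hasFDerivAt.comp x h4
  have h6 := (ContinuousLinearMap.snd ℝ D.V ℝ).hasFDerivAt.comp x h4
  have e3 : ∀ u, (fderiv ℝ (D.lift (angle w₀)) x u).snd = fderiv ℝ D.σ₁ x u := fun u => by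
    have := congrArg (· u) (h3.unique ((hasFDerivAt_σ₁ x).sub_const (∑ k, D.α k)))
    rw [(hasFDerivAt_σ₁ x).fderiv]
    exact this
  have e6 : ∀ u, (fderiv ℝ (D.lift (angle w₀)) x u).fst.snd = D.β₀ x u := fun u => by
    rw [← fderiv_κ_mul_angle hx hw]
    exact congrArg (· u) h6.fderiv.symm
  have e5 : ∀ j u, (fderiv ℝ (D.lift (angle w₀)) x u).fst.fst j =
      fderiv ℝ (D.ζ (angle w₀) j) x u := fun j u => by
    have h7 := (PiLp.hasFDerivAt_apply (𝕜 := ℝ) 2 (E := fun j => EuclideanSpace ℂ (Fin (D.d j + 1)))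
      (WithLp.toLp 2 fun j => D.ζ (angle w₀) j x) j).comp x h5
    exact congrArg (· u) h7.fderiv.symm
  rw [WithLp.prod_inner_apply, WithLp.prod_inner_apply, PiLp.inner_apply,
    gPrime_eq_sum_gCone hx.1]
  change (∑ j, inner ℝ ((fderiv ℝ (D.lift (angle w₀)) x u).fst.fst j)
    ((fderiv ℝ (D.lift (angle w₀)) x u').fst.fst j) +
    inner ℝ (fderiv ℝ (D.lift (angle w₀)) x u).fst.snd
      (fderiv ℝ (D.lift (angle w₀)) x u').fst.snd) +
    inner ℝ (fderiv ℝ (D.lift (angle w₀)) x u).snd (fderiv ℝ (D.lift (angle w₀)) x u').snd = _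
  simp only [e3, e6, e5, inner_fderiv_ζ hx hw _ hu hu']
  simp only [RCLike.inner_apply, conj_trivial]
  ring

end Data

/-! ### Quotients in which the distance of orbits is attained -/

section Attained

variable {X : Type*} [MetricSpace X] {G : Subgroup (X ≃ᵢ X)}

theorem eq_of_dist_eq_zero
    (hG : ∀ x y : X, ∃ g ∈ G, dist (OrbitSpace.mk G x) (OrbitSpace.mk G y) = dist x (g y))
    {e e' : WithLp 2 (OrbitSpace G × ℝ)} (h : dist e e' = 0) : e = e' := by
  rw [dist_withLp, Real.sqrt_eq_zero (by positivity)] at h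
  obtain ⟨h1, h2⟩ := (add_eq_zero_iff_of_nonneg (sq_nonneg _) (sq_nonneg _)).1 h
  refine (WithLp.ofLp_injective 2) (Prod.ext ?_
    (dist_eq_zero.1 (pow_eq_zero_iff two_ne_zero |>.1 h2)))
  have h3 : dist e.fst e'.fst = 0 := pow_eq_zero_iff two_ne_zero |>.1 h1
  obtain ⟨x, hx⟩ := OrbitSpace.mk_surjective G e.fst
  obtain ⟨y, hy⟩ := OrbitSpace.mk_surjective G e'.fst
  obtain ⟨g, hg, h4⟩ := hG x y
  change e.fst = e'.fst
  rw [← hx, ← hy] at h3 ⊢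
  rw [h3] at h4
  exact (OrbitSpace.mk_eq_mk.2 ⟨g, hg, (dist_eq_zero.1 h4.symm).symm⟩).symm

end Attained

namespace Data

variable {D : Data}

/-! ### The `ℤ`-action -/

theorem rotation_apply (t : Fin D.m → Circle) (x : D.V) (j : Fin D.m) :
    D.rotation t x j = t j • x j := rfl

theorem rotation_zero (t : Fin D.m → Circle) : D.rotation t 0 = 0 := by
  ext j k
  simp [rotation_apply]

theorem rotation_smul (t : Fin D.m → Circle) (c : ℝ) (x : D.V) :
    D.rotation t (c • x) = c • D.rotation t x := by
  ext j k
  simp only [rotation_apply, PiLp.smul_apply, Circle.smul_def, smul_eq_mul, Complex.real_smul]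
  ring

theorem norm_rotation (t : Fin D.m → Circle) (x : D.V) : ‖D.rotation t x‖ = ‖x‖ := by
  have h := (D.rotation t).isometry.dist_eq x 0
  rwa [rotation_zero, dist_zero_right, dist_zero_right] at h

theorem gen_zpow_apply (n : ℤ) (y : WithLp 2 (D.V × ℝ)) :
    (D.gen ^ n) y = WithLp.toLp 2 (D.rotation (D.τTorus ^ n) y.fst, y.snd + n * D.shift) := by
  have key : ∀ (n : ℕ) (y : WithLp 2 (D.V × ℝ)), (D.gen ^ n) y =
      WithLp.toLp 2 (D.rotation (D.τTorus ^ n) y.fst, y.snd + n * D.shift) := by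
    intro n
    induction n with
    | zero => intro y; simp; rfl
    | succ n ih =>
      intro y
      have e : (D.gen ^ (n + 1)) y = (D.gen ^ n) (D.gen y) := by rw [pow_succ]; rfl
      have e2 : D.rotation (D.τTorus ^ (n + 1)) y.fst =
        D.rotation (D.τTorus ^ n) (D.rotation D.τTorus y.fst) := by
        rw [pow_succ, map_mul]; rfl
      rw [e, ih, e2]
      change WithLp.toLp 2 (_, (y.snd + D.shift) + n * D.shift) = _
      congr 2
      push_cast
      ring
  obtain ⟨k, rfl | rfl⟩ := n.eq_nat_or_neg
  · rw [zpow_natCast, zpow_natCast, key]; rfl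
  · rw [zpow_neg, zpow_neg, zpow_natCast, zpow_natCast, map_inv]
    refine (D.gen ^ k).injective (((D.gen ^ k).apply_symm_apply y).trans ?_)
    rw [key]
    have e : D.rotation (D.τTorus ^ k) ((D.rotation (D.τTorus ^ k))⁻¹ y.fst) = y.fst :=
      (D.rotation (D.τTorus ^ k)).apply_symm_apply _
    change y = WithLp.toLp 2 (D.rotation (D.τTorus ^ k) ((D.rotation (D.τTorus ^ k))⁻¹ y.fst),
      (y.snd + ((-(k : ℤ) : ℤ) : ℝ) * D.shift) + k * D.shift)
    rw [e]
    push_cast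
    rw [neg_mul, neg_add_cancel_right]
    rfl

theorem shift_ne_zero : D.shift ≠ 0 := by
  unfold shift
  refine mul_ne_zero (neg_ne_zero.2 Real.two_pi_pos.ne') (mul_ne_zero
    (div_ne_zero two_ne_zero D.q_ne_zero) (Finset.prod_ne_zero_iff.2 fun k _ => ?_))
  exact sub_ne_zero.2 (D.strictMono_α (Fin.castSucc_lt_last k)).ne'

theorem gen_zpow_ne (n : ℤ) (hn : n ≠ 0) (y : WithLp 2 (D.V × ℝ)) : (D.gen ^ n) y ≠ y := by
  intro h
  have h' := congrArg WithLp.snd h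
  rw [gen_zpow_apply] at h'
  have h2 : y.snd + n * D.shift = y.snd := h'
  exact mul_ne_zero (Int.cast_ne_zero.2 hn) shift_ne_zero (by linarith)

theorem dist_fst_le {α β : Type*} [PseudoMetricSpace α] [PseudoMetricSpace β]
    (x y : WithLp 2 (α × β)) : dist x.fst y.fst ≤ dist x y := by
  rw [dist_withLp]
  exact Real.le_sqrt_of_sq_le (le_add_of_nonneg_right (sq_nonneg _))

theorem dist_snd_le {α β : Type*} [PseudoMetricSpace α] [PseudoMetricSpace β]
    (x y : WithLp 2 (α × β)) : dist x.snd y.snd ≤ dist x y := by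
  rw [dist_withLp]
  exact Real.le_sqrt_of_sq_le (le_add_of_nonneg_left (sq_nonneg _))

theorem abs_sub_mul_shift_le (n : ℤ) (x y : WithLp 2 (D.V × ℝ)) :
    |x.snd - y.snd - n * D.shift| ≤ dist x ((D.gen ^ n) y) := by
  refine le_trans (le_of_eq ?_) (dist_snd_le _ _)
  rw [gen_zpow_apply, Real.dist_eq]
  change _ = |x.snd - (y.snd + n * D.shift)|
  congr 1
  ring

theorem finite_setOf_gen_zpow_inter (K : Set (WithLp 2 (D.V × ℝ))) (hK : IsCompact K) :
    {n : ℤ | ((D.gen ^ n) '' K ∩ K).Nonempty}.Finite := by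
  obtain ⟨C, hC⟩ := hK.isBounded.subset_closedBall 0
  have h : ∀ y ∈ K, |y.snd| ≤ C := fun y hy => by
    have h1 := dist_snd_le y 0
    rw [Real.dist_eq] at h1
    have h2 : |y.snd - 0| ≤ dist y 0 := h1
    rw [sub_zero] at h2
    exact h2.trans (hC hy)
  obtain ⟨N, hN⟩ := exists_nat_ge (2 * C / |D.shift|)
  refine (Set.finite_Icc (-(N : ℤ)) N).subset ?_
  rintro n ⟨_, ⟨y, hy, rfl⟩, hy'⟩
  have h1 := h _ hy'
  rw [gen_zpow_apply] at h1
  have h2 : |y.snd + n * D.shift| ≤ C := h1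
  have h3 : |(n : ℝ)| * |D.shift| ≤ 2 * C := by
    rw [← abs_mul]
    have h4 := abs_sub (y.snd + n * D.shift) y.snd
    rw [add_sub_cancel_left] at h4
    linarith [h y hy]
  have h5 : |(n : ℝ)| ≤ N := ((le_div_iff₀ (abs_pos.2 shift_ne_zero)).2 h3).trans hN
  have h6 : |n| ≤ (N : ℤ) := by exact_mod_cast h5
  exact abs_le.1 h6

theorem exists_dist_mk_eq (x y : WithLp 2 (D.V × ℝ)) : ∃ n : ℤ,
    dist (OrbitSpace.mk (Subgroup.zpowers D.gen) x) (OrbitSpace.mk _ y) =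
      dist x ((D.gen ^ n) y) := by
  have ht : Filter.Tendsto (fun n : ℤ => dist x ((D.gen ^ n) y)) Filter.cofinite Filter.atTop := by
    have h1 := (tendsto_dist_left_cocompact_atTop (x.snd - y.snd)).comp
      (Int.tendsto_zmultiplesHom_cofinite (shift_ne_zero (D := D)))
    refine Filter.tendsto_atTop_mono (fun n => ?_) h1
    refine le_trans (le_of_eq ?_) (abs_sub_mul_shift_le n x y)
    rw [Function.comp_apply, zmultiplesHom_apply, zsmul_eq_mul, Real.dist_eq]
  obtain ⟨n, hn⟩ := ht.exists_forall_le
  refine ⟨n, le_antisymm (dist_mk_le (G := Subgroup.zpowers D.gen) ⟨n, rfl⟩ x y)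
    (le_ciInf fun g => ?_)⟩
  obtain ⟨k, hk⟩ := g.2
  rw [← hk]
  exact hn k

/-! ### The geometry of `E` -/

theorem E_eq_of_dist_eq_zero {e e' : D.E} (h : dist e e' = 0) : e = e' :=
  eq_of_dist_eq_zero (fun x y => by
    obtain ⟨n, hn⟩ := exists_dist_mk_eq x y
    exact ⟨_, ⟨n, rfl⟩, hn⟩) h

theorem dist_proj_le (y y' : D.Euc) : dist (D.proj y) (D.proj y') ≤ dist y y' := by
  rw [dist_withLp, dist_withLp]
  refine Real.sqrt_le_sqrt (add_le_add_left (pow_le_pow_left₀ dist_nonneg ?_ 2) _)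
  exact dist_mk_le_dist _ y.fst y'.fst

theorem proj_eq_proj {y y' : D.Euc} :
    D.proj y = D.proj y' ↔ (∃ n : ℤ, (D.gen ^ n) y.fst = y'.fst) ∧ y.snd = y'.snd := by
  constructor
  · intro h
    have h1 : OrbitSpace.mk (Subgroup.zpowers D.gen) y.fst = OrbitSpace.mk _ y'.fst :=
      congrArg WithLp.fst h
    obtain ⟨g, ⟨n, rfl⟩, hg⟩ := OrbitSpace.mk_eq_mk.1 h1
    have h2 : (D.proj y).snd = (D.proj y').snd := congrArg WithLp.snd h
    exact ⟨⟨n, hg⟩, h2⟩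
  · rintro ⟨⟨n, hn⟩, h2⟩
    have h1 : OrbitSpace.mk (Subgroup.zpowers D.gen) y.fst = OrbitSpace.mk _ y'.fst :=
      OrbitSpace.mk_eq_mk.2 ⟨_, ⟨n, rfl⟩, hn⟩
    unfold proj
    rw [h1, h2]

theorem proj_surjective : Function.Surjective D.proj := by
  intro e
  obtain ⟨x, hx⟩ := OrbitSpace.mk_surjective _ e.fst
  refine ⟨WithLp.toLp 2 (x, e.snd), ?_⟩
  unfold proj
  change WithLp.toLp 2 (OrbitSpace.mk _ x, e.snd) = _
  rw [hx]
  rfl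

theorem exists_proj_eq_dist_eq (y : D.Euc) (e : D.E) :
    ∃ y', D.proj y' = e ∧ dist y y' = dist (D.proj y) e := by
  obtain ⟨z, rfl⟩ := proj_surjective e
  obtain ⟨n, hn⟩ := exists_dist_mk_eq y.fst z.fst
  refine ⟨WithLp.toLp 2 ((D.gen ^ n) z.fst, z.snd), proj_eq_proj.2 ⟨⟨-n, ?_⟩, rfl⟩, ?_⟩
  · rw [zpow_neg]
    exact (D.gen ^ n).symm_apply_apply z.fst
  · rw [dist_withLp (D.proj y), dist_withLp y]
    change √(dist y.fst ((D.gen ^ n) z.fst) ^ 2 + dist y.snd z.snd ^ 2) = _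
    rw [← hn]
    rfl

theorem image_proj_ball (y : D.Euc) (ε : ℝ) :
    D.proj '' Metric.ball y ε = Metric.ball (D.proj y) ε := by
  ext e
  constructor
  · rintro ⟨y', hy', rfl⟩
    exact (dist_proj_le y' y).trans_lt hy'
  · intro he
    obtain ⟨y', rfl, h⟩ := exists_proj_eq_dist_eq y e
    rw [Metric.mem_ball, dist_comm] at he
    exact ⟨y', by rwa [Metric.mem_ball, dist_comm, h], rfl⟩

theorem continuous_proj : Continuous D.proj :=
  (LipschitzWith.of_dist_le_mul (K := 1) fun x y => by simpa using dist_proj_le x y).continuous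

theorem isOpenMap_proj : IsOpenMap D.proj := by
  intro U hU
  rw [Metric.isOpen_iff]
  rintro _ ⟨y, hy, rfl⟩
  obtain ⟨ε, hε, h⟩ := Metric.isOpen_iff.1 hU y hy
  exact ⟨ε, hε, by rw [← image_proj_ball]; exact Set.image_mono h⟩

/-- The covering map is isometric on balls whose radius is a quarter of the translation length. -/
theorem dist_proj_eq {y y₁ y₂ : D.Euc} (h₁ : y₁ ∈ Metric.ball y (|D.shift| / 4))
    (h₂ : y₂ ∈ Metric.ball y (|D.shift| / 4)) : dist (D.proj y₁) (D.proj y₂) = dist y₁ y₂ := by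
  refine le_antisymm (dist_proj_le _ _) ?_
  rw [dist_withLp y₁, dist_withLp (D.proj y₁)]
  refine Real.sqrt_le_sqrt (add_le_add_left (pow_le_pow_left₀ dist_nonneg ?_ 2) _)
  obtain ⟨n, hn⟩ := exists_dist_mk_eq y₁.fst y₂.fst
  change dist y₁.fst y₂.fst ≤
    dist (OrbitSpace.mk (Subgroup.zpowers D.gen) y₁.fst) (OrbitSpace.mk _ y₂.fst)
  rw [hn]
  by_cases h0 : n = 0
  · rw [h0, zpow_zero]; rfl
  have h12 : dist y₁ y₂ < |D.shift| / 2 := by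
    have := dist_triangle_right y₁ y₂ y
    rw [Metric.mem_ball] at h₁ h₂
    linarith
  have h3 := dist_fst_le y₁ y₂
  have h4 := (dist_snd_le y₁.fst y₂.fst).trans h3
  have h5 := abs_sub_mul_shift_le n y₁.fst y₂.fst
  have h6 : |D.shift| ≤ |n * D.shift| := by
    rw [abs_mul]
    refine le_mul_of_one_le_left (abs_nonneg _) ?_
    exact_mod_cast Int.one_le_abs h0
  have h7 := abs_sub_abs_le_abs_sub (n * D.shift) (y₁.fst.snd - y₂.fst.snd)
  rw [abs_sub_comm (n * D.shift)] at h7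
  rw [Real.dist_eq] at h4
  linarith

/-- Segments between suitable lifts project to minimal geodesics. -/
theorem exists_geodesic (e e' : D.E) : ∃ γ : ℝ → D.E, γ 0 = e ∧ γ (dist e e') = e' ∧
    ∀ s ∈ Set.Icc 0 (dist e e'), ∀ t ∈ Set.Icc 0 (dist e e'), dist (γ s) (γ t) = |s - t| := by
  obtain ⟨y, rfl⟩ := proj_surjective e
  obtain ⟨y', rfl, hL⟩ := exists_proj_eq_dist_eq y e'
  set L := dist (D.proj y) (D.proj y')
  rcases (dist_nonneg : 0 ≤ L).eq_or_lt with h0 | h0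
  · refine ⟨fun _ => D.proj y, rfl, E_eq_of_dist_eq_zero h0.symm, fun s hs t ht => ?_⟩
    rw [show L = 0 from h0.symm] at hs ht
    rw [dist_self, le_antisymm hs.2 hs.1, le_antisymm ht.2 ht.1, sub_zero, abs_zero]
  set γ : ℝ → D.E := fun s => D.proj (AffineMap.lineMap y y' (s / L))
  have hγ0 : γ 0 = D.proj y := by simp [γ]
  have hγL : γ L = D.proj y' := by simp [γ, div_self (show L ≠ 0 from h0.ne')]
  have hle : ∀ s t, dist (γ s) (γ t) ≤ |s - t| := fun s t => by
    refine (dist_proj_le _ _).trans (le_of_eq ?_)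
    rw [dist_lineMap_lineMap, hL, Real.dist_eq, ← sub_div, abs_div, abs_of_pos h0,
      div_mul_cancel₀ _ h0.ne']
  have key : ∀ s ∈ Set.Icc 0 L, ∀ t ∈ Set.Icc 0 L, s ≤ t → dist (γ s) (γ t) = |s - t| := by
    intro s hs t ht hst
    refine le_antisymm (hle s t) ?_
    have h1 := dist_triangle4 (γ 0) (γ s) (γ t) (γ L)
    have h2 := hle 0 s
    have h3 := hle t L
    rw [zero_sub, abs_neg, abs_of_nonneg hs.1] at h2
    rw [abs_sub_comm, abs_of_nonneg (sub_nonneg.2 ht.2)] at h3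
    have h4 : dist (γ 0) (γ L) = L := by rw [hγ0, hγL]
    rw [abs_sub_comm, abs_of_nonneg (sub_nonneg.2 hst)]
    linarith
  refine ⟨γ, hγ0, hγL, fun s hs t ht => ?_⟩
  rcases le_total s t with h | h
  · exact key s hs t ht h
  · rw [dist_comm, abs_sub_comm]
    exact key t ht s hs h

/-! ### The asymptotic cone -/

theorem isCompact_Λ : IsCompact (D.Λ : Set (Fin D.m → Circle)) :=
  (Subgroup.isClosed_topologicalClosure _).isCompact

theorem continuous_rotation (x : D.V) : Continuous fun t => D.rotation t x :=
  (PiLp.continuous_toLp 2 _).comp <| continuous_pi fun j =>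
    (continuous_apply j).smul continuous_const

theorem exists_dist_mk_Λ_eq (x y : D.V) : ∃ t ∈ D.Λ,
    dist (OrbitSpace.mk (D.Λ.map D.rotation) x) (OrbitSpace.mk _ y) =
      dist x (D.rotation t y) := by
  obtain ⟨t, ht, hmin⟩ := isCompact_Λ.exists_isMinOn (f := fun t => dist x (D.rotation t y))
    ⟨1, D.Λ.one_mem⟩ (continuous_const.dist (continuous_rotation y)).continuousOn
  refine ⟨t, ht, le_antisymm (dist_mk_le (Subgroup.mem_map_of_mem _ ht) x y)
    (le_ciInf fun g => ?_)⟩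
  obtain ⟨s, hs, hg⟩ := g.2
  rw [← hg]
  exact hmin hs

theorem Cone_eq_of_dist_eq_zero {z z' : D.Cone} (h : dist z z' = 0) : z = z' :=
  eq_of_dist_eq_zero (fun x y => by
    obtain ⟨t, ht, h⟩ := exists_dist_mk_Λ_eq x y
    exact ⟨_, Subgroup.mem_map_of_mem _ ht, h⟩) h

/-- Rotations by nearby elements of the torus are close to each other. -/
theorem dist_rotation_le {s t : Fin D.m → Circle} {δ : ℝ} (hδ : 0 ≤ δ) (h : dist s t ≤ δ)
    (x : D.V) : dist (D.rotation s x) (D.rotation t x) ≤ δ * ‖x‖ := by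
  rw [PiLp.dist_eq_of_L2, PiLp.norm_eq_of_L2, ← Real.sqrt_sq hδ, ← Real.sqrt_mul (sq_nonneg δ),
    Finset.mul_sum]
  refine Real.sqrt_le_sqrt (Finset.sum_le_sum fun j _ => ?_)
  rw [← mul_pow]
  refine pow_le_pow_left₀ dist_nonneg ?_ 2
  rw [rotation_apply, rotation_apply, dist_eq_norm, Circle.smul_def, Circle.smul_def, ← sub_smul,
    norm_smul]
  refine mul_le_mul_of_nonneg_right ?_ (norm_nonneg _)
  exact ((dist_eq_norm (s j : ℂ) (t j)).symm.trans_le (dist_le_pi_dist s t j)).trans h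

/-- Finitely many powers of `τ` suffice to approximate all elements of `Λ`. -/
theorem exists_zpow_near (D : Data) {δ : ℝ} (hδ : 0 < δ) : ∃ N : ℕ, ∀ t ∈ D.Λ, ∃ n : ℤ,
    |(n : ℝ)| ≤ N ∧ ∀ x, dist (D.rotation t x) (D.rotation (D.τTorus ^ n) x) ≤ δ * ‖x‖ := by
  obtain ⟨S, hS⟩ := isCompact_Λ.elim_finite_subcover (fun n : ℤ => Metric.ball (D.τTorus ^ n) δ)
    (fun n => Metric.isOpen_ball) (fun t ht => by
      obtain ⟨_, ⟨n, rfl⟩, h⟩ := Metric.mem_closure_iff.1 ht δ hδ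
      exact Set.mem_iUnion.2 ⟨n, h⟩)
  refine ⟨S.sup Int.natAbs, fun t ht => ?_⟩
  obtain ⟨n, hn, h⟩ := Set.mem_iUnion₂.1 (hS ht)
  refine ⟨n, ?_, fun x => dist_rotation_le hδ.le (le_of_lt h) x⟩
  rw [← Int.cast_abs, Int.abs_eq_natAbs, Int.cast_natCast]
  exact_mod_cast Finset.le_sup hn

/-- The rescaling map from the Euclidean space to the cone. -/
def toCone (D : Data) (c : ℝ) (y : D.Euc) : D.Cone :=
  WithLp.toLp 2 (OrbitSpace.mk _ (c • y.fst.fst), c * y.snd)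

theorem norm_eq_sqrt {α β : Type*} [NormedAddCommGroup α] [NormedAddCommGroup β]
    (x : WithLp 2 (α × β)) : ‖x‖ = √(‖x.fst‖ ^ 2 + ‖x.snd‖ ^ 2) :=
  WithLp.prod_norm_eq_of_L2 x

theorem dist_mk_zero (x : D.V) : dist (OrbitSpace.mk (D.Λ.map D.rotation) 0) (OrbitSpace.mk _ x) =
    ‖x‖ := by
  obtain ⟨t, -, h⟩ := exists_dist_mk_Λ_eq 0 x
  rw [h, dist_zero_left, norm_rotation]

theorem dist_apex (x : D.V) (s : ℝ) :
    dist D.apex (WithLp.toLp 2 (OrbitSpace.mk _ x, s)) = √(‖x‖ ^ 2 + s ^ 2) := by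
  rw [dist_withLp]
  change √(dist (OrbitSpace.mk _ 0) (OrbitSpace.mk _ x) ^ 2 + dist (0 : ℝ) s ^ 2) = _
  rw [dist_mk_zero, dist_zero_left, Real.norm_eq_abs, sq_abs]

theorem dist_apex_toCone_le {c : ℝ} (hc : 0 ≤ c) (y : D.Euc) :
    dist D.apex (D.toCone c y) ≤ c * ‖y‖ := by
  rw [toCone, dist_apex, norm_eq_sqrt, norm_eq_sqrt, Real.sq_sqrt (by positivity), norm_smul,
    Real.norm_of_nonneg hc, mul_pow, mul_pow, ← mul_add, Real.sqrt_mul (sq_nonneg c),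
    Real.sqrt_sq hc, Real.norm_eq_abs y.snd, sq_abs]
  refine mul_le_mul_of_nonneg_left (Real.sqrt_le_sqrt ?_) hc
  have := sq_nonneg ‖y.fst.snd‖
  linarith

theorem norm_fst_fst_le_dist_apex {c : ℝ} (hc : 0 ≤ c) (y : D.Euc) :
    c * ‖y.fst.fst‖ ≤ dist D.apex (D.toCone c y) := by
  rw [toCone, dist_apex, norm_smul, Real.norm_of_nonneg hc]
  exact Real.le_sqrt_of_sq_le (le_add_of_nonneg_right (sq_nonneg _))

theorem sqrt_mul_sq_add {c : ℝ} (hc : 0 ≤ c) (a b : ℝ) :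
    √((c * a) ^ 2 + (c * b) ^ 2) = c * √(a ^ 2 + b ^ 2) := by
  rw [mul_pow, mul_pow, ← mul_add, Real.sqrt_mul (sq_nonneg c), Real.sqrt_sq hc]

theorem sqrt_add_sq_le {a b s : ℝ} (hb : 0 ≤ b) :
    √((a + b) ^ 2 + s ^ 2) ≤ √(a ^ 2 + s ^ 2) + b := by
  have h1 : 0 ≤ √(a ^ 2 + s ^ 2) := Real.sqrt_nonneg _
  refine Real.sqrt_le_iff.2 ⟨by positivity, ?_⟩
  have h2 : a ≤ √(a ^ 2 + s ^ 2) := Real.le_sqrt_of_sq_le (le_add_of_nonneg_right (sq_nonneg _))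
  have h3 := Real.sq_sqrt (show 0 ≤ a ^ 2 + s ^ 2 by positivity)
  nlinarith

theorem dist_toCone {c : ℝ} (hc : 0 ≤ c) (y y' : D.Euc) :
    ∃ t ∈ D.Λ, dist (D.toCone c y) (D.toCone c y') =
      c * √(dist y.fst.fst (D.rotation t y'.fst.fst) ^ 2 + dist y.snd y'.snd ^ 2) ∧
      ∀ s ∈ D.Λ, dist (D.toCone c y) (D.toCone c y') ≤
      c * √(dist y.fst.fst (D.rotation s y'.fst.fst) ^ 2 + dist y.snd y'.snd ^ 2) := by
  have e : ∀ s, dist (c • y.fst.fst) (D.rotation s (c • y'.fst.fst)) =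
      c * dist y.fst.fst (D.rotation s y'.fst.fst) := fun s => by
    rw [rotation_smul, dist_smul₀, Real.norm_of_nonneg hc]
  have e2 : dist (c * y.snd) (c * y'.snd) = c * dist y.snd y'.snd := by
    rw [Real.dist_eq, Real.dist_eq, ← mul_sub, abs_mul, abs_of_nonneg hc]
  obtain ⟨t, ht, h⟩ := exists_dist_mk_Λ_eq (c • y.fst.fst) (c • y'.fst.fst)
  refine ⟨t, ht, ?_, fun s hs => ?_⟩
  · rw [← sqrt_mul_sq_add hc, ← e, ← e2, ← h, dist_withLp]
    rfl
  · rw [← sqrt_mul_sq_add hc, ← e, ← e2, dist_withLp]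
    refine Real.sqrt_le_sqrt (add_le_add_left (pow_le_pow_left₀ dist_nonneg ?_ 2) _)
    exact dist_mk_le (Subgroup.mem_map_of_mem _ hs) _ _

theorem zpow_mem_Λ (n : ℤ) : D.τTorus ^ n ∈ D.Λ :=
  Subgroup.le_topologicalClosure _ ⟨n, rfl⟩

theorem dist_toCone_le {c : ℝ} (hc : 0 ≤ c) (y y' : D.Euc) :
    dist (D.toCone c y) (D.toCone c y') ≤ c * dist (D.proj y) (D.proj y') := by
  obtain ⟨n, hn⟩ := exists_dist_mk_eq y.fst y'.fst
  obtain ⟨-, -, -, h⟩ := dist_toCone hc y y'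
  refine (h _ (zpow_mem_Λ n)).trans (mul_le_mul_of_nonneg_left ?_ hc)
  rw [dist_withLp]
  refine Real.sqrt_le_sqrt (add_le_add_left (pow_le_pow_left₀ dist_nonneg ?_ 2) _)
  change _ ≤ dist (OrbitSpace.mk _ y.fst) (OrbitSpace.mk _ y'.fst)
  rw [hn]
  refine le_trans (le_of_eq ?_) (dist_fst_le _ _)
  rw [gen_zpow_apply]
  rfl

/-- In `E`, the distance exceeds that in the cone by a small multiple of the radius and a constant.
The lifts are normalized in the direction in which the deck transformations translate. -/
theorem mul_dist_proj_le {c δ : ℝ} (hc : 0 ≤ c) {N : ℕ} (hN : ∀ t ∈ D.Λ, ∃ n : ℤ,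
      |(n : ℝ)| ≤ N ∧ ∀ x, dist (D.rotation t x) (D.rotation (D.τTorus ^ n) x) ≤ δ * ‖x‖)
    (hδ : 0 ≤ δ) (y y' : D.Euc) (hy : y.fst.snd ∈ Set.Icc 0 |D.shift|)
    (hy' : y'.fst.snd ∈ Set.Icc 0 |D.shift|) :
    c * dist (D.proj y) (D.proj y') ≤ dist (D.toCone c y) (D.toCone c y') +
      δ * (c * ‖y'.fst.fst‖) + c * ((N + 1) * |D.shift|) := by
  obtain ⟨t, ht, h, -⟩ := dist_toCone hc y y'
  obtain ⟨n, hn, hx⟩ := hN t ht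
  set a := dist y.fst.fst (D.rotation t y'.fst.fst)
  have h1 : dist (OrbitSpace.mk (Subgroup.zpowers D.gen) y.fst) (OrbitSpace.mk _ y'.fst) ≤
      a + (δ * ‖y'.fst.fst‖ + (N + 1) * |D.shift|) := by
    refine (dist_mk_le (G := Subgroup.zpowers D.gen) ⟨n, rfl⟩ _ _).trans ?_
    change dist y.fst ((D.gen ^ n) y'.fst) ≤ _
    rw [gen_zpow_apply, dist_withLp]
    change √(dist y.fst.fst (D.rotation (D.τTorus ^ n) y'.fst.fst) ^ 2 +
      dist y.fst.snd (y'.fst.snd + n * D.shift) ^ 2) ≤ _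
    have h2 := (dist_triangle y.fst.fst (D.rotation t y'.fst.fst)
      (D.rotation (D.τTorus ^ n) y'.fst.fst)).trans (add_le_add_right (hx y'.fst.fst) _)
    have h3 : dist y.fst.snd (y'.fst.snd + n * D.shift) ≤ (N + 1) * |D.shift| := by
      rw [Real.dist_eq, ← sub_sub]
      refine (abs_sub _ _).trans ?_
      rw [abs_mul]
      have h4 : |y.fst.snd - y'.fst.snd| ≤ |D.shift| := by
        rw [abs_le]
        constructor <;> linarith [hy.1, hy.2, hy'.1, hy'.2]
      have h5 := mul_le_mul_of_nonneg_right hn (abs_nonneg D.shift)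
      linarith
    refine (Real.sqrt_le_sqrt (add_le_add (pow_le_pow_left₀ dist_nonneg h2 2)
      (pow_le_pow_left₀ dist_nonneg h3 2))).trans ?_
    have h6 : 0 ≤ a + δ * ‖y'.fst.fst‖ := by positivity
    have h7 : 0 ≤ (N + 1) * |D.shift| := by positivity
    refine Real.sqrt_le_iff.2 ⟨by positivity, ?_⟩
    nlinarith
  rw [h, add_assoc]
  have h8 : δ * (c * ‖y'.fst.fst‖) + c * ((N + 1) * |D.shift|) =
      c * (δ * ‖y'.fst.fst‖ + (N + 1) * |D.shift|) := by ring
  rw [h8, ← mul_add]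
  refine mul_le_mul_of_nonneg_left ?_ hc
  refine le_trans ?_ (sqrt_add_sq_le (by positivity))
  rw [dist_withLp]
  exact Real.sqrt_le_sqrt (add_le_add_left (pow_le_pow_left₀ dist_nonneg h1 2) _)

/-- Powers of the generator bring the coordinate of the line into a bounded interval, so that only
the other coordinates matter at large scales. -/
theorem exists_normalized_lift (e : D.E) :
    ∃ y, D.proj y = e ∧ y.fst.snd ∈ Set.Icc 0 |D.shift| := by
  obtain ⟨y, rfl⟩ := proj_surjective e
  have hpos : 0 < |D.shift| := abs_pos.2 shift_ne_zero
  obtain ⟨n, hn, -⟩ := existsUnique_add_zsmul_mem_Ico hpos y.fst.snd 0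
  have h : ∃ k : ℤ, k * D.shift = n • |D.shift| := by
    rcases abs_choice D.shift with h | h
    · exact ⟨n, by rw [h, zsmul_eq_mul]⟩
    · exact ⟨-n, by rw [h, zsmul_eq_mul]; push_cast; ring⟩
  obtain ⟨k, hk⟩ := h
  refine ⟨WithLp.toLp 2 ((D.gen ^ k) y.fst, y.snd), proj_eq_proj.2 ⟨⟨-k, ?_⟩, rfl⟩, ?_⟩
  · rw [zpow_neg]
    exact (D.gen ^ k).symm_apply_apply y.fst
  · rw [gen_zpow_apply]
    change y.fst.snd + k * D.shift ∈ _
    rw [hk]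
    exact ⟨hn.1, by simpa using hn.2.le⟩

theorem toCone_eq_of_proj_eq {y y' : D.Euc} (h : D.proj y = D.proj y') (c : ℝ) :
    D.toCone c y = D.toCone c y' := by
  obtain ⟨⟨n, hn⟩, h2⟩ := proj_eq_proj.1 h
  have e : OrbitSpace.mk (D.Λ.map D.rotation) (c • y.fst.fst) =
      OrbitSpace.mk _ (c • y'.fst.fst) := by
    refine OrbitSpace.mk_eq_mk.2 ⟨_, Subgroup.mem_map_of_mem _ (zpow_mem_Λ n), ?_⟩
    rw [rotation_smul, ← hn, gen_zpow_apply]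
    rfl
  unfold toCone
  rw [e, h2]

open Filter Topology in
/-- The rescalings of `E` converge to the cone, with the rescaling maps as approximations. -/
theorem rescalingsConverge (p : D.E) (c : ℕ → ℝ) (hc : ∀ i, 0 < c i)
    (hc0 : Tendsto c atTop (𝓝 0)) : RescalingsConverge D.E p c D.Cone D.apex := by
  classical
  intro R hR ε hε
  choose y hy hys using exists_normalized_lift (D := D)
  -- An element of `Λ` within `δ` of a power of `τ` moves points of norm at most `R + 1` to within
  -- `δ (R + 1) = ε / 4` of the image under that power.
  set δ := ε / (4 * (R + 1))
  have hδ : 0 < δ := by positivity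
  obtain ⟨N, hN⟩ := D.exists_zpow_near hδ
  have hc1 : Tendsto (fun i => c i * ‖y p‖) atTop (𝓝 0) := by simpa using hc0.mul_const ‖y p‖
  have hc2 : Tendsto (fun i => c i * ((N + 1) * |D.shift|)) atTop (𝓝 0) := by
    simpa using hc0.mul_const ((N + 1) * |D.shift|)
  filter_upwards [hc1.eventually_lt_const zero_lt_one,
    hc1.eventually_lt_const (show 0 < ε / 8 by positivity),
    hc2.eventually_lt_const (show 0 < ε / 4 by positivity)] with i h1 h2 h3
  have hci := (hc i).le
  set f : D.E → D.Cone := fun a => if a = p then D.apex else D.toCone (c i) (y a)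
  have hfD : ∀ a, dist (f a) (D.toCone (c i) (y a)) < ε / 8 := fun a => by
    by_cases ha : a = p
    · simp only [f, ha, if_true]
      exact (dist_apex_toCone_le hci _).trans_lt h2
    · simp only [f, ha, if_false, dist_self]
      positivity
  refine ⟨f, by simp [f], fun a b _ hb => ?_, fun z hz => ?_⟩
  · have hlow := dist_toCone_le hci (y a) (y b)
    have hup := mul_dist_proj_le hci hN hδ.le (y a) (y b) (hys a) (hys b)
    have hpb := dist_toCone_le hci (y p) (y b)
    rw [hy, hy] at hlow hup hpb
    have hb1 : c i * ‖(y b).fst.fst‖ ≤ R + 1 := by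
      have t1 := norm_fst_fst_le_dist_apex hci (y b)
      have t2 := dist_triangle D.apex (D.toCone (c i) (y p)) (D.toCone (c i) (y b))
      have t3 := dist_apex_toCone_le hci (y p)
      linarith
    have hb2 : δ * (c i * ‖(y b).fst.fst‖) ≤ ε / 4 := by
      refine (mul_le_mul_of_nonneg_left hb1 hδ.le).trans (le_of_eq ?_)
      simp only [δ]
      field_simp
    have u1 := dist_triangle4 (f a) (D.toCone (c i) (y a)) (D.toCone (c i) (y b)) (f b)
    have u2 := dist_triangle4 (D.toCone (c i) (y a)) (f a) (f b) (D.toCone (c i) (y b))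
    have u3 := hfD a
    have u4 := hfD b
    rw [dist_comm (D.toCone (c i) (y b)) (f b)] at u1
    rw [dist_comm (D.toCone (c i) (y a)) (f a)] at u2
    rw [abs_lt]
    constructor <;> linarith
  · obtain ⟨v, hv⟩ := OrbitSpace.mk_surjective _ z.fst
    set w : D.Euc := WithLp.toLp 2 (WithLp.toLp 2 ((c i)⁻¹ • v, 0), (c i)⁻¹ * z.snd)
    have hz' : z = WithLp.toLp 2 (OrbitSpace.mk _ v, z.snd) := by rw [hv]; rfl
    have hwz : D.toCone (c i) w = z := by
      rw [hz']
      change WithLp.toLp 2 (OrbitSpace.mk _ (c i • (c i)⁻¹ • v), c i * ((c i)⁻¹ * z.snd)) = _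
      rw [smul_inv_smul₀ (hc i).ne', mul_inv_cancel_left₀ (hc i).ne']
    have hnw : c i * ‖w‖ = dist D.apex z := by
      rw [hz', dist_apex, norm_eq_sqrt, norm_eq_sqrt, Real.sq_sqrt (by positivity),
        ← Real.sqrt_sq hci, ← Real.sqrt_mul (sq_nonneg (c i))]
      change √(c i ^ 2 * (‖(c i)⁻¹ • v‖ ^ 2 + ‖(0 : ℝ)‖ ^ 2 + ‖(c i)⁻¹ * z.snd‖ ^ 2)) = _
      have := (hc i).ne'
      rw [norm_smul, norm_mul, Real.norm_of_nonneg (inv_nonneg.2 hci), norm_zero,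
        Real.norm_eq_abs, mul_pow, mul_pow, sq_abs]
      congr 1
      field_simp
      ring
    refine ⟨D.proj w, ?_, ?_⟩
    · have t1 := dist_proj_le (y p) w
      have t2 := dist_le_norm_add_norm (y p) w
      rw [hy] at t1
      have t3 := mul_le_mul_of_nonneg_left (t1.trans t2) hci
      rw [mul_add, hnw] at t3
      linarith
    · have t1 := hfD (D.proj w)
      rw [toCone_eq_of_proj_eq (hy (D.proj w)), hwz] at t1
      linarith

/-! ### Reconstruction of the coordinates `ξ` from the radii and from `σ₁` -/

/-- The polynomial `A(t)(t - c) - ∑ₖ wₖ ∏_{n≠k} (t - αₙ)`. It is `p_nc` if `wₖ = rₖ²/4` and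
`c = σ₁ - ∑_{k<l} αₖ`. -/
def poly (D : Data) (c : ℝ) (w : Fin D.m → ℝ) (t : ℝ) : ℝ :=
  D.A t * (t - c) - ∑ k : Fin D.m, w k * ∏ n ∈ Finset.univ.erase k, (t - D.α n.castSucc)

/-- The quotient of `poly` and `A`. -/
def rat (D : Data) (c : ℝ) (w : Fin D.m → ℝ) (t : ℝ) : ℝ :=
  t - c - ∑ k : Fin D.m, w k / (t - D.α k.castSucc)

theorem poly_eq_A_mul_rat (c : ℝ) (w : Fin D.m → ℝ) {t : ℝ} (ht : ∀ k : Fin D.m,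
    t ≠ D.α k.castSucc) : D.poly c w t = D.A t * D.rat c w t := by
  rw [poly, rat, mul_sub _ (t - c), Finset.mul_sum]
  congr 1
  refine Finset.sum_congr rfl fun k _ => ?_
  have := sub_ne_zero.2 (ht k)
  rw [A_eq_mul D k]
  field_simp

theorem poly_α (c : ℝ) (w : Fin D.m → ℝ) (k : Fin D.m) :
    D.poly c w (D.α k.castSucc) = -(w k * D.Δα k) := by
  rw [poly, A_eq_mul D k, sub_self, zero_mul, zero_mul, zero_sub, Finset.sum_eq_single k]
  · rfl
  · intro n _ hn
    rw [Finset.prod_eq_zero (Finset.mem_erase.2 ⟨hn.symm, Finset.mem_univ k⟩) (sub_self _),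
      mul_zero]
  · exact fun h => absurd (Finset.mem_univ k) h

open Polynomial in
/-- The subleading coefficient of `∏_{i≠j} (t - ξᵢ)`, by interpolation. -/
theorem sum_prod_div_Δα (ξ : Fin (D.m + 1) → ℝ) (j : Fin (D.m + 1)) :
    ∑ k : Fin D.m, (∏ i ∈ Finset.univ.erase j, (D.α k.castSucc - ξ i)) / D.Δα k =
      ∑ k : Fin D.m, D.α k.castSucc - ∑ i ∈ Finset.univ.erase j, ξ i := by
  have hc : (Finset.univ.erase j).card = (Finset.univ : Finset (Fin D.m)).card := by simp
  have hpos : 0 < (Finset.univ : Finset (Fin D.m)).card := by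
    rw [Finset.card_univ, Fintype.card_fin]; exact D.one_le_m
  have h := Lagrange.coeff_eq_sum D.α_injective.injOn (degree_nodal_sub_nodal_lt
    (Finset.univ.erase j) (Finset.univ : Finset (Fin D.m)) ξ (fun k => D.α k.castSucc) hc)
  rw [coeff_sub, Lagrange.nodal, Lagrange.nodal, prod_X_sub_C_coeff_card_pred _ _ hpos, ← hc,
    prod_X_sub_C_coeff_card_pred _ _ (hc ▸ hpos)] at h
  rw [← neg_add_eq_sub, ← sub_neg_eq_add (-_), h]
  refine Finset.sum_congr rfl fun k _ => ?_
  rw [eval_sub, eval_prod, eval_prod, Finset.prod_eq_zero (Finset.mem_univ k) (by simp), sub_zero]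
  simp [Δα]

/-- `p_nc` in terms of the functions `ρₖ = rₖ²/4` and `σ₁`. -/
theorem pnc_eq_poly (ξ : Fin (D.m + 1) → ℝ) (t : ℝ) :
    pnc ξ t = D.poly (∑ j, ξ j - ∑ k : Fin D.m, D.α k.castSucc) (fun k => D.ρ k ξ) t := by
  set L := Fin.last D.m
  set H : Fin D.m → ℝ := fun k => (∏ i ∈ Finset.univ.erase L, (D.α k.castSucc - ξ i)) / D.Δα k
  have h1 : ∏ i ∈ Finset.univ.erase L, (t - ξ i) = D.A t + ∑ k : Fin D.m,
      H k * ∏ n ∈ Finset.univ.erase k, (t - D.α n.castSucc) := prod_erase_eq_A_add L t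
  have h2 : ∑ k, H k = ∑ k : Fin D.m, D.α k.castSucc - ∑ i ∈ Finset.univ.erase L, ξ i :=
    sum_prod_div_Δα ξ L
  have h3 : ∀ k, D.ρ k ξ = -(D.α k.castSucc - ξ L) * H k := fun k => by
    rw [ρ, pnc_eq_mul ξ L]
    simp only [H]
    ring
  have h4 : ∑ j, ξ j = ξ L + ∑ i ∈ Finset.univ.erase L, ξ i :=
    (Finset.add_sum_erase _ _ (Finset.mem_univ L)).symm
  have h5 : ∀ k, (t - ξ L) * (H k * ∏ n ∈ Finset.univ.erase k, (t - D.α n.castSucc)) =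
      D.A t * H k - D.ρ k ξ * ∏ n ∈ Finset.univ.erase k, (t - D.α n.castSucc) := fun k => by
    rw [h3, A_eq_mul D k]
    ring
  rw [pnc_eq_mul ξ L, h1, mul_add, Finset.mul_sum, Finset.sum_congr rfl fun k _ => h5 k,
    Finset.sum_sub_distrib, ← Finset.mul_sum, h2, poly, h4]
  ring

/-- A monic polynomial of degree `l` is determined by the sum of its roots and by its values at the
`αⱼ`. -/
theorem pnc_eq_poly_iff (ξ : Fin (D.m + 1) → ℝ) (c : ℝ) (w : Fin D.m → ℝ) :
    (∀ t, pnc ξ t = D.poly c w t) ↔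
      (∀ k, D.ρ k ξ = w k) ∧ ∑ j, ξ j - ∑ k : Fin D.m, D.α k.castSucc = c := by
  constructor
  · intro h
    have h1 : ∀ k, D.ρ k ξ = w k := fun k => by
      rw [ρ, h, poly_α, neg_neg, mul_div_cancel_right₀ _ (D.Δα_ne_zero k)]
    refine ⟨h1, ?_⟩
    have h2 := h D.αl
    rw [pnc_eq_poly, funext h1, poly, poly, sub_left_inj] at h2
    exact sub_right_injective (mul_left_cancel₀ A_αl_pos.ne' h2)
  · rintro ⟨h1, rfl⟩ t
    rw [pnc_eq_poly, funext h1]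

/-- The interval between `αⱼ₋₁` and `αⱼ` (with infinite ends for the first and the last `j`). -/
def slot (D : Data) (j : Fin (D.m + 1)) : Set ℝ :=
  {t | (∀ k : Fin D.m, k.castSucc < j → D.α k.castSucc < t) ∧
    ∀ k : Fin D.m, j ≤ k.castSucc → t < D.α k.castSucc}

theorem mem_slot {ξ : Fin (D.m + 1) → ℝ} (hξ : ξ ∈ D.domain) (j : Fin (D.m + 1)) :
    ξ j ∈ D.slot j :=
  ⟨fun _ hk => α_lt_of_lt hξ hk, fun _ hk => lt_α_of_le hξ hk⟩

theorem ne_α_of_mem_slot {j : Fin (D.m + 1)} {t : ℝ} (ht : t ∈ D.slot j) (k : Fin D.m) :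
    t ≠ D.α k.castSucc := by
  rcases lt_or_ge k.castSucc j with h | h
  · exact (ht.1 k h).ne'
  · exact (ht.2 k h).ne

theorem isOpen_slot (j : Fin (D.m + 1)) : IsOpen (D.slot j) := by
  refine IsOpen.and ?_ ?_ <;> simp only [Set.ofPred_forall]
  · exact isOpen_iInter_of_finite fun k => isOpen_iInter_of_finite fun _ =>
      isOpen_lt continuous_const continuous_id
  · exact isOpen_iInter_of_finite fun k => isOpen_iInter_of_finite fun _ =>
      isOpen_lt continuous_id continuous_const

theorem ordConnected_slot (j : Fin (D.m + 1)) : (D.slot j).OrdConnected :=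
  ⟨fun _ ha _ hb _ ht => ⟨fun k hk => (ha.1 k hk).trans_le ht.1,
    fun k hk => ht.2.trans_lt (hb.2 k hk)⟩⟩

/-- In its interval, `p_nc / A` changes sign exactly at `ξⱼ`. -/
theorem prod_div_A_pos {ξ : Fin (D.m + 1) → ℝ} (hξ : ξ ∈ D.domain) {j : Fin (D.m + 1)} {t : ℝ}
    (ht : t ∈ D.slot j) : 0 < (∏ i ∈ Finset.univ.erase j, (t - ξ i)) / D.A t := by
  unfold A
  rw [prod_erase_eq_prod_succAbove, ← Finset.prod_div_distrib]
  refine Finset.prod_pos fun k _ => ?_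
  rcases lt_or_ge k.castSucc j with h | h
  · rw [Fin.succAbove_of_castSucc_lt _ _ h]
    have := ht.1 k h
    exact div_pos (sub_pos.2 ((lt_α_of_le hξ le_rfl).trans this)) (sub_pos.2 this)
  · rw [Fin.succAbove_of_le_castSucc _ _ h]
    have := ht.2 k h
    exact div_pos_of_neg_of_neg (sub_neg.2 (this.trans (α_lt_of_lt hξ Fin.castSucc_lt_succ)))
      (sub_neg.2 this)

theorem rat_eq {ξ : Fin (D.m + 1) → ℝ} {c : ℝ} {w : Fin D.m → ℝ}
    (h : ∀ t, pnc ξ t = D.poly c w t) {j : Fin (D.m + 1)} {t : ℝ} (ht : t ∈ D.slot j) :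
    D.rat c w t = (t - ξ j) * ((∏ i ∈ Finset.univ.erase j, (t - ξ i)) / D.A t) := by
  have h1 := h t
  have hA : D.A t ≠ 0 := Finset.prod_ne_zero_iff.2 fun k _ =>
    sub_ne_zero.2 (ne_α_of_mem_slot ht k)
  rw [poly_eq_A_mul_rat c w (ne_α_of_mem_slot ht), pnc_eq_mul ξ j] at h1
  field_simp
  linarith

theorem rat_neg_iff {ξ : Fin (D.m + 1) → ℝ} (hξ : ξ ∈ D.domain) {c : ℝ} {w : Fin D.m → ℝ}
    (h : ∀ t, pnc ξ t = D.poly c w t) {j : Fin (D.m + 1)} {t : ℝ} (ht : t ∈ D.slot j) :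
    D.rat c w t < 0 ↔ t < ξ j := by
  rw [rat_eq h ht, ← neg_pos, ← neg_mul, mul_pos_iff_of_pos_right (prod_div_A_pos hξ ht), neg_sub,
    sub_pos]

theorem rat_pos_iff {ξ : Fin (D.m + 1) → ℝ} (hξ : ξ ∈ D.domain) {c : ℝ} {w : Fin D.m → ℝ}
    (h : ∀ t, pnc ξ t = D.poly c w t) {j : Fin (D.m + 1)} {t : ℝ} (ht : t ∈ D.slot j) :
    0 < D.rat c w t ↔ ξ j < t := by
  rw [rat_eq h ht, mul_pos_iff_of_pos_right (prod_div_A_pos hξ ht), sub_pos]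

theorem eq_of_pnc_eq_poly {ξ ξ' : Fin (D.m + 1) → ℝ} (hξ : ξ ∈ D.domain) (hξ' : ξ' ∈ D.domain)
    {c : ℝ} {w : Fin D.m → ℝ} (h : ∀ t, pnc ξ t = D.poly c w t)
    (h' : ∀ t, pnc ξ' t = D.poly c w t) : ξ = ξ' := by
  funext j
  have h1 := rat_eq h (mem_slot hξ j)
  have h2 := rat_eq h' (mem_slot hξ j)
  rw [h1, sub_self, zero_mul, eq_comm] at h2
  exact sub_eq_zero.1 ((mul_eq_zero.1 h2).resolve_right (prod_div_A_pos hξ' (mem_slot hξ j)).ne')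

section Existence

open Filter Topology

variable (c : ℝ) {w : Fin D.m → ℝ}

theorem continuousOn_rat : ContinuousOn (D.rat c w) {t | ∀ k : Fin D.m, t ≠ D.α k.castSucc} := by
  refine (continuousOn_id.sub continuousOn_const).sub (continuousOn_finsetSum _ fun k _ => ?_)
  exact continuousOn_const.div (continuousOn_id.sub continuousOn_const)
    fun t ht => sub_ne_zero.2 (ht k)

/-- The part of `rat` that is regular at `αₖ`. -/
theorem exists_rat_eq_add (w : Fin D.m → ℝ) (k : Fin D.m) : ∃ g : ℝ → ℝ,
    ContinuousAt g (D.α k.castSucc) ∧ ∀ t, D.rat c w t = g t + w k * -(t - D.α k.castSucc)⁻¹ := by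
  refine ⟨fun t => t - c - ∑ n ∈ Finset.univ.erase k, w n / (t - D.α n.castSucc), ?_, fun t => ?_⟩
  · refine ContinuousAt.sub (continuousAt_id.sub continuousAt_const) ?_
    refine tendsto_finsetSum _ fun n hn => ?_
    refine ContinuousAt.div continuousAt_const (continuousAt_id.sub continuousAt_const) ?_
    exact sub_ne_zero.2 fun h => Finset.ne_of_mem_erase hn (D.α_injective h).symm
  · rw [rat, ← Finset.add_sum_erase _ _ (Finset.mem_univ k)]
    ring

theorem tendsto_rat_nhdsGT {k : Fin D.m} (hw : 0 < w k) :
    Tendsto (D.rat c w) (𝓝[>] D.α k.castSucc) atBot := by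
  obtain ⟨g, hg, h⟩ := D.exists_rat_eq_add c w k
  rw [funext h]
  refine (hg.tendsto.mono_left nhdsWithin_le_nhds).add_atBot ?_
  refine Tendsto.const_mul_atBot hw (tendsto_neg_atTop_atBot.comp ?_)
  refine tendsto_inv_nhdsGT_zero.comp (tendsto_nhdsWithin_iff.2 ⟨?_, ?_⟩)
  · have : Tendsto (fun t => t - D.α k.castSucc) (𝓝 (D.α k.castSucc)) (𝓝 0) := by
      simpa using (tendsto_id (x := 𝓝 (D.α k.castSucc))).sub_const (D.α k.castSucc)
    exact this.mono_left nhdsWithin_le_nhds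
  · filter_upwards [self_mem_nhdsWithin] with t ht
    exact sub_pos.2 (Set.mem_Ioi.1 ht)

theorem tendsto_rat_nhdsLT {k : Fin D.m} (hw : 0 < w k) :
    Tendsto (D.rat c w) (𝓝[<] D.α k.castSucc) atTop := by
  obtain ⟨g, hg, h⟩ := D.exists_rat_eq_add c w k
  rw [funext h]
  refine (hg.tendsto.mono_left nhdsWithin_le_nhds).add_atTop ?_
  refine Tendsto.const_mul_atTop hw (tendsto_neg_atBot_atTop.comp ?_)
  refine tendsto_inv_nhdsLT_zero.comp (tendsto_nhdsWithin_iff.2 ⟨?_, ?_⟩)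
  · have : Tendsto (fun t => t - D.α k.castSucc) (𝓝 (D.α k.castSucc)) (𝓝 0) := by
      simpa using (tendsto_id (x := 𝓝 (D.α k.castSucc))).sub_const (D.α k.castSucc)
    exact this.mono_left nhdsWithin_le_nhds
  · filter_upwards [self_mem_nhdsWithin] with t ht
    exact sub_neg.2 (Set.mem_Iio.1 ht)

theorem tendsto_rat_atTop (w : Fin D.m → ℝ) : Tendsto (D.rat c w) atTop atTop := by
  have h : Tendsto (fun t => -c + -∑ k : Fin D.m, w k / (t - D.α k.castSucc)) atTop
      (𝓝 (-c + -∑ _k : Fin D.m, 0)) := tendsto_const_nhds.add (tendsto_finsetSum _ fun k _ =>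
    Tendsto.div_atTop tendsto_const_nhds (tendsto_atTop_add_const_right _ _ tendsto_id)).neg
  refine (tendsto_id.atTop_add h).congr fun t => ?_
  rw [rat, id]
  ring

theorem tendsto_rat_atBot (w : Fin D.m → ℝ) : Tendsto (D.rat c w) atBot atBot := by
  have h : Tendsto (fun t => -c + -∑ k : Fin D.m, w k / (t - D.α k.castSucc)) atBot
      (𝓝 (-c + -∑ _k : Fin D.m, 0)) := tendsto_const_nhds.add (tendsto_finsetSum _ fun k _ =>
    Tendsto.div_atBot tendsto_const_nhds (tendsto_atBot_add_const_right _ _ tendsto_id)).neg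
  refine (tendsto_id.atBot_add h).congr fun t => ?_
  rw [rat, id]
  ring

theorem exists_root_castSucc (hw : ∀ k, 0 < w k) (j : Fin D.m) :
    ∃ t ∈ D.slot j.castSucc, D.rat c w t = 0 := by
  have hslot : ∀ t, (∀ k : Fin D.m, k < j → D.α k.castSucc < t) → t < D.α j.castSucc →
      t ∈ D.slot j.castSucc := fun t h1 h2 =>
    ⟨fun k hk => h1 k hk, fun k hk => h2.trans_le (α_le hk)⟩
  have hb : ∃ b ∈ D.slot j.castSucc, 0 < D.rat c w b := by
    have h1 : ∀ᶠ t in 𝓝[<] D.α j.castSucc, ∀ k : Fin D.m, k < j → D.α k.castSucc < t := by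
      refine eventually_all.2 fun k => ?_
      by_cases hk : k < j
      · filter_upwards [nhdsWithin_le_nhds (Ioi_mem_nhds (D.strictMono_α
          (Fin.castSucc_lt_castSucc_iff.2 hk)))] with t ht _
        exact ht
      · exact Eventually.of_forall fun t h => absurd h hk
    obtain ⟨t, ht1, ht2, ht3⟩ := (h1.and (((tendsto_rat_nhdsLT c (hw j)).eventually_gt_atTop 0).and
      self_mem_nhdsWithin)).exists
    exact ⟨t, hslot t ht1 ht3, ht2⟩
  have ha : ∃ a ∈ D.slot j.castSucc, D.rat c w a < 0 := by
    by_cases hj : (j : ℕ) = 0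
    · obtain ⟨t, ht1, ht2⟩ := (((tendsto_rat_atBot c w).eventually_lt_atBot 0).and
        (eventually_lt_atBot (D.α j.castSucc))).exists
      refine ⟨t, hslot t (fun k hk => ?_) ht2, ht1⟩
      have : (k : ℕ) < j := hk
      omega
    · let n : Fin D.m := ⟨j - 1, by omega⟩
      have hn : n < j := Fin.lt_def.2 (by simp only [n]; omega)
      have h1 : ∀ᶠ t in 𝓝[>] D.α n.castSucc, t < D.α j.castSucc := nhdsWithin_le_nhds
        (Iio_mem_nhds (D.strictMono_α (Fin.castSucc_lt_castSucc_iff.2 hn)))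
      obtain ⟨t, ht1, ht2, ht3⟩ := (((tendsto_rat_nhdsGT c (hw n)).eventually_lt_atBot 0).and
        (h1.and self_mem_nhdsWithin)).exists
      refine ⟨t, hslot t (fun k hk => lt_of_le_of_lt (α_le (Fin.le_def.2 ?_)) ht3) ht2, ht1⟩
      have : (k : ℕ) < j := hk
      simp only [n]
      omega
  obtain ⟨a, ha, ha'⟩ := ha
  obtain ⟨b, hb, hb'⟩ := hb
  have hc : ContinuousOn (D.rat c w) (D.slot j.castSucc) :=
    (continuousOn_rat c).mono fun t ht => ne_α_of_mem_slot ht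
  obtain ⟨t, ht, h⟩ := (ordConnected_slot j.castSucc).isPreconnected.intermediate_value ha hb hc
    ⟨ha'.le, hb'.le⟩
  exact ⟨t, ht, h⟩

theorem exists_root_last (hl : D.rat c w D.αl < 0) : ∃ t, D.αl < t ∧ D.rat c w t = 0 := by
  obtain ⟨b, hb, hb'⟩ := (((tendsto_rat_atTop c w).eventually_gt_atTop 0).and
    (eventually_ge_atTop D.αl)).exists
  have hc : ContinuousOn (D.rat c w) (Set.Ici D.αl) :=
    (continuousOn_rat c).mono fun t ht k => ((α_lt_αl k).trans_le ht).ne'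
  obtain ⟨t, ht, h⟩ := isPreconnected_Ici.intermediate_value Set.self_mem_Ici hb' hc
    ⟨hl.le, hb.le⟩
  exact ⟨t, lt_of_le_of_ne ht fun h' => hl.ne (h' ▸ h), h⟩

open Polynomial in
/-- `poly` is the monic polynomial of degree `l` with given roots. -/
theorem pnc_eq_poly_of_roots (w : Fin D.m → ℝ) {ξ : Fin (D.m + 1) → ℝ}
    (hξ : Function.Injective ξ) (h : ∀ j, D.poly c w (ξ j) = 0) (t : ℝ) :
    pnc ξ t = D.poly c w t := by
  set p : ℝ[X] := Lagrange.nodal Finset.univ (fun k : Fin D.m => D.α k.castSucc) * (X - C c)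
  set s : ℝ[X] := ∑ k : Fin D.m,
    w k • Lagrange.nodal (Finset.univ.erase k) (fun k : Fin D.m => D.α k.castSucc)
  have heval : ∀ t, (p - s).eval t = D.poly c w t := fun t => by
    simp only [p, s, eval_sub, eval_mul, eval_X, eval_C, eval_finsetSum, eval_smul,
      Lagrange.eval_nodal, smul_eq_mul]
    rfl
  have hp : p.Monic := Lagrange.nodal_monic.mul (monic_X_sub_C c)
  have hpd : p.degree = (D.m + 1 : ℕ) := by
    rw [degree_mul, Lagrange.degree_nodal, degree_X_sub_C, Finset.card_univ, Fintype.card_fin]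
    rfl
  have hqd : (Lagrange.nodal Finset.univ ξ).degree = (D.m + 1 : ℕ) := by
    rw [Lagrange.degree_nodal, Finset.card_univ, Fintype.card_fin]
  have h1 : p - Lagrange.nodal Finset.univ ξ ∈ degreeLT ℝ (D.m + 1) := by
    rw [mem_degreeLT, ← hpd]
    exact degree_sub_lt_left (hpd.trans hqd.symm) hp.ne_zero
      (by rw [hp.leadingCoeff, Lagrange.nodal_monic.leadingCoeff])
  have h2 : s ∈ degreeLT ℝ (D.m + 1) := by
    refine Submodule.sum_mem _ fun k _ => Submodule.smul_mem _ _ (mem_degreeLT.2 ?_)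
    rw [Lagrange.degree_nodal, Finset.card_erase_of_mem (Finset.mem_univ k), Finset.card_univ,
      Fintype.card_fin]
    exact_mod_cast lt_of_le_of_lt (Nat.sub_le _ _) (Nat.lt_succ_self _)
  have h3 := Polynomial.eq_of_degree_sub_lt_of_eval_index_eq (f := p - s)
    (g := Lagrange.nodal Finset.univ ξ) (s := Finset.univ) (v := ξ) hξ.injOn (by
      rw [sub_right_comm, Finset.card_univ, Fintype.card_fin]
      exact mem_degreeLT.1 (Submodule.sub_mem _ h1 h2))
    (fun j _ => by
      rw [heval, h, Lagrange.eval_nodal_at_node (Finset.mem_univ j)])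
  rw [← heval, h3, Lagrange.eval_nodal]
  rfl

theorem exists_pnc_eq_poly (hw : ∀ k, 0 < w k) (hl : D.rat c w D.αl < 0) :
    ∃ ξ ∈ D.domain, ∀ t, pnc ξ t = D.poly c w t := by
  choose x hx hx0 using exists_root_castSucc c hw
  obtain ⟨b, hb, hb0⟩ := exists_root_last c hl
  have hdom : Fin.snoc (α := fun _ => ℝ) x b ∈ D.domain := by
    refine ⟨fun j => ?_, fun j k hjk => ?_, ?_⟩
    · rw [Fin.snoc_castSucc]
      exact (hx j).2 j le_rfl
    · rw [Fin.snoc_castSucc]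
      exact (hx k).1 j (Fin.lt_def.2 (by simp only [Fin.val_castSucc]; omega))
    · rwa [Fin.snoc_last]
  refine ⟨_, hdom, pnc_eq_poly_of_roots c w (strictMono_of_mem hdom).injective fun j => ?_⟩
  rw [poly_eq_A_mul_rat c w (ξ_ne_α hdom j)]
  induction j using Fin.lastCases with
  | last => rw [Fin.snoc_last, hb0, mul_zero]
  | cast j => rw [Fin.snoc_castSucc, hx0, mul_zero]

end Existence

/-! ### The embedding of `M⁰` into `E` -/

/-- The lifts of a point of `E` in the image of a point of `M⁰` correspond to the choices of the
angle of `w`. -/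
theorem proj_eq_proj_lift_iff {x : D.W} {s : ℝ} (hs : Complex.exp (s * Complex.I) = x.2.2)
    (y : D.Euc) : D.proj y = D.proj (D.lift (fun _ => s) x) ↔
      ∃ t : ℝ, Complex.exp (t * Complex.I) = x.2.2 ∧ y = D.lift (fun _ => t) x := by
  have hgen : ∀ n : ℤ, (D.gen ^ n) (D.lift (fun _ => s) x).fst =
      (D.lift (fun _ => s + n * (2 * Real.pi)) x).fst := fun n => by
    rw [gen_zpow_apply]
    refine (WithLp.ofLp_injective 2) (Prod.ext ?_ ?_)
    · refine PiLp.ext fun j => ?_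
      change D.rotation (D.τTorus ^ n) (D.lift (fun _ => s) x).fst.fst j =
        D.ζ (fun _ => s + n * (2 * Real.pi)) j x
      rw [rotation_apply]
      change (D.τTorus ^ n) j • D.ζ (fun _ => s) j x = _
      rw [ζ, ζ, Circle.smul_def, smul_smul]
      congr 1
      rw [Pi.pow_apply, Circle.coe_zpow, τTorus, Circle.coe_exp, ← Complex.exp_int_mul,
        mul_left_comm, ← Complex.exp_add]
      congr 2
      push_cast
      ring
    · change D.κ * s + n * D.shift = D.κ * (s + n * (2 * Real.pi))
      rw [shift_eq]
      ring
  rw [eq_comm, proj_eq_proj]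
  constructor
  · rintro ⟨⟨n, hn⟩, h⟩
    refine ⟨s + n * (2 * Real.pi), ?_, ?_⟩
    · rw [← hs, Complex.exp_eq_exp_iff_exists_int]
      exact ⟨n, by push_cast; ring⟩
    · rw [hgen] at hn
      exact (WithLp.ofLp_injective 2) (Prod.ext hn.symm h.symm)
  · rintro ⟨t, ht, rfl⟩
    rw [← hs, Complex.exp_eq_exp_iff_exists_int] at ht
    obtain ⟨n, hn⟩ := ht
    have : t = s + n * (2 * Real.pi) := by
      have h : (t : ℂ) * Complex.I = ((s + n * (2 * Real.pi) : ℝ) : ℂ) * Complex.I := by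
        rw [hn]; push_cast; ring
      exact Complex.ofReal_injective (mul_right_cancel₀ Complex.I_ne_zero h)
    subst this
    exact ⟨⟨n, hgen n⟩, rfl⟩

theorem exp_arg {w : ℂ} (hw : ‖w‖ = 1) : Complex.exp (w.arg * Complex.I) = w := by
  have := Complex.norm_mul_exp_arg_mul_I w
  rwa [hw, Complex.ofReal_one, one_mul] at this

theorem exp_angle {w₀ w : ℂ} (hw₀ : ‖w₀‖ = 1) (hw : ‖w‖ = 1) :
    Complex.exp (angle w₀ w * Complex.I) = w := by
  have h0 : w₀ ≠ 0 := norm_ne_zero_iff.1 (by rw [hw₀]; exact one_ne_zero)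
  rw [angle, Complex.log_im, Complex.ofReal_add, add_mul, Complex.exp_add, exp_arg hw₀, exp_arg,
    div_mul_cancel₀ _ h0]
  rw [norm_div, hw, hw₀, div_one]

/-- The embedding of `M⁰` into `E`. -/
def Φ (D : Data) (x : D.M0) : D.E := D.proj (D.lift Complex.arg x)

/-- The lifts of `Φ x` are given by the real numbers that are angles of the last circle. -/
theorem proj_eq_Φ_iff (x : D.M0) (y : D.Euc) : D.proj y = D.Φ x ↔
    ∃ t : ℝ, Complex.exp (t * Complex.I) = x.1.2.2 ∧ y = D.lift (fun _ => t) x :=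
  proj_eq_proj_lift_iff (exp_arg x.2.2.2) y

theorem proj_lift_angle {w₀ : ℂ} (hw₀ : ‖w₀‖ = 1) (x : D.M0) :
    D.proj (D.lift (angle w₀) x) = D.Φ x :=
  (proj_eq_Φ_iff x _).2 ⟨_, exp_angle hw₀ x.2.2.2, rfl⟩

theorem isIsometricImmersion_Φ : D.IsIsometricImmersion D.Φ := fun x₀ hx₀ =>
  ⟨D.chart x₀.2.2, D.lift (angle x₀.2.2), isOpen_chart _, mem_chart hx₀, contDiffOn_lift _,
    fun x hx hw => ⟨proj_lift_angle hx₀.2.2 ⟨x, hx⟩, fun _ hu _ hu' =>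
      inner_fderiv_lift hx hw hu hu'⟩⟩

theorem radius_lift (t : ℂ → ℝ) (j : Fin D.m) (x : D.W) :
    D.radius j (D.lift t x) = ‖D.ζ t j x‖ := rfl

theorem lift_fst_fst (t : ℂ → ℝ) (x : D.W) (j : Fin D.m) : (D.lift t x).fst.fst j = D.ζ t j x := rfl

theorem lift_fst_snd (t : ℂ → ℝ) (x : D.W) : (D.lift t x).fst.snd = D.κ * t x.2.2 := rfl

theorem Euc_ext {y y' : D.Euc} (h₁ : ∀ j, y.fst.fst j = y'.fst.fst j)
    (h₂ : y.fst.snd = y'.fst.snd) (h₃ : y.snd = y'.snd) : y = y' :=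
  WithLp.ofLp_injective 2 (Prod.ext (WithLp.ofLp_injective 2 (Prod.ext (PiLp.ext h₁) h₂)) h₃)

theorem lift_snd (t : ℂ → ℝ) (x : D.W) : (D.lift t x).snd = D.σ₁ x - ∑ k, D.α k := rfl

theorem radius_and_snd_of_proj_eq (x : D.M0) (y : D.Euc) (h : D.proj y = D.Φ x) :
    (∀ j, D.radius j y = D.r j x) ∧ y.snd = D.σ₁ x - ∑ k, D.α k := by
  obtain ⟨t, -, h'⟩ := (proj_eq_Φ_iff x y).1 h
  rw [h']
  exact ⟨fun j => (radius_lift (fun _ => t) j x.1).trans (norm_ζ x.2 (fun _ => t) j),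
    lift_snd (fun _ => t) x.1⟩

/-- The preimage in the Euclidean space of the image of the embedding. -/
def region (D : Data) : Set D.Euc :=
  {y : D.Euc | (∀ j, 0 < D.radius j y) ∧
    1 / 4 * ∑ j : Fin D.m, 1 / (D.αl - D.α j.castSucc) * D.radius j y ^ 2 > -y.snd}

theorem continuous_radius (j : Fin D.m) : Continuous (D.radius j) := by
  have h1 : Continuous fun y : D.Euc => y.fst.fst := by fun_prop
  exact ((PiLp.continuous_apply 2 _ j).comp h1).norm

theorem continuous_snd_Euc : Continuous fun y : D.Euc => y.snd := by fun_prop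

theorem isOpen_region : IsOpen D.region := by
  refine IsOpen.and ?_ (isOpen_lt continuous_snd_Euc.neg ?_)
  · simp only [Set.ofPred_forall]
    exact isOpen_iInter_of_finite fun k => isOpen_lt continuous_const (continuous_radius k)
  · exact continuous_const.mul (continuous_finsetSum _ fun k _ =>
      continuous_const.mul ((continuous_radius k).pow 2))

/-- The value of `rat` at `α_l`, which expresses the inequality that defines the region. -/
theorem rat_αl (s : ℝ) (R : Fin D.m → ℝ) : D.rat (s + D.αl) (fun k => R k ^ 2 / 4) D.αl =
    -(1 / 4 * ∑ j : Fin D.m, 1 / (D.αl - D.α j.castSucc) * R j ^ 2) - s := by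
  have e : ∑ k : Fin D.m, R k ^ 2 / 4 / (D.αl - D.α k.castSucc) =
      1 / 4 * ∑ j : Fin D.m, 1 / (D.αl - D.α j.castSucc) * R j ^ 2 := by
    rw [Finset.mul_sum]
    exact Finset.sum_congr rfl fun k _ => by ring
  rw [rat, e]
  ring

theorem exists_roots {y : D.Euc} (hy : y ∈ D.region) : ∃ ξ ∈ D.domain,
    ∀ t, pnc ξ t = D.poly (y.snd + D.αl) (fun k => D.radius k y ^ 2 / 4) t := by
  refine exists_pnc_eq_poly _ (fun k => ?_) ?_
  · have := hy.1 k
    positivity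
  · rw [rat_αl]
    have := hy.2
    linarith

open Classical in
/-- The coordinates `ξ` as functions on the region of the Euclidean space. -/
def roots (D : Data) (y : D.Euc) : Fin (D.m + 1) → ℝ :=
  if hy : y ∈ D.region then (exists_roots hy).choose else 0

theorem roots_mem {y : D.Euc} (hy : y ∈ D.region) : D.roots y ∈ D.domain := by
  rw [roots, dif_pos hy]
  exact (exists_roots hy).choose_spec.1

theorem pnc_roots {y : D.Euc} (hy : y ∈ D.region) (t : ℝ) : pnc (D.roots y) t =
    D.poly (y.snd + D.αl) (fun k => D.radius k y ^ 2 / 4) t := by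
  rw [roots, dif_pos hy]
  exact (exists_roots hy).choose_spec.2 t

theorem r_eq_radius_iff {ξ : Fin (D.m + 1) → ℝ} (hξ : ξ ∈ D.domain) (k : Fin D.m) {R : ℝ}
    (hR : 0 ≤ R) : 2 * √(D.ρ k ξ) = R ↔ D.ρ k ξ = R ^ 2 / 4 := by
  have h := Real.sq_sqrt (ρ_pos hξ k).le
  constructor
  · rintro rfl
    rw [mul_pow, h]
    ring
  · intro h'
    rw [h', Real.sqrt_div' _ (by norm_num), Real.sqrt_sq hR,
      show (4 : ℝ) = 2 ^ 2 by norm_num, Real.sqrt_sq two_pos.le]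
    ring

theorem pnc_eq_iff {ξ : Fin (D.m + 1) → ℝ} (hξ : ξ ∈ D.domain) (y : D.Euc) :
    (∀ t, pnc ξ t = D.poly (y.snd + D.αl) (fun k => D.radius k y ^ 2 / 4) t) ↔
      (∀ k, 2 * √(D.ρ k ξ) = D.radius k y) ∧ y.snd = ∑ j, ξ j - ∑ k, D.α k := by
  rw [pnc_eq_poly_iff]
  refine and_congr (forall_congr' fun k => (r_eq_radius_iff hξ k (norm_nonneg _)).symm) ?_
  rw [Fin.sum_univ_castSucc D.α, ← αl]
  constructor <;> intro h <;> linarith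

/-- `σ₁` and the radii of a point of `M⁰` satisfy the inequality of the region, as `p_nc` is
negative at `α_l`. -/
theorem lift_mem_region {x : D.W} (hx : x ∈ D.M0) (t : ℂ → ℝ) : D.lift t x ∈ D.region := by
  have hr : ∀ j, D.radius j (D.lift t x) = D.r j x := fun j =>
    (radius_lift t j x).trans (norm_ζ hx t j)
  refine ⟨fun j => by rw [hr]; exact r_pos hx.1 j, ?_⟩
  have h1 := (pnc_eq_iff hx.1 (D.lift t x)).2 ⟨fun k => (hr k).symm, by rw [← σ₁_eq, lift_snd]⟩
  have h2 : D.αl ∈ D.slot (Fin.last D.m) :=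
    ⟨fun k _ => α_lt_αl k, fun k hk => absurd hk (not_le.2 (Fin.castSucc_lt_last k))⟩
  have h3 := (rat_neg_iff hx.1 h1 h2).2 hx.1.2.2
  rw [rat_αl] at h3
  linarith

/-- The roots depend continuously on the parameters: the sign of `rat` at a point of an interval
tells on which side of that point the root lies. -/
theorem continuousOn_roots : ContinuousOn D.roots D.region := by
  refine continuousOn_pi.2 fun j y₀ hy₀ => ?_
  have hcont : ∀ t : ℝ, (∀ k : Fin D.m, t ≠ D.α k.castSucc) → Continuous fun y : D.Euc =>
      D.rat (y.snd + D.αl) (fun k => D.radius k y ^ 2 / 4) t := fun t ht =>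
    (continuous_const.sub (continuous_snd_Euc.add continuous_const)).sub
      (continuous_finsetSum _ fun k _ =>
        (((continuous_radius k).pow 2).div_const 4).div_const (t - D.α k.castSucc))
  have hslot : D.slot j ∈ nhds (D.roots y₀ j) :=
    (isOpen_slot j).mem_nhds (mem_slot (roots_mem hy₀) j)
  refine tendsto_order.2 ⟨fun a ha => ?_, fun a ha => ?_⟩
  · obtain ⟨t, ht, ht2⟩ := Filter.Eventually.exists (Filter.Eventually.and
      (Ioo_mem_nhdsLT ha) (nhdsWithin_le_nhds hslot))
    have h1 := (rat_neg_iff (roots_mem hy₀) (pnc_roots hy₀) ht2).2 ht.2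
    have h2 := (hcont t (ne_α_of_mem_slot ht2)).continuousAt.eventually_lt_const h1
    filter_upwards [nhdsWithin_le_nhds h2, self_mem_nhdsWithin] with y hy hyr
    exact ht.1.trans ((rat_neg_iff (roots_mem hyr) (pnc_roots hyr) ht2).1 hy)
  · obtain ⟨t, ht, ht2⟩ := Filter.Eventually.exists (Filter.Eventually.and
      (Ioo_mem_nhdsGT ha) (nhdsWithin_le_nhds hslot))
    have h1 := (rat_pos_iff (roots_mem hy₀) (pnc_roots hy₀) ht2).2 ht.1
    have h2 := (hcont t (ne_α_of_mem_slot ht2)).continuousAt.eventually_const_lt h1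
    filter_upwards [nhdsWithin_le_nhds h2, self_mem_nhdsWithin] with y hy hyr
    exact ((rat_pos_iff (roots_mem hyr) (pnc_roots hyr) ht2).1 hy).trans ht.2

/-- The map from the region of the Euclidean space to `M⁰` that inverts the flat coordinates. -/
def Ψ (D : Data) (y : D.Euc) : D.W :=
  (D.roots y,
    fun j => (((D.radius j y)⁻¹ : ℝ) *
      Complex.exp (-(D.τ j * (y.fst.snd / D.κ) : ℝ) * Complex.I) : ℂ) • y.fst.fst j,
    Complex.exp ((y.fst.snd / D.κ : ℝ) * Complex.I))

theorem Ψ_snd_fst (y : D.Euc) (j : Fin D.m) : (D.Ψ y).2.1 j = (((D.radius j y)⁻¹ : ℝ) *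
    Complex.exp (-(D.τ j * (y.fst.snd / D.κ) : ℝ) * Complex.I) : ℂ) • y.fst.fst j := rfl

theorem Ψ_snd_snd (y : D.Euc) :
    (D.Ψ y).2.2 = Complex.exp ((y.fst.snd / D.κ : ℝ) * Complex.I) := rfl

theorem radius_eq (j : Fin D.m) (y : D.Euc) : D.radius j y = ‖y.fst.fst j‖ := rfl

theorem continuousOn_Ψ : ContinuousOn D.Ψ D.region := by
  have h1 : Continuous fun y : D.Euc => y.fst.snd / D.κ := by fun_prop
  have h2 : Continuous fun y : D.Euc => y.fst.fst := by fun_prop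
  refine continuousOn_roots.prodMk (ContinuousOn.prodMk (continuousOn_pi.2 fun j => ?_) ?_)
  · have h3 : ContinuousOn (fun y : D.Euc => (((D.radius j y)⁻¹ : ℝ) : ℂ)) D.region :=
      Complex.continuous_ofReal.comp_continuousOn
        ((continuous_radius j).continuousOn.inv₀ fun y hy => (hy.1 j).ne')
    have h4 : Continuous fun y : D.Euc =>
        Complex.exp (-(D.τ j * (y.fst.snd / D.κ) : ℝ) * Complex.I) :=
      Complex.continuous_exp.comp ((Complex.continuous_ofReal.comp
        (continuous_const.mul h1)).neg.mul continuous_const)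
    have h5 : Continuous fun y : D.Euc => y.fst.fst j := (PiLp.continuous_apply 2 _ j).comp h2
    exact ContinuousOn.smul (h3.mul h4.continuousOn) h5.continuousOn
  · exact (Complex.continuous_exp.comp ((Complex.continuous_ofReal.comp h1).mul
      continuous_const)).continuousOn

theorem Ψ_mem {y : D.Euc} (hy : y ∈ D.region) : D.Ψ y ∈ D.M0 := by
  refine ⟨roots_mem hy, fun j => ?_, Complex.norm_exp_ofReal_mul_I _⟩
  rw [Ψ_snd_fst, norm_smul, norm_mul, ← Complex.ofReal_neg, Complex.norm_exp_ofReal_mul_I, mul_one,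
    Complex.norm_real, Real.norm_of_nonneg (inv_nonneg.2 (hy.1 j).le), ← radius_eq,
    inv_mul_cancel₀ (hy.1 j).ne']

theorem lift_Ψ {y : D.Euc} (hy : y ∈ D.region) :
    y = D.lift (fun _ => y.fst.snd / D.κ) (D.Ψ y) := by
  obtain ⟨h1, h2⟩ := (pnc_eq_iff (roots_mem hy) y).1 (pnc_roots hy)
  refine Euc_ext (fun j => ?_) ?_ ?_
  · have h3 : D.r j (D.Ψ y) = D.radius j y := h1 j
    have h4 : (D.radius j y : ℂ) ≠ 0 := Complex.ofReal_ne_zero.2 (hy.1 j).ne'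
    rw [lift_fst_fst, ζ, h3, Ψ_snd_fst, smul_smul, mul_mul_mul_comm, ← Complex.exp_add,
      Complex.ofReal_inv, mul_inv_cancel₀ h4, neg_mul, add_neg_cancel, Complex.exp_zero, one_mul,
      one_smul]
  · rw [lift_fst_snd, mul_div_cancel₀ _ κ_ne_zero]
  · rw [lift_snd, σ₁_eq]
    exact h2

theorem Ψ_lift {x : D.W} (hx : x ∈ D.M0) {t : ℝ} (ht : Complex.exp (t * Complex.I) = x.2.2) :
    D.Ψ (D.lift (fun _ => t) x) = x := by
  have hmem := lift_mem_region hx fun _ => t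
  have hr : ∀ j, D.radius j (D.lift (fun _ => t) x) = D.r j x := fun j =>
    (radius_lift _ j x).trans (norm_ζ hx (fun _ => t) j)
  have ht' : (D.lift (fun _ => t) x).fst.snd / D.κ = t := mul_div_cancel_left₀ t κ_ne_zero
  refine Prod.ext ?_ (Prod.ext (funext fun j => ?_) ?_)
  · exact eq_of_pnc_eq_poly (roots_mem hmem) hx.1 (pnc_roots hmem)
      ((pnc_eq_iff hx.1 _).2 ⟨fun k => (hr k).symm, by rw [← σ₁_eq, lift_snd]⟩)
  · have h4 : (D.r j x : ℂ) ≠ 0 := Complex.ofReal_ne_zero.2 (r_pos hx.1 j).ne'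
    rw [Ψ_snd_fst, ht', hr, lift_fst_fst, ζ, smul_smul, mul_mul_mul_comm, ← Complex.exp_add,
      Complex.ofReal_inv, inv_mul_cancel₀ h4, neg_mul, neg_add_cancel, Complex.exp_zero, one_mul,
      one_smul]
  · rw [Ψ_snd_snd, ht', ht]

theorem mem_region_of_proj_eq {x : D.M0} {y : D.Euc} (h : D.proj y = D.Φ x) :
    y ∈ D.region ∧ D.Ψ y = x := by
  obtain ⟨t, ht, rfl⟩ := (proj_eq_Φ_iff x y).1 h
  exact ⟨lift_mem_region x.2 _, Ψ_lift x.2 ht⟩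

theorem Φ_Ψ {y : D.Euc} (hy : y ∈ D.region) : D.Φ ⟨D.Ψ y, Ψ_mem hy⟩ = D.proj y :=
  ((proj_eq_Φ_iff ⟨D.Ψ y, Ψ_mem hy⟩ y).2 ⟨y.fst.snd / D.κ, rfl, lift_Ψ hy⟩).symm

theorem range_Φ : Set.range D.Φ = D.proj '' D.region := by
  ext e
  constructor
  · rintro ⟨x, rfl⟩
    obtain ⟨y, hy⟩ := proj_surjective (D.Φ x)
    exact ⟨y, (mem_region_of_proj_eq hy).1, hy⟩
  · rintro ⟨y, hy, rfl⟩
    exact ⟨_, Φ_Ψ hy⟩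

theorem continuous_Φ : Continuous D.Φ := by
  refine continuous_iff_continuousAt.2 fun x₀ => ?_
  have h1 : ContinuousAt (D.lift (angle x₀.1.2.2)) x₀.1 :=
    (contDiffOn_lift _).continuousOn.continuousAt ((isOpen_chart _).mem_nhds (mem_chart x₀.2))
  have h2 : ContinuousAt (fun x : D.M0 => D.proj (D.lift (angle x₀.1.2.2) x)) x₀ :=
    continuous_proj.continuousAt.comp
      (ContinuousAt.comp (g := D.lift (angle x₀.1.2.2)) h1 continuous_subtype_val.continuousAt)
  exact h2.congr (Filter.Eventually.of_forall fun x => proj_lift_angle x₀.2.2.2 x)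

theorem isOpenEmbedding_Φ : Topology.IsOpenEmbedding D.Φ := by
  refine .of_continuous_injective_isOpenMap continuous_Φ (fun x x' h => ?_) fun U hU => ?_
  · obtain ⟨y, hy⟩ := proj_surjective (D.Φ x)
    exact Subtype.ext ((mem_region_of_proj_eq hy).2.symm.trans
      (mem_region_of_proj_eq (hy.trans h)).2)
  · obtain ⟨V, hV, rfl⟩ := isOpen_induced_iff.1 hU
    have e : D.Φ '' (Subtype.val ⁻¹' V) = D.proj '' (D.region ∩ D.Ψ ⁻¹' V) := by
      ext e
      constructor
      · rintro ⟨x, hx, rfl⟩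
        obtain ⟨y, hy⟩ := proj_surjective (D.Φ x)
        obtain ⟨h1, h2⟩ := mem_region_of_proj_eq hy
        exact ⟨y, ⟨h1, by rw [Set.mem_preimage, h2]; exact hx⟩, hy⟩
      · rintro ⟨y, ⟨hy, hy'⟩, rfl⟩
        exact ⟨_, hy', Φ_Ψ hy⟩
    rw [e]
    exact isOpenMap_proj _ (continuousOn_Ψ.isOpen_inter_preimage isOpen_region hV)

end Data

end TaubNUT

end

theorem mainTheorem2 (D : TaubNUT.Data) :
    -- `g'` is a Riemannian metric on `M⁰` and `g' = dσ₁² + β₀² + ∑ⱼ g_{ℝ^{2dⱼ+2}}`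
    (∀ x ∈ D.M0, ∀ u ∈ D.tangent x, u ≠ 0 → 0 < D.gPrime x u u) ∧
    (∀ x ∈ D.M0, ∀ u ∈ D.tangent x, ∀ u' ∈ D.tangent x,
      D.gPrime x u u' = fderiv ℝ D.σ₁ x u * fderiv ℝ D.σ₁ x u' + D.β₀ x u * D.β₀ x u' +
        ∑ j, D.gCone j x u u') ∧
    -- `β₀` is locally exact and the summands of the last sum are locally the Euclidean metrics
    -- of `ℂ^{dⱼ+1}`, with radius `rⱼ`
    (∀ x₀ ∈ D.M0, ∃ (N : Set D.W) (s : D.W → ℝ)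
      (ζ : (j : Fin D.m) → D.W → EuclideanSpace ℂ (Fin (D.d j + 1))),
      IsOpen N ∧ x₀ ∈ N ∧ ContDiffOn ℝ (⊤ : ℕ∞) s N ∧ (∀ j, ContDiffOn ℝ (⊤ : ℕ∞) (ζ j) N) ∧
      ∀ x ∈ D.M0, x ∈ N → (∀ j, ‖ζ j x‖ = D.r j x) ∧
        (∀ u ∈ D.tangent x, fderiv ℝ s x u = D.β₀ x u) ∧
        ∀ j, ∀ u ∈ D.tangent x, ∀ u' ∈ D.tangent x,
          inner ℝ (fderiv ℝ (ζ j) x u) (fderiv ℝ (ζ j) x u') = D.gCone j x u u') ∧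
    -- the `ℤ`-action is free and properly discontinuous, and `E` is a complete flat manifold
    (∀ n : ℤ, n ≠ 0 → ∀ y, (D.gen ^ n) y ≠ y) ∧
    (∀ K : Set (WithLp 2 (D.V × ℝ)), IsCompact K →
      {n : ℤ | ((D.gen ^ n) '' K ∩ K).Nonempty}.Finite) ∧
    (∀ e e' : D.E, dist e e' = 0 → e = e') ∧
    CompleteSpace D.E ∧
    (∀ y : D.Euc, ∃ ε > 0,
      (∀ y₁ ∈ Metric.ball y ε, ∀ y₂ ∈ Metric.ball y ε,
        dist (D.proj y₁) (D.proj y₂) = dist y₁ y₂) ∧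
      D.proj '' Metric.ball y ε = Metric.ball (D.proj y) ε) ∧
    (∀ e e' : D.E, ∃ γ : ℝ → D.E, γ 0 = e ∧ γ (dist e e') = e' ∧
      ∀ s ∈ Set.Icc 0 (dist e e'), ∀ t ∈ Set.Icc 0 (dist e e'), dist (γ s) (γ t) = |s - t|) ∧
    -- the isometric embedding of `(M⁰, g')` onto an open subset of `E`
    (∃ Φ : D.M0 → D.E, Topology.IsOpenEmbedding Φ ∧ D.IsIsometricImmersion Φ ∧
      (∀ (x : D.M0) (y : D.Euc), D.proj y = Φ x →
        (∀ j, D.radius j y = D.r j x) ∧ y.snd = D.σ₁ x - ∑ k, D.α k) ∧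
      Set.range Φ = D.proj '' {y : D.Euc | (∀ j, 0 < D.radius j y) ∧
        1 / 4 * ∑ j : Fin D.m, 1 / (D.αl - D.α j.castSucc) * D.radius j y ^ 2 > -y.snd}) ∧
    -- `(∏ ℂ^{dⱼ+1} / Λ) × ℝ` is the unique asymptotic cone of `E`
    (∀ z z' : D.Cone, dist z z' = 0 → z = z') ∧
    ProperSpace D.Cone ∧
    (∀ (p : D.E) (c : ℕ → ℝ), (∀ i, 0 < c i) → Filter.Tendsto c Filter.atTop (nhds 0) →
      TaubNUT.RescalingsConverge D.E p c D.Cone D.apex) ∧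
    (∀ (Y : Type*) [MetricSpace Y] [ProperSpace Y] (y : Y),
      TaubNUT.IsAsymptoticCone D.E Y y → ∃ e : Y ≃ᵢ D.Cone, e y = D.apex) := by
  refine ⟨fun x hx u hu => TaubNUT.Data.gPrime_pos hx hu,
    fun x hx u _ u' _ => TaubNUT.Data.gPrime_eq_sum_gCone hx.1 u u', fun x₀ hx₀ => ?_,
    TaubNUT.Data.gen_zpow_ne, TaubNUT.Data.finite_setOf_gen_zpow_inter,
    fun _ _ => TaubNUT.Data.E_eq_of_dist_eq_zero, inferInstance, fun y => ?_,
    TaubNUT.Data.exists_geodesic, ⟨D.Φ, TaubNUT.Data.isOpenEmbedding_Φ,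
      TaubNUT.Data.isIsometricImmersion_Φ, TaubNUT.Data.radius_and_snd_of_proj_eq,
      TaubNUT.Data.range_Φ⟩, fun _ _ => TaubNUT.Data.Cone_eq_of_dist_eq_zero, inferInstance,
    TaubNUT.Data.rescalingsConverge, fun Y _ _ y => ?_⟩
  · exact ⟨D.chart x₀.2.2, fun x => D.κ * TaubNUT.Data.angle x₀.2.2 x.2.2,
      D.ζ (TaubNUT.Data.angle x₀.2.2), TaubNUT.Data.isOpen_chart _, TaubNUT.Data.mem_chart hx₀,
      contDiffOn_const.mul (TaubNUT.Data.contDiffOn_angle_comp _), TaubNUT.Data.contDiffOn_ζ _,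
      fun x hx hw => ⟨TaubNUT.Data.norm_ζ hx _,
        fun u _ => TaubNUT.Data.fderiv_κ_mul_angle hx hw u,
        fun j u hu u' hu' => TaubNUT.Data.inner_fderiv_ζ hx hw j hu hu'⟩⟩
  · exact ⟨|D.shift| / 4, div_pos (abs_pos.2 TaubNUT.Data.shift_ne_zero) four_pos,
      fun y₁ h₁ y₂ h₂ => TaubNUT.Data.dist_proj_eq h₁ h₂, TaubNUT.Data.image_proj_ball y _⟩
  · rintro ⟨p, c, hc, hc0, h⟩
    exact h.exists_isometryEquiv (fun _ _ => TaubNUT.Data.Cone_eq_of_dist_eq_zero)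
      (TaubNUT.Data.rescalingsConverge p c hc hc0)
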